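/- Let $\ell$ be a prime number and let $K$ be a number field containing the $2\ell$-th roots of unity. Let $\ell^m$ be the order of the group of roots of unity of $\ell$-power order in $K$. Inside a fixed algebraic closure of $K$, let $K_n=K(\mu_{\ell^{m+n}})$ for $n\ge 0$ (so $K_0=K$), and let $K_\infty=\bigcup_n K_n$ be the cyclotomic $\mathbb Z_\ell$-extension of $K$. Let $\gamma$ be the topological generator of $\mathrm{Gal}(K_\infty/K)$ defined by $\zeta^\gamma=\zeta^{1+\ell^m}$ for every root of unity $\zeta$ of $\ell$-power order, and put $\gamma^*=(1+\ell^m)^{-1}\gamma$. For a field $F$ put $\mathcal R_F=\mathbb Z_\ell\otimes_{\mathbb Z}F^\times$, $V_F=\mathbb Q_\ell\otimes_{\mathbb Z}F^\times$ and $\mathfrak R_F=(\mathbb Q_\ell/\mathbb Z_\ell)\otimes_{\mathbb Z}F^\times$. Let $\mu_{K_n}\subseteq\mathcal R_{K_n}$ be the image of the group of roots of unity of $\ell$-power order in $K_n$, and let $\mathfrak R_{K_n}^{\Gamma^*}$ be the submodule of the elements of $\mathfrak R_{K_n}$ fixed by $\gamma^*$. Let $Z$ be the compositum of all $\mathbb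 Z_\ell$-extensions of $K$, and let $${}_{\ell^m}\mathfrak Z_K=\{\ell^{-m}\otimes x\in\mathfrak R_K \;:\; x\in K^\times,\ K_\infty[\sqrt[\ell^m]{x}]\subseteq Z\}$$ be the initial radical. Then: 1. For every $n\ge 0$ the operator $\gamma^*-1$ is bijective on $V_{K_n}$, and the connecting map of the snake lemma for $\gamma^*-1$ acting on the exact sequence $1\to\mathcal R_{K_n}/\mu_{K_n}\to V_{K_n}\to\mathfrak R_{K_n}\to 1$ is a $\mathbb Z_\ell$-linear isomorphism $$\delta_n:\ \mathfrak R_{K_n}^{\Gamma^*}\ \xrightarrow{\ \sim\ }\ \mathcal R_{K_n}/\mathcal R_{K_n}^{\gamma^*-1}\mu_{K_n};$$ that is, $\delta_n(y)$ is the class of $r\in\mathcal R_{K_n}$ whenever $v\in V_{K_n}$ lifts $y$ and $v^{\gamma^*-1}$ is the image of $r$ in $V_{K_n}$. 2. The norm $K_{n+1}^\times\to K_n^\times$ induces maps $\mathfrak R_{K_{n+1}}^{\Gamma^*}\to\mathfrak R_{K_n}^{\Gamma^*}$ and $\mathcal R_{K_{n+1}}/\mathcal R_{K_{n+1}}^{\gamma^*-1}\mu_{K_{n+1}}\to\mathcal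 R_{K_n}/\mathcal R_{K_n}^{\gamma^*-1}\mu_{K_n}$, and the isomorphisms $\delta_n$ commute with them. 3. The initial radical ${}_{\ell^m}\mathfrak Z_K$ is contained in $\mathfrak R_{K_0}^{\Gamma^*}$, and $\delta_0$ identifies it with the module of initial terms of the projective limit, for the norm maps, of these quotients: $${}_{\ell^m}\mathfrak Z_K=\pi_0\Bigl(\varprojlim_n\ \mathcal R_{K_n}/\mathcal R_{K_n}^{\gamma^*-1}\mu_{K_n}\Bigr),$$ where $\pi_0$ sends a sequence $(c_n)_{n\ge 0}$ to $c_0$. -/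

import Mathlib

open scoped TensorProduct

namespace CycloKummer

/-! ### `ℓ`-adified multiplicative groups (written additively) -/

section Adified

variable (ℓ : ℕ) [Fact ℓ.Prime]

/-- The `ℤ_ℓ`-module `ℚ_ℓ / ℤ_ℓ`. -/
abbrev QlModZl : Type := ℚ_[ℓ] ⧸ LinearMap.range (Algebra.linearMap ℤ_[ℓ] ℚ_[ℓ])

/-- The `ℓ`-adic group of principal ideles `𝓡_F = ℤ_ℓ ⊗ Fˣ`. -/
abbrev PrincipalIdeles (F : Type*) [Field F] : Type _ := ℤ_[ℓ] ⊗[ℤ] Additive Fˣ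

/-- The space `V_F = ℚ_ℓ ⊗ Fˣ`. -/
abbrev RationalIdeles (F : Type*) [Field F] : Type _ := ℚ_[ℓ] ⊗[ℤ] Additive Fˣ

/-- The universal `ℓ`-radical `𝔕_F = (ℚ_ℓ / ℤ_ℓ) ⊗ Fˣ`. -/
abbrev UniversalRadical (F : Type*) [Field F] : Type _ := QlModZl ℓ ⊗[ℤ] Additive Fˣ

/-- The natural map `𝓡_F → V_F`. -/
noncomputable def toRational (F : Type*) [Field F] :
    PrincipalIdeles ℓ F →ₗ[ℤ_[ℓ]] RationalIdeles ℓ F :=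
  TensorProduct.AlgebraTensorModule.rTensor ℤ (Additive Fˣ) (Algebra.linearMap ℤ_[ℓ] ℚ_[ℓ])

/-- The natural map `V_F → 𝔕_F`. -/
noncomputable def toRadical (F : Type*) [Field F] :
    RationalIdeles ℓ F →ₗ[ℤ_[ℓ]] UniversalRadical ℓ F :=
  TensorProduct.AlgebraTensorModule.rTensor ℤ (Additive Fˣ)
    (LinearMap.range (Algebra.linearMap ℤ_[ℓ] ℚ_[ℓ])).mkQ

variable (A : Type*) [AddCommGroup A] [Module ℤ_[ℓ] A]

/-- The map `A ⊗ Eˣ → A ⊗ Fˣ` induced by a multiplicative map `E → F`. -/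
noncomputable def mapUnits {E F : Type*} [Field E] [Field F] (f : E →* F) :
    A ⊗[ℤ] Additive Eˣ →ₗ[ℤ_[ℓ]] A ⊗[ℤ] Additive Fˣ :=
  TensorProduct.AlgebraTensorModule.lTensor ℤ_[ℓ] A
    (MonoidHom.toAdditive (Units.map f)).toIntLinearMap

/-- The operator `σ* - 1` on `A ⊗ Fˣ`, where `σ* = (1 + ℓ ^ m)⁻¹ σ`
(the inverse being taken in `ℤ_ℓ`). -/
noncomputable def starSubOne (m : ℕ) {F : Type*} [Field F] (σ : F →* F) :
    A ⊗[ℤ] Additive Fˣ →ₗ[ℤ_[ℓ]] A ⊗[ℤ] Additive Fˣ :=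
  Ring.inverse ((1 : ℤ_[ℓ]) + (ℓ : ℤ_[ℓ]) ^ m) • mapUnits ℓ A σ - LinearMap.id

/-- The image in `𝓡_F` of the group `μ_F` of roots of unity of `ℓ`-power order of `F`. -/
noncomputable def rootsSubmodule (F : Type*) [Field F] :
    Submodule ℤ_[ℓ] (PrincipalIdeles ℓ F) :=
  Submodule.span ℤ_[ℓ]
    ((fun ζ : Fˣ => (1 : ℤ_[ℓ]) ⊗ₜ[ℤ] Additive.ofMul ζ) '' CommGroup.primaryComponent Fˣ ℓ)

/-- The subgroup `𝓡_F ^ (σ* - 1) · μ_F` of `𝓡_F`. -/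
noncomputable def denominator (m : ℕ) {F : Type*} [Field F] (σ : F →* F) :
    Submodule ℤ_[ℓ] (PrincipalIdeles ℓ F) :=
  LinearMap.range (starSubOne ℓ ℤ_[ℓ] m σ) ⊔ rootsSubmodule ℓ F

theorem mapUnits_comp {E F G : Type*} [Field E] [Field F] [Field G] (g : F →* G) (f : E →* F)
    (x : A ⊗[ℤ] Additive Eˣ) :
    mapUnits ℓ A (g.comp f) x = mapUnits ℓ A g (mapUnits ℓ A f x) := by
  induction x with
  | zero => simp
  | tmul a y => rfl
  | add x y hx hy => simp only [map_add, hx, hy]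

theorem mapUnits_starSubOne (m : ℕ) {E F : Type*} [Field E] [Field F] (f : E →* F)
    (σ : E →* E) (τ : F →* F) (h : τ.comp f = f.comp σ) (x : A ⊗[ℤ] Additive Eˣ) :
    mapUnits ℓ A f (starSubOne ℓ A m σ x) = starSubOne ℓ A m τ (mapUnits ℓ A f x) := by
  simp only [starSubOne, LinearMap.sub_apply, LinearMap.smul_apply, LinearMap.id_apply, map_sub,
    map_smul, ← mapUnits_comp, h]

theorem denominator_le_comap (m : ℕ) {E F : Type*} [Field E] [Field F] (f : E →* F)
    (σ : E →* E) (τ : F →* F) (h : τ.comp f = f.comp σ) :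
    denominator ℓ m σ ≤ (denominator ℓ m τ).comap (mapUnits ℓ ℤ_[ℓ] f) := by
  refine sup_le ?_ ?_
  · rintro _ ⟨x, rfl⟩
    exact Submodule.mem_sup_left ⟨_, (mapUnits_starSubOne ℓ ℤ_[ℓ] m f σ τ h x).symm⟩
  · refine Submodule.span_le.2 ?_
    rintro _ ⟨ζ, ⟨k, hk⟩, rfl⟩
    refine Submodule.mem_sup_right (Submodule.subset_span ⟨Units.map f ζ, ?_, rfl⟩)
    have h1 : ζ ^ ℓ ^ k = 1 := hk
    have h2 : (Units.map f ζ) ^ ℓ ^ k = 1 := by rw [← map_pow, h1, map_one]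
    exact ⟨k, h2⟩

end Adified

/-! ### The cyclotomic tower -/

section Tower

variable (ℓ : ℕ) (K Ω : Type*) [Field K] [Field Ω] [Algebra K Ω]

/-- `K_∞ = K(μ_{ℓ^∞})` inside the algebraic closure `Ω`. -/
def cycTop : IntermediateField K Ω :=
  IntermediateField.adjoin K {ζ : Ω | ∃ k : ℕ, ζ ^ ℓ ^ k = 1}

/-- The `n`-th layer `K_n = K(μ_{ℓ^(m+n)})`, as a subfield of `K_∞`. -/
def layer (m n : ℕ) : IntermediateField K (cycTop ℓ K Ω) :=
  IntermediateField.adjoin K {ζ : cycTop ℓ K Ω | ζ ^ ℓ ^ (m + n) = 1}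

theorem layer_le_succ (m n : ℕ) : layer ℓ K Ω m n ≤ layer ℓ K Ω m (n + 1) := by
  refine IntermediateField.adjoin.mono _ _ _ fun ζ (hζ : ζ ^ ℓ ^ (m + n) = 1) => ?_
  change ζ ^ ℓ ^ (m + (n + 1)) = 1
  rw [← add_assoc, pow_succ, pow_mul, hζ, one_pow]

variable {ℓ K Ω}

theorem layer_map (m n : ℕ) (γ : Gal(cycTop ℓ K Ω/K)) :
    (layer ℓ K Ω m n).map (γ : cycTop ℓ K Ω →ₐ[K] cycTop ℓ K Ω) = layer ℓ K Ω m n := by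
  rw [layer, IntermediateField.adjoin_map]
  congr 1
  ext ζ
  constructor
  · rintro ⟨ξ, hξ : ξ ^ ℓ ^ (m + n) = 1, rfl⟩
    change (γ ξ) ^ ℓ ^ (m + n) = 1
    rw [← map_pow, hξ, map_one]
  · intro (hζ : ζ ^ ℓ ^ (m + n) = 1)
    refine ⟨γ.symm ζ, ?_, γ.apply_symm_apply ζ⟩
    change (γ.symm ζ) ^ ℓ ^ (m + n) = 1
    rw [← map_pow, hζ, map_one]

/-- The restriction to `K_n` of an automorphism of `K_∞ / K`. -/
noncomputable def restrictLayer (m n : ℕ) (γ : Gal(cycTop ℓ K Ω/K)) :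
    layer ℓ K Ω m n ≃ₐ[K] layer ℓ K Ω m n :=
  (IntermediateField.intermediateFieldMap γ (layer ℓ K Ω m n)).trans
    (IntermediateField.equivOfEq (layer_map m n γ))

theorem coe_restrictLayer (m n : ℕ) (γ : Gal(cycTop ℓ K Ω/K)) (x : layer ℓ K Ω m n) :
    (restrictLayer m n γ x : cycTop ℓ K Ω) = γ x := rfl

/-- The underlying multiplicative map `K_n → K_n` of the restriction of `γ`. -/
noncomputable def actLayer (m n : ℕ) (γ : Gal(cycTop ℓ K Ω/K)) :
    layer ℓ K Ω m n →* layer ℓ K Ω m n :=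
  ((restrictLayer m n γ : layer ℓ K Ω m n ≃+* layer ℓ K Ω m n) :
    layer ℓ K Ω m n →* layer ℓ K Ω m n)

variable (ℓ K Ω)

/-- The norm map `K_{n+1} → K_n`. -/
noncomputable def layerNorm (m n : ℕ) : layer ℓ K Ω m (n + 1) →* layer ℓ K Ω m n :=
  letI : Algebra (layer ℓ K Ω m n) (layer ℓ K Ω m (n + 1)) :=
    (IntermediateField.inclusion (layer_le_succ ℓ K Ω m n)).toRingHom.toAlgebra
  Algebra.norm (layer ℓ K Ω m n)

variable {ℓ K Ω}

theorem actLayer_comp_layerNorm (m n : ℕ) (γ : Gal(cycTop ℓ K Ω/K)) :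
    (actLayer m n γ).comp (layerNorm ℓ K Ω m n) =
      (layerNorm ℓ K Ω m n).comp (actLayer m (n + 1) γ) := by
  let _ : Algebra (layer ℓ K Ω m n) (layer ℓ K Ω m (n + 1)) :=
    (IntermediateField.inclusion (layer_le_succ ℓ K Ω m n)).toRingHom.toAlgebra
  ext1 x
  have := Algebra.norm_eq_of_equiv_equiv (restrictLayer m n γ).toRingEquiv
    (restrictLayer m (n + 1) γ).toRingEquiv (by ext y; rfl) x
  exact (congrArg (restrictLayer m n γ) this).trans ((restrictLayer m n γ).apply_symm_apply _)

variable [Fact ℓ.Prime]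

/-- The quotient `𝓡_{K_n} / 𝓡_{K_n} ^ (γ* - 1) μ_{K_n}`. -/
abbrev LayerQuotient (m : ℕ) (γ : Gal(cycTop ℓ K Ω/K)) (n : ℕ) : Type _ :=
  PrincipalIdeles ℓ (layer ℓ K Ω m n) ⧸ denominator ℓ m (actLayer m n γ)

/-- The map between consecutive quotients induced by the norm `K_{n+1} → K_n`. -/
noncomputable def quotientNorm (m : ℕ) (γ : Gal(cycTop ℓ K Ω/K)) (n : ℕ) :
    LayerQuotient m γ (n + 1) →ₗ[ℤ_[ℓ]] LayerQuotient m γ n :=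
  Submodule.mapQ _ _ (mapUnits ℓ ℤ_[ℓ] (layerNorm ℓ K Ω m n))
    (denominator_le_comap ℓ m _ _ _ (actLayer_comp_layerNorm m n γ))

/-- The projective limit of the quotients `𝓡_{K_n} / 𝓡_{K_n} ^ (γ* - 1) μ_{K_n}` for the norm
maps. -/
noncomputable def quotientLimit (m : ℕ) (γ : Gal(cycTop ℓ K Ω/K)) :
    Submodule ℤ_[ℓ] (∀ n, LayerQuotient m γ n) where
  carrier := {c | ∀ n, quotientNorm m γ n (c (n + 1)) = c n}
  add_mem' ha hb n := by simp only [Pi.add_apply, map_add, ha n, hb n]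
  zero_mem' n := by simp only [Pi.zero_apply, map_zero]
  smul_mem' a c hc n := by simp only [Pi.smul_apply, map_smul, hc n]

/-- The module `π₀(lim 𝓡_{K_n} / 𝓡_{K_n} ^ (γ* - 1) μ_{K_n})` of initial terms. -/
noncomputable def initialTerms (m : ℕ) (γ : Gal(cycTop ℓ K Ω/K)) : Submodule ℤ_[ℓ] (LayerQuotient m γ 0) :=
  (quotientLimit m γ).map (LinearMap.proj 0)

/-- The submodule `𝔕_{K_n} ^ Γ*` of the elements of `𝔕_{K_n}` that are fixed by the
topological generator `γ*` of `Γ*`. -/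
noncomputable def radicalInvariants (m : ℕ) (γ : Gal(cycTop ℓ K Ω/K)) (n : ℕ) :
    Submodule ℤ_[ℓ] (UniversalRadical ℓ (layer ℓ K Ω m n)) :=
  LinearMap.ker (starSubOne ℓ (QlModZl ℓ) m (actLayer m n γ))

/-- `L / K` is a `ℤ_ℓ`-extension. -/
def IsZlExtension (L : IntermediateField K Ω) : Prop :=
  IsGalois K L ∧ Nonempty (Gal(L/K) ≃ₜ* Multiplicative ℤ_[ℓ])

variable (ℓ K Ω)

/-- The compositum `Z` of all the `ℤ_ℓ`-extensions of `K` inside `Ω`. -/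
def zlCompositum : IntermediateField K Ω :=
  sSup {L | IsZlExtension (ℓ := ℓ) L}

/-- The initial radical: the set of the `ℓ ^ (-m) ⊗ x` in `𝔕_K` with `K_∞[x ^ (1 / ℓ ^ m)] ⊆ Z`. -/
def initialRadical (m : ℕ) : Set (UniversalRadical ℓ K) :=
  {z | ∃ x : Kˣ,
    cycTop ℓ K Ω ⊔ IntermediateField.adjoin K {y : Ω | y ^ ℓ ^ m = algebraMap K Ω x} ≤
      zlCompositum ℓ K Ω ∧
    z = (Submodule.Quotient.mk (((ℓ : ℚ_[ℓ]) ^ m)⁻¹) : QlModZl ℓ) ⊗ₜ[ℤ] Additive.ofMul x}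

/-- The identification of `𝔕_K` with `𝔕_{K_0}`, induced by the inclusion of `K` in
`K_0 = K(μ_{ℓ^m})`. -/
noncomputable def toLayerZero (m : ℕ) :
    UniversalRadical ℓ K →ₗ[ℤ_[ℓ]] UniversalRadical ℓ (layer ℓ K Ω m 0) :=
  mapUnits ℓ (QlModZl ℓ) (algebraMap K (layer ℓ K Ω m 0) : K →* layer ℓ K Ω m 0)

end Tower

end CycloKummer

/-!
The operator `γ* - 1` is invertible on `V_{K_n}`, since `γ` has finite order on `K_n` and no
positive power of `1 + ℓ ^ m` is `1`; and the kernel of `𝓡_F → V_F` is `μ_F`, by flatness of `ℤ_ℓ`. The snake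
lemma then gives `δ_n`, and its compatibility with the norms is formal (`exists_connecting`,
`exists_connecting_layers`). The substance is the description of the initial radical, which rests
on three facts.

* *Norms.* As `γ` multiplies an element of `𝔕_{K_{n+1}}` fixed by `γ*` by `1 + ℓ ^ m`, the norm of
  `K_{n+1} / K_n` multiplies it by `∑ (1 + ℓ ^ m) ^ (ℓ ^ n j)`, which is `ℓ` times a unit of
  `ℤ_ℓ`. As `𝔕_{K_n} → 𝔕_{K_{n+1}}` is injective (`mapUnits_layerInclusion_injective`),
  norm-compatible sequences are, up to units, the sequences of elements `y n ∈ 𝔕_{K_n}` fixed by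
  `γ*` such that `y n = ℓ • y (n + 1)` in `𝔕_{K_{n+1}}` (`mem_image_initialRadical_iff`).
* *Kummer theory.* Such a `y n` is of the form `ℓ ^ (-(m + n)) ⊗ x n` with `x n ∈ K_n`. The Kummer
  characters of the `x n` on `Gal(Ω / K_∞)` form a homomorphism to `ℤ_ℓ`, which is invariant under
  conjugation by lifts of `γ` because the `y n` are fixed by `γ*`. Conversely, a homomorphism `φ`
  from `Gal(Ω / K)` to `ℤ_ℓ` gives such a sequence: by Hilbert's theorem 90, its reduction modulo
  `ℓ ^ (m + n)` is a Kummer character over `K_n` (`exists_hom_of_kummer_sequence`,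
  `exists_kummer_element`).
* *Homomorphisms from `Gal(Ω / K)` to `ℤ_ℓ`.* Their common kernel fixes exactly `Z`. A conjugation
  invariant homomorphism on `Gal(Ω / K_∞)` extends to `Gal(Ω / K)`, because `Gal(K_∞ / K)` is
  procyclic (`exists_extension`). If the Kummer character of `x` is trivial on the common kernel
  then it is the reduction modulo `ℓ ^ m` of a single homomorphism to `ℤ_ℓ`, because the joint
  image in `ℤ_ℓ ^ r` of finitely many homomorphisms is a free module (`exists_hom_lift`). So the
  initial radical is the set of initial terms `y 0`.

The Galois group of `Ω / K_∞` is `rootFixer ℓ K Ω`, and that of `Ω / K_n` is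
`levelFixer ℓ K Ω (m + n)`.
-/

set_option linter.unusedSectionVars false

namespace CycloKummer

variable (ℓ : ℕ) [Fact ℓ.Prime]

/-! ### The `ℓ`-adified multiplicative group of a field -/

section AdifiedGroup

variable {F : Type*} [Field F]

theorem zsmul_tmul_comm {M N : Type*} [AddCommGroup M] [AddCommGroup N] (n : ℤ) (x : M) (y : N) :
    (n • x) ⊗ₜ[ℤ] y = x ⊗ₜ[ℤ] (n • y) :=
  TensorProduct.smul_tmul n x y

theorem rTensor_exact_int (A : Type*) [AddCommGroup A] {M N P : Type*} [AddCommGroup M]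
    [AddCommGroup N] [AddCommGroup P] [Module ℤ_[ℓ] M] [Module ℤ_[ℓ] N] [Module ℤ_[ℓ] P]
    {f : M →ₗ[ℤ_[ℓ]] N} {g : N →ₗ[ℤ_[ℓ]] P} (hfg : Function.Exact f g)
    (hg : Function.Surjective g) :
    Function.Exact (TensorProduct.AlgebraTensorModule.rTensor ℤ A f)
      (TensorProduct.AlgebraTensorModule.rTensor ℤ A g) :=
  rTensor_exact A (f := f.restrictScalars ℤ) (g := g.restrictScalars ℤ) hfg hg

/-- The class of `ℓ ^ (-k)` in `ℚ_ℓ / ℤ_ℓ`. -/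
noncomputable def invPow (k : ℕ) : QlModZl ℓ :=
  Submodule.Quotient.mk (((ℓ : ℚ_[ℓ]) ^ k)⁻¹)

/-- The element `ℓ ^ (-k) ⊗ x` of the universal radical. -/
noncomputable def radicalOf (k : ℕ) (x : Fˣ) : UniversalRadical ℓ F :=
  invPow ℓ k ⊗ₜ[ℤ] Additive.ofMul x

theorem natCast_ne_zero_padic : (ℓ : ℚ_[ℓ]) ≠ 0 :=
  Nat.cast_ne_zero.2 (Fact.out : ℓ.Prime).ne_zero

theorem invPow_add (k j : ℕ) : (ℓ ^ j : ℤ) • invPow ℓ (k + j) = invPow ℓ k := by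
  have h := natCast_ne_zero_padic ℓ
  rw [invPow, invPow, ← Submodule.Quotient.mk_smul]
  congr 1
  rw [zsmul_eq_mul]
  push_cast
  field_simp
  rw [pow_add, mul_comm]

theorem invPow_zero : invPow ℓ 0 = 0 := by
  rw [invPow, Submodule.Quotient.mk_eq_zero]
  exact ⟨1, by simp⟩

theorem radicalOf_mul (k : ℕ) (x y : Fˣ) :
    radicalOf ℓ k (x * y) = radicalOf ℓ k x + radicalOf ℓ k y := by
  rw [radicalOf, ofMul_mul, TensorProduct.tmul_add]; rfl

theorem radicalOf_pow (k n : ℕ) (x : Fˣ) :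
    radicalOf ℓ k (x ^ n) = (n : ℤ_[ℓ]) • radicalOf ℓ k x := by
  rw [radicalOf, ofMul_pow, TensorProduct.tmul_smul, radicalOf, Nat.cast_smul_eq_nsmul]

theorem radicalOf_pow_pow (k j : ℕ) (x : Fˣ) :
    radicalOf ℓ (k + j) (x ^ ℓ ^ j) = radicalOf ℓ k x := by
  have h : Additive.ofMul (x ^ ℓ ^ j) = (ℓ ^ j : ℤ) • Additive.ofMul x := by
    rw [ofMul_pow, ← natCast_zsmul]; push_cast; rfl
  rw [radicalOf, h, radicalOf, ← invPow_add ℓ k j]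
  exact (zsmul_tmul_comm _ _ _).symm

theorem pow_smul_radicalOf (k j : ℕ) (x : Fˣ) :
    (ℓ ^ j : ℤ_[ℓ]) • radicalOf ℓ (k + j) x = radicalOf ℓ k x := by
  rw [← radicalOf_pow_pow ℓ k j x, radicalOf_pow]; push_cast; rfl

theorem radicalOf_pow_self (k : ℕ) (x : Fˣ) : radicalOf ℓ k (x ^ ℓ ^ k) = 0 := by
  have := radicalOf_pow_pow ℓ 0 k x
  rw [zero_add] at this
  rw [this, radicalOf, invPow_zero, TensorProduct.zero_tmul]

theorem radicalOf_torsion (k j : ℕ) {ζ : Fˣ} (h : ζ ^ ℓ ^ j = 1) : radicalOf ℓ k ζ = 0 := by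
  rw [← radicalOf_pow_pow ℓ k j, h, radicalOf, ofMul_one, TensorProduct.tmul_zero]

theorem exists_eq_zsmul_invPow (q : QlModZl ℓ) : ∃ (k : ℕ) (n : ℤ), q = n • invPow ℓ k := by
  obtain ⟨q, rfl⟩ := Submodule.Quotient.mk_surjective _ q
  have h := natCast_ne_zero_padic ℓ
  obtain ⟨k, a, ha⟩ : ∃ (k : ℕ) (a : ℤ_[ℓ]), q * ℓ ^ k = a := by
    have hp : 1 < (ℓ : ℝ) := by exact_mod_cast (Fact.out : ℓ.Prime).one_lt
    obtain ⟨k, hk⟩ := pow_unbounded_of_one_lt ‖q‖ hp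
    refine ⟨k, ⟨q * ℓ ^ k, ?_⟩, rfl⟩
    rw [norm_mul, norm_pow, Padic.norm_p, inv_pow, ← div_eq_mul_inv]
    exact (div_le_one (by positivity)).2 hk.le
  have hs := PadicInt.appr_spec k a
  obtain ⟨c, hc⟩ := Ideal.mem_span_singleton'.1 hs
  refine ⟨k, a.appr k, ?_⟩
  rw [invPow, ← Submodule.Quotient.mk_smul, Submodule.Quotient.eq]
  refine ⟨c, ?_⟩
  have : (a : ℚ_[ℓ]) = a.appr k + c * ℓ ^ k := by
    have := congrArg (fun z : ℤ_[ℓ] => (z : ℚ_[ℓ])) hc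
    push_cast at this
    rw [this]; ring
  have hq : q = a / ℓ ^ k := by rw [← ha]; field_simp
  rw [hq, this]
  simp only [Algebra.linearMap_apply, PadicInt.algebraMap_apply, zsmul_eq_mul]
  push_cast
  field_simp
  ring

/-- Every element of `𝔕_F` is a pure tensor `ℓ ^ (-k) ⊗ x`. -/
theorem exists_radicalOf_eq (y : UniversalRadical ℓ F) :
    ∃ (k : ℕ) (x : Fˣ), y = radicalOf ℓ k x := by
  induction y using TensorProduct.induction_on with
  | zero => exact ⟨0, 1, by rw [radicalOf, ofMul_one, TensorProduct.tmul_zero]⟩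
  | tmul q x =>
    obtain ⟨k, n, rfl⟩ := exists_eq_zsmul_invPow ℓ q
    exact ⟨k, x.toMul ^ n, by rw [TensorProduct.smul_tmul, radicalOf, ofMul_zpow]; rfl⟩
  | add y z hy hz =>
    obtain ⟨k, x, rfl⟩ := hy
    obtain ⟨j, w, rfl⟩ := hz
    refine ⟨k + j, x ^ ℓ ^ j * w ^ ℓ ^ k, ?_⟩
    rw [radicalOf_mul, radicalOf_pow_pow, add_comm k j, radicalOf_pow_pow]

theorem toRational_tmul (a : ℤ_[ℓ]) (x : Additive Fˣ) :
    toRational ℓ F (a ⊗ₜ x) = (a : ℚ_[ℓ]) ⊗ₜ x := rfl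

theorem mapUnits_radicalOf {E : Type*} [Field E] (f : E →* F) (k : ℕ) (x : Eˣ) :
    mapUnits ℓ (QlModZl ℓ) f (radicalOf ℓ k x) = radicalOf ℓ k (Units.map f x) := rfl

theorem toRadical_surjective : Function.Surjective (toRadical ℓ F) := by
  intro y
  obtain ⟨k, x, rfl⟩ := exists_radicalOf_eq ℓ y
  exact ⟨((ℓ : ℚ_[ℓ]) ^ k)⁻¹ ⊗ₜ Additive.ofMul x, rfl⟩

theorem toRadical_eq_zero_iff (v : RationalIdeles ℓ F) :
    toRadical ℓ F v = 0 ↔ ∃ r, toRational ℓ F r = v := by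
  exact rTensor_exact_int ℓ (Additive Fˣ) (fun x => Submodule.Quotient.mk_eq_zero _)
    (Submodule.mkQ_surjective _) v

/-- `V_F` is the localization of `𝓡_F` at the nonzero elements of `ℤ_ℓ`, so that the kernel of
`𝓡_F → V_F` is the torsion submodule. -/
theorem exists_pow_smul_eq_zero {r : PrincipalIdeles ℓ F} (h : toRational ℓ F r = 0) :
    ∃ k : ℕ, (ℓ ^ k : ℤ) • r = 0 := by
  have hb : IsBaseChange ℚ_[ℓ] (toRational ℓ F) :=
    IsBaseChange.of_comp (TensorProduct.isBaseChange ℤ (Additive Fˣ) ℤ_[ℓ])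
      (TensorProduct.isBaseChange ℤ (Additive Fˣ) ℚ_[ℓ])
  have := (isLocalizedModule_iff_isBaseChange (nonZeroDivisors ℤ_[ℓ]) ℚ_[ℓ] _).2 hb
  obtain ⟨⟨c, hc⟩, hcr⟩ := (IsLocalizedModule.eq_zero_iff (nonZeroDivisors ℤ_[ℓ])
    (toRational ℓ F)).1 h
  have hc0 : c ≠ 0 := nonZeroDivisors.ne_zero hc
  change c • r = 0 at hcr
  rw [PadicInt.unitCoeff_spec hc0, mul_smul] at hcr
  refine ⟨c.valuation, ?_⟩
  have := (PadicInt.unitCoeff hc0).isUnit.smul_eq_zero.1 hcr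
  rw [← this, ← Int.cast_smul_eq_zsmul ℤ_[ℓ]]
  push_cast
  rfl

/-- As `ℤ_ℓ` is flat over `ℤ`, the `ℓ ^ k`-torsion of `ℤ_ℓ ⊗ Fˣ` comes from that of `Fˣ`. -/
theorem mem_rootsSubmodule_of_pow_smul {r : PrincipalIdeles ℓ F} {k : ℕ}
    (h : (ℓ ^ k : ℤ) • r = 0) : r ∈ rootsSubmodule ℓ F := by
  let g : Additive Fˣ →ₗ[ℤ] Additive Fˣ := (ℓ ^ k : ℤ) • LinearMap.id
  have hex : Function.Exact (LinearMap.ker g).subtype g := fun x => by simp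
  have := Module.Flat.lTensor_exact ℤ_[ℓ] hex
  obtain ⟨t, rfl⟩ := (this r).1 (by
    rw [← h, LinearMap.lTensor_smul, LinearMap.lTensor_id]; rfl)
  clear h
  induction t with
  | zero => simp
  | tmul a x =>
    have : (LinearMap.lTensor ℤ_[ℓ] (LinearMap.ker g).subtype) (a ⊗ₜ[ℤ] x) =
        a • ((1 : ℤ_[ℓ]) ⊗ₜ[ℤ] Additive.ofMul (Additive.toMul (x : Additive Fˣ))) := by
      rw [LinearMap.lTensor_tmul, TensorProduct.smul_tmul', smul_eq_mul, mul_one]; rfl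
    rw [this]
    refine Submodule.smul_mem _ _ (Submodule.subset_span ⟨_, ?_, rfl⟩)
    refine (CommGroup.mem_primaryComponent).2 ⟨k, ?_⟩
    have hx := x.2
    rw [LinearMap.mem_ker] at hx
    have hx' : (ℓ ^ k : ℕ) • (x : Additive Fˣ) = 0 := by
      rw [← hx, ← natCast_zsmul]; push_cast; rfl
    exact hx'
  | add x y hx hy => rw [map_add]; exact Submodule.add_mem _ hx hy

theorem toRational_eq_zero_iff (r : PrincipalIdeles ℓ F) :
    toRational ℓ F r = 0 ↔ r ∈ rootsSubmodule ℓ F := by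
  constructor
  · intro h
    obtain ⟨k, hk⟩ := exists_pow_smul_eq_zero ℓ h
    exact mem_rootsSubmodule_of_pow_smul ℓ hk
  · intro h
    change r ∈ LinearMap.ker (toRational ℓ F)
    revert r
    refine Submodule.span_le.2 ?_
    rintro _ ⟨ζ, ⟨k, hk⟩, rfl⟩
    have hk : ζ ^ ℓ ^ k = 1 := hk
    have h := natCast_ne_zero_padic ℓ
    change (((1 : ℤ_[ℓ]) : ℚ_[ℓ])) ⊗ₜ[ℤ] Additive.ofMul ζ = 0
    have : ((1 : ℤ_[ℓ]) : ℚ_[ℓ]) = (ℓ ^ k : ℕ) • ((ℓ : ℚ_[ℓ]) ^ k)⁻¹ := by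
      rw [nsmul_eq_mul]; push_cast; field_simp
    rw [this, TensorProduct.smul_tmul, ← ofMul_pow, hk, ofMul_one, TensorProduct.tmul_zero]

/-- An additive map from `A` to a group killed by `ℓ ^ k` extends to `ℤ_ℓ ⊗ A`. -/
theorem exists_addMonoidHom_tensor {A Q : Type*} [AddCommGroup A] [AddCommGroup Q] (k : ℕ)
    (p : A →+ Q) (hQ : ∀ y : Q, (ℓ ^ k) • y = 0) :
    ∃ f : ℤ_[ℓ] ⊗[ℤ] A →+ Q, ∀ a x, f (a ⊗ₜ x) = (PadicInt.toZModPow k a).val • p x := by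
  have : NeZero (ℓ ^ k) := ⟨pow_ne_zero _ (Fact.out : ℓ.Prime).ne_zero⟩
  let _ : Module (ZMod (ℓ ^ k)) Q := AddCommGroup.zmodModule hQ
  refine ⟨(TensorProduct.liftAddHom ((AddMonoidHom.compHom.flip p).comp
    (((smulAddHom (ZMod (ℓ ^ k)) Q)).comp (PadicInt.toZModPow k).toAddMonoidHom)) ?_),
    fun a x => ?_⟩
  · intro n a x
    change PadicInt.toZModPow k (n • a) • p x = PadicInt.toZModPow k a • p (n • x)
    rw [map_zsmul, map_zsmul, zsmul_eq_mul, mul_smul, Int.cast_smul_eq_zsmul]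
    exact (map_zsmul (smulAddHom (ZMod (ℓ ^ k)) Q (PadicInt.toZModPow k a)) n (p x)).symm
  · have : PadicInt.toZModPow k a • p x = (PadicInt.toZModPow k a).val • p x := by
      rw [← Nat.cast_smul_eq_nsmul (ZMod (ℓ ^ k)), ZMod.natCast_zmod_val]
    exact this

/-- `ℓ ^ (-k) ⊗ x` vanishes only if `x` is an `ℓ ^ k`-th power up to a root of unity of `ℓ`-power
order: the group `A / (ℓ ^ k A + μ)`, for `A = Fˣ`, is killed by `ℓ ^ k`, so that
`A → A / (ℓ ^ k A + μ)` extends to `ℤ_ℓ ⊗ A`, and the extension kills the image of `x`. -/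
theorem exists_of_radicalOf_eq_zero {k : ℕ} {x : Fˣ} (h : radicalOf ℓ k x = 0) :
    ∃ (j : ℕ) (ζ c : Fˣ), ζ ^ ℓ ^ j = 1 ∧ x = ζ * c ^ ℓ ^ k := by
  obtain ⟨r, hr⟩ := (toRadical_eq_zero_iff (F := F) ℓ
    (((ℓ : ℚ_[ℓ]) ^ k)⁻¹ ⊗ₜ Additive.ofMul x)).1 h
  have hℓ := natCast_ne_zero_padic ℓ
  have h1 : (1 : ℤ_[ℓ]) ⊗ₜ[ℤ] Additive.ofMul x - (ℓ ^ k : ℕ) • r ∈ rootsSubmodule ℓ F := by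
    rw [← toRational_eq_zero_iff, map_sub, map_nsmul, hr, toRational_tmul,
      TensorProduct.smul_tmul', nsmul_eq_mul, sub_eq_zero]
    congr 1
    push_cast
    field_simp
  let P : Submodule ℤ (Additive Fˣ) :=
    AddSubgroup.toIntSubmodule (Subgroup.toAddSubgroup (CommGroup.primaryComponent Fˣ ℓ)) ⊔
      LinearMap.range ((ℓ ^ k : ℕ) • (LinearMap.id : Additive Fˣ →ₗ[ℤ] Additive Fˣ))
  have hP : ∀ y : Additive Fˣ ⧸ P, (ℓ ^ k) • y = 0 := by
    intro y
    obtain ⟨y, rfl⟩ := P.mkQ_surjective y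
    rw [← map_nsmul, Submodule.mkQ_apply, Submodule.Quotient.mk_eq_zero]
    exact Submodule.mem_sup_right ⟨y, rfl⟩
  obtain ⟨f, hf⟩ := exists_addMonoidHom_tensor ℓ k P.mkQ.toAddMonoidHom hP
  replace hf : ∀ a x, f (a ⊗ₜ x) = (PadicInt.toZModPow k a).val • P.mkQ x := hf
  have hμ : ∀ r ∈ rootsSubmodule ℓ F, f r = 0 := by
    intro r hr
    suffices h : ∀ a : ℤ_[ℓ], f (a • r) = 0 by simpa using h 1
    induction hr using Submodule.span_induction with
    | mem _ h =>
      obtain ⟨ζ, hζ, rfl⟩ := h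
      intro a
      have h0 : P.mkQ (Additive.ofMul ζ) = 0 :=
        (Submodule.Quotient.mk_eq_zero _).2 (Submodule.mem_sup_left hζ)
      rw [TensorProduct.smul_tmul', hf, h0, smul_zero]
    | zero => intro a; rw [smul_zero, map_zero]
    | add x y _ _ hx hy => intro a; rw [smul_add, map_add, hx, hy, add_zero]
    | smul b x _ hx => intro a; rw [smul_smul]; exact hx _
  have h2 := hμ _ h1
  have h3 : f ((1 : ℤ_[ℓ]) ⊗ₜ[ℤ] Additive.ofMul x) = P.mkQ (Additive.ofMul x) := by
    rw [hf, map_one]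
    rcases k.eq_zero_or_pos with rfl | hk
    · have h4 := hP (P.mkQ (Additive.ofMul x))
      rw [pow_zero, one_smul] at h4
      rw [h4, smul_zero]
    · have : Fact (1 < ℓ ^ k) := ⟨Nat.one_lt_pow hk.ne' (Fact.out : ℓ.Prime).one_lt⟩
      rw [ZMod.val_one, one_smul]
  rw [map_sub, map_nsmul, hP, sub_zero, h3, Submodule.mkQ_apply,
    Submodule.Quotient.mk_eq_zero] at h2
  obtain ⟨ζ, ⟨j, hζ⟩, _, ⟨c, rfl⟩, hc⟩ := Submodule.mem_sup.1 h2
  exact ⟨j, ζ.toMul, c.toMul, hζ, hc.symm⟩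

theorem exists_radicalOf_of_pow_smul_eq_zero {j : ℕ} {y : UniversalRadical ℓ F}
    (h : (ℓ ^ j : ℤ_[ℓ]) • y = 0) : ∃ c : Fˣ, y = radicalOf ℓ j c := by
  obtain ⟨i, x, rfl⟩ := exists_radicalOf_eq ℓ y
  rw [← radicalOf_pow_pow ℓ i j] at h ⊢
  rw [pow_smul_radicalOf] at h
  obtain ⟨s, ζ, c, hζ, hc⟩ := exists_of_radicalOf_eq_zero ℓ h
  refine ⟨c, ?_⟩
  rw [hc, radicalOf_mul, radicalOf_torsion ℓ _ s hζ, zero_add, add_comm i j, radicalOf_pow_pow]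

end AdifiedGroup

/-! ### The connecting isomorphism -/

section Connecting

variable {E F : Type*} [Field E] [Field F]

theorem toRational_mapUnits (f : E →* F) (r : PrincipalIdeles ℓ E) :
    toRational ℓ F (mapUnits ℓ ℤ_[ℓ] f r) = mapUnits ℓ ℚ_[ℓ] f (toRational ℓ E r) := by
  induction r using TensorProduct.induction_on with
  | zero => simp only [map_zero]
  | tmul a x => rfl
  | add x y hx hy => simp only [map_add, hx, hy]

theorem toRadical_mapUnits (f : E →* F) (v : RationalIdeles ℓ E) :
    toRadical ℓ F (mapUnits ℓ ℚ_[ℓ] f v) = mapUnits ℓ (QlModZl ℓ) f (toRadical ℓ E v) := by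
  induction v using TensorProduct.induction_on with
  | zero => simp only [map_zero]
  | tmul a x => rfl
  | add x y hx hy => simp only [map_add, hx, hy]

theorem toRational_starSubOne (m : ℕ) (σ : F →* F) (r : PrincipalIdeles ℓ F) :
    toRational ℓ F (starSubOne ℓ ℤ_[ℓ] m σ r) = starSubOne ℓ ℚ_[ℓ] m σ (toRational ℓ F r) := by
  simp only [starSubOne, LinearMap.sub_apply, LinearMap.smul_apply, map_sub, map_smul,
    toRational_mapUnits, LinearMap.id_apply]

theorem toRadical_starSubOne (m : ℕ) (σ : F →* F) (v : RationalIdeles ℓ F) :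
    toRadical ℓ F (starSubOne ℓ ℚ_[ℓ] m σ v) =
      starSubOne ℓ (QlModZl ℓ) m σ (toRadical ℓ F v) := by
  simp only [starSubOne, LinearMap.sub_apply, LinearMap.smul_apply, map_sub, map_smul,
    toRadical_mapUnits, LinearMap.id_apply]

/-- The snake lemma for `σ* - 1`. The inverse `e` of the connecting map sends the class of `r` to
the image in the universal radical of the element `v` with `v ^ (σ* - 1) = r`; its kernel is
`𝓡_F ^ (σ* - 1) μ_F` because `μ_F` is the kernel of `𝓡_F → V_F`. -/
theorem exists_connecting (m : ℕ) (σ : F →* F)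
    (hσ : Function.Bijective (starSubOne ℓ ℚ_[ℓ] m σ)) :
    ∃ δ : LinearMap.ker (starSubOne ℓ (QlModZl ℓ) m σ) ≃ₗ[ℤ_[ℓ]]
        PrincipalIdeles ℓ F ⧸ denominator ℓ m σ,
      ∀ (y : LinearMap.ker (starSubOne ℓ (QlModZl ℓ) m σ)) (v : RationalIdeles ℓ F)
        (r : PrincipalIdeles ℓ F), toRadical ℓ F v = y →
        starSubOne ℓ ℚ_[ℓ] m σ v = toRational ℓ F r → δ y = Submodule.Quotient.mk r := by
  let T := LinearEquiv.ofBijective (starSubOne ℓ ℚ_[ℓ] m σ) hσ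
  have hT : ∀ v, starSubOne ℓ ℚ_[ℓ] m σ (T.symm v) = v := T.apply_symm_apply
  let e₀ : PrincipalIdeles ℓ F →ₗ[ℤ_[ℓ]] UniversalRadical ℓ F :=
    toRadical ℓ F ∘ₗ T.symm.toLinearMap ∘ₗ toRational ℓ F
  have he₀ : ∀ r, e₀ r = toRadical ℓ F (T.symm (toRational ℓ F r)) := fun r => rfl
  let e : PrincipalIdeles ℓ F →ₗ[ℤ_[ℓ]] LinearMap.ker (starSubOne ℓ (QlModZl ℓ) m σ) :=
    e₀.codRestrict _ fun r => by
      rw [LinearMap.mem_ker, he₀, ← toRadical_starSubOne, hT]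
      exact (toRadical_eq_zero_iff ℓ _).2 ⟨r, rfl⟩
  have key : ∀ (y : LinearMap.ker (starSubOne ℓ (QlModZl ℓ) m σ)) (v : RationalIdeles ℓ F)
      (r : PrincipalIdeles ℓ F), toRadical ℓ F v = y →
      starSubOne ℓ ℚ_[ℓ] m σ v = toRational ℓ F r → e r = y := by
    intro y v r hv hr
    apply Subtype.ext
    change e₀ r = y
    rw [he₀, ← hr, ← hv]
    congr 1
    exact T.symm_apply_apply v
  have hsurj : Function.Surjective e := by
    intro y
    obtain ⟨v, hv⟩ := toRadical_surjective ℓ (y : UniversalRadical ℓ F)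
    obtain ⟨r, hr⟩ := (toRadical_eq_zero_iff ℓ (starSubOne ℓ ℚ_[ℓ] m σ v)).1 (by
      rw [toRadical_starSubOne, hv]; exact y.2)
    exact ⟨r, key y v r hv hr.symm⟩
  have hker : LinearMap.ker e = denominator ℓ m σ := by
    ext r
    rw [LinearMap.mem_ker, ← Subtype.coe_inj]
    change e₀ r = 0 ↔ _
    rw [he₀, toRadical_eq_zero_iff]
    constructor
    · rintro ⟨s, hs⟩
      have : r - starSubOne ℓ ℤ_[ℓ] m σ s ∈ rootsSubmodule ℓ F := by
        rw [← toRational_eq_zero_iff, map_sub, toRational_starSubOne, hs, hT, sub_self]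
      rw [← add_sub_cancel (starSubOne ℓ ℤ_[ℓ] m σ s) r]
      exact Submodule.add_mem_sup ⟨s, rfl⟩ this
    · intro h
      obtain ⟨_, ⟨s, rfl⟩, w, hw, rfl⟩ := Submodule.mem_sup.1 h
      refine ⟨s, ?_⟩
      rw [map_add, (toRational_eq_zero_iff ℓ w).2 hw, add_zero, toRational_starSubOne]
      exact (T.symm_apply_apply _).symm
  refine ⟨((Submodule.quotEquivOfEq _ _ hker.symm).trans (e.quotKerEquivOfSurjective hsurj)).symm,
    fun y v r hv hr => ?_⟩
  rw [LinearEquiv.symm_apply_eq, ← key y v r hv hr]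
  rfl

theorem isUnit_one_add_pow {m : ℕ} (hm : m ≠ 0) : IsUnit ((1 : ℤ_[ℓ]) + (ℓ : ℤ_[ℓ]) ^ m) := by
  rw [PadicInt.isUnit_iff]
  have h : ‖(ℓ : ℤ_[ℓ]) ^ m‖ < 1 := by
    rw [PadicInt.norm_lt_one_iff_dvd]
    exact dvd_pow_self _ hm
  have := PadicInt.norm_add_eq_max_of_ne (p := ℓ) (q := 1) (r := (ℓ : ℤ_[ℓ]) ^ m)
    (by rw [norm_one]; exact h.ne')
  rw [this, norm_one, max_eq_left h.le]

theorem starSubOne_eq_zero_iff {A : Type*} [AddCommGroup A] [Module ℤ_[ℓ] A] {m : ℕ} (hm : m ≠ 0)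
    (σ : F →* F) (y : A ⊗[ℤ] Additive Fˣ) :
    starSubOne ℓ A m σ y = 0 ↔ mapUnits ℓ A σ y = (1 + (ℓ : ℤ_[ℓ]) ^ m) • y := by
  have hu := isUnit_one_add_pow ℓ hm
  rw [starSubOne, LinearMap.sub_apply, LinearMap.smul_apply, LinearMap.id_apply, sub_eq_zero]
  constructor
  · intro h
    nth_rw 2 [← h]
    rw [smul_smul, Ring.mul_inverse_cancel _ hu, one_smul]
  · intro h
    rw [h, smul_smul, Ring.inverse_mul_cancel _ hu, one_smul]

theorem smul_bijective_rational {c : ℤ_[ℓ]} (hc : c ≠ 0) :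
    Function.Bijective (fun v : RationalIdeles ℓ F => c • v) := by
  have hc' : (c : ℚ_[ℓ]) ≠ 0 := fun h => hc (Subtype.ext h)
  have h : ∀ v : RationalIdeles ℓ F, c • v = (c : ℚ_[ℓ]) • v := fun v =>
    (algebraMap_smul ℚ_[ℓ] c v).symm
  simp_rw [h]
  exact ⟨smul_right_injective _ hc', fun v => ⟨(c : ℚ_[ℓ])⁻¹ • v, smul_inv_smul₀ hc' v⟩⟩

theorem coe_units_map_iterate (σ : F →* F) (i : ℕ) (x : Fˣ) :
    (((Units.map σ)^[i] x : Fˣ) : F) = σ^[i] x := by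
  induction i with
  | zero => rfl
  | succ i ih => rw [Function.iterate_succ_apply', Function.iterate_succ_apply', ← ih]; rfl

/-- If `σ` has finite order `N`, then `σ* - 1` divides the nonzero scalar `(1 + ℓ ^ m) ^ (-N) - 1`,
hence is invertible on a `ℚ_ℓ`-vector space. -/
theorem starSubOne_bijective {m : ℕ} (hm : m ≠ 0) (σ : F →* F) {N : ℕ} (hN : N ≠ 0)
    (hσ : ∀ x : F, σ^[N] x = x) : Function.Bijective (starSubOne ℓ ℚ_[ℓ] m σ) := by
  set u : ℤ_[ℓ] := Ring.inverse (1 + (ℓ : ℤ_[ℓ]) ^ m) with hu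
  let S : Module.End ℤ_[ℓ] (RationalIdeles ℓ F) := mapUnits ℓ ℚ_[ℓ] σ
  have hS : S ^ N = 1 := by
    refine LinearMap.ext fun v => ?_
    have key : ∀ (n : ℕ) (a : ℚ_[ℓ]) (x : Fˣ), (S ^ n) (a ⊗ₜ Additive.ofMul x) =
        a ⊗ₜ Additive.ofMul ((Units.map σ)^[n] x) := by
      intro n a x
      induction n with
      | zero => rfl
      | succ n ih => rw [pow_succ', Module.End.mul_apply, ih, Function.iterate_succ_apply']; rfl
    induction v using TensorProduct.induction_on with
    | zero => simp only [map_zero]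
    | tmul a x =>
      have : (Units.map σ)^[N] x.toMul = x.toMul := Units.ext (by
        rw [coe_units_map_iterate, hσ])
      have h2 := key N a x.toMul
      rw [this] at h2
      exact h2
    | add x y hx hy => simp only [map_add, hx, hy]
  let T : Module.End ℤ_[ℓ] (RationalIdeles ℓ F) := u • S - 1
  have hq := isUnit_one_add_pow ℓ hm
  have hc : u ^ N - 1 ≠ 0 := by
    intro h
    have h1 : (1 + (ℓ : ℤ_[ℓ]) ^ m) ^ N = 1 := by
      have h2 : (1 + (ℓ : ℤ_[ℓ]) ^ m) ^ N * u ^ N = 1 := by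
        rw [← mul_pow, hu, Ring.mul_inverse_cancel _ hq, one_pow]
      rwa [sub_eq_zero.1 h, mul_one] at h2
    have h3 : ((1 + ℓ ^ m) ^ N : ℕ) = 1 := by exact_mod_cast h1
    have h4 : 1 < 1 + ℓ ^ m := by
      have := pow_pos (Fact.out : ℓ.Prime).pos m
      omega
    exact (Nat.one_lt_pow hN h4).ne' h3
  have hpow : (u • S) ^ N = (u ^ N) • (1 : Module.End ℤ_[ℓ] (RationalIdeles ℓ F)) := by
    rw [smul_pow, hS]
  have h1 : T * (∑ i ∈ Finset.range N, (u • S) ^ i) = (u ^ N - 1) • 1 := by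
    rw [mul_geom_sum, hpow]
    module
  have h2 : (∑ i ∈ Finset.range N, (u • S) ^ i) * T = (u ^ N - 1) • 1 := by
    rw [geom_sum_mul, hpow]
    module
  have hb := smul_bijective_rational (F := F) ℓ hc
  change Function.Bijective T
  constructor
  · refine Function.Injective.of_comp (f := ⇑(∑ i ∈ Finset.range N, (u • S) ^ i)) ?_
    rw [← Module.End.coe_mul, h2]
    exact hb.1
  · refine Function.Surjective.of_comp (g := ⇑(∑ i ∈ Finset.range N, (u • S) ^ i)) ?_
    rw [← Module.End.coe_mul, h1]
    exact hb.2

end Connecting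

/-! ### Powers of `1 + ℓ ^ m` -/

section Powers

variable {ℓ} {m : ℕ}

/-- The order of `1 + ℓ ^ m` in `(ℤ / ℓ ^ (m + N))ˣ` is `ℓ ^ N`. -/
theorem one_add_pow_modEq_one_iff (hm : m ≠ 0) (h2 : m + 2 ≤ ℓ * m) (N i : ℕ) :
    (1 + ℓ ^ m) ^ i ≡ 1 [MOD ℓ ^ (m + N)] ↔ ℓ ^ N ∣ i := by
  have ho := ZMod.orderOf_one_add_mul_prime_pow (Fact.out : ℓ.Prime) m hm h2 1
    (by
      intro h
      have := Int.natAbs_dvd_natAbs.2 h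
      simp only [Int.natAbs_natCast, Int.natAbs_one, Nat.dvd_one] at this
      exact (Fact.out : ℓ.Prime).one_lt.ne' this) N
  rw [← ho, orderOf_dvd_iff_pow_eq_one, ← ZMod.natCast_eq_natCast_iff, add_comm m N]
  push_cast
  rw [mul_one]

theorem exists_one_add_pow_eq (hm : m ≠ 0) (h2 : m + 2 ≤ ℓ * m) (N : ℕ) :
    ∃ v : ℕ, ¬ ℓ ∣ v ∧ (1 + ℓ ^ m) ^ ℓ ^ N = 1 + ℓ ^ (m + N) * v := by
  have h1 := (Nat.modEq_iff_dvd' (Nat.one_le_pow _ _ (by positivity))).1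
    ((one_add_pow_modEq_one_iff (ℓ := ℓ) hm h2 N (ℓ ^ N)).2 dvd_rfl).symm
  obtain ⟨v, hv⟩ := h1
  have hv' : (1 + ℓ ^ m) ^ ℓ ^ N = 1 + ℓ ^ (m + N) * v := by
    have : 1 ≤ (1 + ℓ ^ m) ^ ℓ ^ N := Nat.one_le_pow _ _ (by positivity)
    omega
  refine ⟨v, ?_, hv'⟩
  rintro ⟨w, rfl⟩
  have h3 : (1 + ℓ ^ m) ^ ℓ ^ N ≡ 1 [MOD ℓ ^ (m + (N + 1))] := by
    rw [hv', ← mul_assoc, ← pow_succ, add_assoc]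
    simp [Nat.ModEq]
  rw [one_add_pow_modEq_one_iff hm h2] at h3
  exact absurd (Nat.pow_dvd_pow_iff_le_right (Fact.out : ℓ.Prime).one_lt |>.1 h3) (by omega)

theorem exists_one_add_pow_eq_add_sq (x : ℤ) (j : ℕ) :
    ∃ k : ℤ, (1 + x) ^ j = 1 + j * x + k * x ^ 2 := by
  induction j with
  | zero => exact ⟨0, by simp⟩
  | succ j ih =>
    obtain ⟨k, hk⟩ := ih
    exact ⟨k + j + k * x, by rw [pow_succ, hk]; push_cast; ring⟩

/-- The powers of `1 + ℓ ^ m` exhaust the integers congruent to `1` modulo `ℓ ^ m`, to any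
`ℓ`-adic precision. -/
theorem exists_one_add_pow_modEq (hm : m ≠ 0) (h2 : m + 2 ≤ ℓ * m) (N c : ℕ)
    (hc : c ≡ 1 [MOD ℓ ^ m]) : ∃ i : ℕ, (1 + ℓ ^ m) ^ i ≡ c [MOD ℓ ^ (m + N)] := by
  have hp : ℓ.Prime := Fact.out
  induction N with
  | zero => exact ⟨0, by simpa using hc.symm⟩
  | succ N ih =>
    obtain ⟨i, hi⟩ := ih
    obtain ⟨t, ht⟩ := (Nat.modEq_iff_dvd.1 hi)
    obtain ⟨v, hv, hvN⟩ := exists_one_add_pow_eq (ℓ := ℓ) hm h2 N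
    have hq : ¬ ℓ ∣ (1 + ℓ ^ m) ^ i := fun h => by
      have h3 := hp.dvd_of_dvd_pow h
      rw [← Nat.dvd_add_iff_left (dvd_pow_self ℓ hm)] at h3
      exact hp.one_lt.ne' (Nat.dvd_one.1 h3)
    have hcop : IsCoprime (((1 + ℓ ^ m) ^ i * v : ℕ) : ℤ) (ℓ : ℤ) := by
      rw [Nat.isCoprime_iff_coprime]
      exact ((hp.coprime_iff_not_dvd.2 (hp.not_dvd_mul hq hv))).symm
    obtain ⟨a, b, hab⟩ := hcop
    -- a natural number congruent to `t * a` modulo `ℓ`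
    obtain ⟨j, hj⟩ : ∃ j : ℕ, (ℓ : ℤ) ∣ j - t * a := by
      refine ⟨((t * a) % ℓ).toNat, ?_⟩
      rw [Int.toNat_of_nonneg (Int.emod_nonneg _ (by exact_mod_cast hp.ne_zero))]
      exact (Int.mod_modEq _ _).symm.dvd
    refine ⟨i + ℓ ^ N * j, Nat.modEq_iff_dvd.2 ?_⟩
    obtain ⟨s, hs⟩ := hj
    obtain ⟨k, hk⟩ := exists_one_add_pow_eq_add_sq ((ℓ : ℤ) ^ (m + N) * v) j
    have e1 : (((1 + ℓ ^ m) ^ (i + ℓ ^ N * j) : ℕ) : ℤ) =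
        ((1 + ℓ ^ m) ^ i : ℕ) * (1 + (ℓ : ℤ) ^ (m + N) * v) ^ j := by
      rw [pow_add, pow_mul, hvN]; push_cast; rfl
    have e2 : ((ℓ ^ (m + (N + 1)) : ℕ) : ℤ) = ℓ * (ℓ : ℤ) ^ (m + N) := by push_cast; ring
    have e3 : (ℓ : ℤ) ^ (m + N) = ℓ * (ℓ : ℤ) ^ (m - 1 + N) := by
      rw [← pow_succ']; congr 1; omega
    rw [Nat.cast_mul] at hab
    rw [Nat.cast_pow ℓ (m + N)] at ht
    rw [e1, e2, hk]
    generalize (((1 + ℓ ^ m) ^ i : ℕ) : ℤ) = Q at *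
    refine ⟨t * b - Q * s * v - Q * k * (ℓ : ℤ) ^ (m - 1 + N) * v ^ 2, ?_⟩
    linear_combination ht - (ℓ : ℤ) ^ (m + N) * Q * v * hs - (ℓ : ℤ) ^ (m + N) * t * hab -
      (ℓ : ℤ) ^ (m + N) * Q * k * v ^ 2 * e3

/-- The sum `∑ (1 + ℓ ^ m) ^ (ℓ ^ n j)` over `j < ℓ` is `ℓ` times an `ℓ`-adic unit. It is the scalar
by which the norm of `K_{n+1} / K_n` acts on an element that `γ` multiplies by `1 + ℓ ^ m`. -/
theorem exists_sum_pow_eq (hm : m ≠ 0) (h2 : m + 2 ≤ ℓ * m) (n : ℕ) :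
    ∃ u : ℕ, ¬ ℓ ∣ u ∧ ∑ j ∈ Finset.range ℓ, (1 + ℓ ^ m) ^ (ℓ ^ n * j) = ℓ * u := by
  have hp : ℓ.Prime := Fact.out
  obtain ⟨v, hv, hvn⟩ := exists_one_add_pow_eq (ℓ := ℓ) hm h2 n
  obtain ⟨w, hw, hwn⟩ := exists_one_add_pow_eq (ℓ := ℓ) hm h2 (n + 1)
  have h := mul_geom_sum (((1 + ℓ ^ m) ^ ℓ ^ n : ℕ) : ℤ) ℓ
  simp_rw [pow_mul]
  set S := ∑ j ∈ Finset.range ℓ, ((1 + ℓ ^ m) ^ ℓ ^ n) ^ j with hS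
  have hS' : ∑ j ∈ Finset.range ℓ, (((1 + ℓ ^ m) ^ ℓ ^ n : ℕ) : ℤ) ^ j = S := by
    rw [hS]; push_cast; rfl
  rw [hS', ← Nat.cast_pow, ← pow_mul, ← pow_succ, hwn, hvn, ← add_assoc, pow_succ] at h
  have h3 : v * S = ℓ * w := by
    have h4 : ((ℓ : ℤ) ^ (m + n)) * (v * S) = (ℓ : ℤ) ^ (m + n) * (ℓ * w) := by
      push_cast at h ⊢; linear_combination h
    have h5 := mul_left_cancel₀ (pow_ne_zero _ (by exact_mod_cast hp.ne_zero)) h4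
    exact_mod_cast h5
  obtain ⟨u, hu⟩ := (hp.dvd_mul.1 ⟨w, h3⟩).resolve_left hv
  refine ⟨u, fun h => hw ?_, hu⟩
  have h6 : ℓ * (v * u) = ℓ * w := by rw [← h3, hu]; ring
  rw [← Nat.eq_of_mul_eq_mul_left hp.pos h6]
  exact dvd_mul_of_dvd_right h v

end Powers

/-! ### Homomorphisms from compact groups to `ℤ_ℓ` -/

section CompactGroups

variable {ℓ} {G : Type*} [Group G] [TopologicalSpace G] [IsTopologicalGroup G]

theorem padic_isOpen_ideal (k : ℕ) : IsOpen {a : ℤ_[ℓ] | (ℓ : ℤ_[ℓ]) ^ k ∣ a} := by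
  have : {a : ℤ_[ℓ] | (ℓ : ℤ_[ℓ]) ^ k ∣ a} = Metric.ball 0 ((ℓ : ℝ) ^ (-k + 1 : ℤ)) := by
    ext a
    rw [Set.mem_ofPred_eq, ← Ideal.mem_span_singleton, mem_ball_zero_iff,
      ← PadicInt.norm_le_pow_iff_mem_span_pow, PadicInt.norm_le_pow_iff_norm_lt_pow_add_one]
  rw [this]
  exact Metric.isOpen_ball

theorem padic_isClosed_ideal (k : ℕ) : IsClosed {a : ℤ_[ℓ] | (ℓ : ℤ_[ℓ]) ^ k ∣ a} := by
  have : {a : ℤ_[ℓ] | (ℓ : ℤ_[ℓ]) ^ k ∣ a} = Metric.closedBall 0 ((ℓ : ℝ) ^ (-k : ℤ)) := by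
    ext a
    rw [Set.mem_ofPred_eq, ← Ideal.mem_span_singleton, mem_closedBall_zero_iff,
      ← PadicInt.norm_le_pow_iff_mem_span_pow]
  rw [this]
  exact Metric.isClosed_closedBall

theorem padic_eq_zero {a : ℤ_[ℓ]} (h : ∀ k : ℕ, (ℓ : ℤ_[ℓ]) ^ k ∣ a) : a = 0 := by
  rw [← PadicInt.ext_of_toZModPow]
  intro n
  rw [map_zero, ← RingHom.mem_ker, PadicInt.ker_toZModPow, Ideal.mem_span_singleton]
  exact h n

/-- The closure in `G × ℤ_ℓ` of the graph of a homomorphism, defined on a dense subgroup of the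
compact group `G` and continuous for the topology of `G`, is the graph of a homomorphism. -/
theorem exists_hom_of_dense_graph (P : Subgroup (G × Multiplicative ℤ_[ℓ]))
    (hd : Dense (Prod.fst '' (P : Set (G × Multiplicative ℤ_[ℓ]))))
    (hc : ∀ k : ℕ, ∃ V : Subgroup G, IsOpen (V : Set G) ∧
      ∀ g c, (g, c) ∈ P → g ∈ V → (ℓ : ℤ_[ℓ]) ^ k ∣ c.toAdd) :
    ∃ φ : G →* Multiplicative ℤ_[ℓ], Continuous φ ∧ ∀ g c, (g, c) ∈ P → φ g = c := by
  have : CompactSpace (Multiplicative ℤ_[ℓ]) := inferInstanceAs (CompactSpace ℤ_[ℓ])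
  have : T2Space (Multiplicative ℤ_[ℓ]) := inferInstanceAs (T2Space ℤ_[ℓ])
  let Q := P.topologicalClosure
  have hQ : IsClosed (Q : Set (G × Multiplicative ℤ_[ℓ])) := P.isClosed_topologicalClosure
  have hcQ : ∀ k : ℕ, ∃ V : Subgroup G, IsOpen (V : Set G) ∧
      ∀ g c, (g, c) ∈ Q → g ∈ V → (ℓ : ℤ_[ℓ]) ^ k ∣ c.toAdd := by
    intro k
    obtain ⟨V, hV, h⟩ := hc k
    refine ⟨V, hV, fun g c hg hgV => ?_⟩
    by_contra hcon
    have ho : IsOpen ((V : Set G) ×ˢ {c : Multiplicative ℤ_[ℓ] | ¬ (ℓ : ℤ_[ℓ]) ^ k ∣ c.toAdd}) :=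
      hV.prod (padic_isClosed_ideal k).isOpen_compl
    obtain ⟨⟨g', c'⟩, ⟨h1, h2⟩, h3⟩ := mem_closure_iff.1 hg _ ho ⟨hgV, hcon⟩
    exact h2 (h _ _ h3 h1)
  have hinj : ∀ g c c', (g, c) ∈ Q → (g, c') ∈ Q → c = c' := by
    intro g c c' h1 h2
    have h3 : ((1 : G), c / c') ∈ Q := by
      have := Q.div_mem h1 h2
      simpa using this
    rw [← div_eq_one]
    exact padic_eq_zero (a := (c / c').toAdd) fun k => by
      obtain ⟨V, -, h⟩ := hcQ k
      exact h _ _ h3 V.one_mem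
  have hsurj : ∀ g, ∃ c, (g, c) ∈ Q := by
    have hcl : IsClosed (Prod.fst '' (Q : Set (G × Multiplicative ℤ_[ℓ]))) :=
      isClosedMap_fst_of_compactSpace _ hQ
    intro g
    have h1 : g ∈ Prod.fst '' (Q : Set (G × Multiplicative ℤ_[ℓ])) :=
      hcl.closure_subset_iff.2 (Set.image_mono P.le_topologicalClosure) (hd g)
    obtain ⟨⟨g', c⟩, h, rfl⟩ := h1
    exact ⟨c, h⟩
  choose f hf using hsurj
  have hmem : ∀ g c, (g, c) ∈ Q ↔ f g = c := fun g c =>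
    ⟨fun h => hinj g _ _ (hf g) h, fun h => h ▸ hf g⟩
  refine ⟨MonoidHom.mk' f fun a b => hinj _ _ _ (hf _) (Q.mul_mem (hf a) (hf b)), ?_,
    fun g c h => hinj _ _ _ (hf g) (P.le_topologicalClosure h)⟩
  refine continuous_iff_isClosed.2 fun C hC => ?_
  have h1 : IsClosed ((Q : Set (G × Multiplicative ℤ_[ℓ])) ∩ Prod.snd ⁻¹' C) :=
    hQ.inter (hC.preimage continuous_snd)
  convert isClosedMap_fst_of_compactSpace _ h1 using 1
  ext g
  constructor
  · intro hg
    exact ⟨(g, f g), ⟨hf g, hg⟩, rfl⟩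
  · rintro ⟨⟨g, c⟩, ⟨h2, h3⟩, rfl⟩
    change f g ∈ C
    rw [(hmem g c).1 h2]
    exact h3

variable [CompactSpace G]

theorem isUnit_natCast_padic {n : ℕ} (h : ¬ ℓ ∣ n) : IsUnit (n : ℤ_[ℓ]) := by
  rw [PadicInt.isUnit_iff]
  refine le_antisymm (PadicInt.norm_le_one _) (not_lt.1 fun h1 => h ?_)
  exact_mod_cast (PadicInt.norm_int_lt_one_iff_dvd (p := ℓ) n).1 (by exact_mod_cast h1)

/-- Extension of a character `ψ` of a closed normal subgroup `H` with procyclic quotient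
`G / H ≃ ℤ_ℓ`, generated by the image of `τ`, to all of `G`, with a prescribed value at `τ`.

The subgroup generated by `H` and `τ` is dense. If `h τ ^ i` is close to `1` then `i` is divisible
by a high power of `ℓ`; as some power `τ ^ e` is close to `1`, so is
`h' = (h τ ^ i) ^ e' τ ^ (-i e')`, where `e'` is the prime-to-`ℓ` part of `e`. Hence
`ψ h' = e' ψ h` is small and `ψ h` is small. -/
theorem exists_extension (H : Subgroup G) [H.Normal] (U : ℕ → Subgroup G)
    (hUo : ∀ n, IsOpen (U n : Set G)) (hHU : ∀ n, H ≤ U n) (τ : G)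
    (hd : Dense {g : G | ∃ h ∈ H, ∃ i : ℤ, g = h * τ ^ i})
    (hτ : ∀ (n : ℕ) (i : ℤ), τ ^ i ∈ U n → ((ℓ ^ n : ℕ) : ℤ) ∣ i)
    (ψ : H →* Multiplicative ℤ_[ℓ]) (hψτ : ∀ h, ψ (MulAut.conjNormal τ h) = ψ h)
    (hψ : ∀ k : ℕ, ∃ V : Subgroup G, IsOpen (V : Set G) ∧
      ∀ h : H, (h : G) ∈ V → (ℓ : ℤ_[ℓ]) ^ k ∣ (ψ h).toAdd) (c : Multiplicative ℤ_[ℓ]) :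
    ∃ φ : G →* Multiplicative ℤ_[ℓ], Continuous φ ∧ (∀ h : H, φ h = ψ h) ∧ φ τ = c := by
  have hp : ℓ.Prime := Fact.out
  have hconj : ∀ (i : ℤ) (h : H), ψ (MulAut.conjNormal (τ ^ i) h) = ψ h := by
    let S : Subgroup G :=
      { carrier := {g | ∀ h : H, ψ (MulAut.conjNormal g h) = ψ h}
        one_mem' := fun h => by rw [map_one]; rfl
        mul_mem' := fun {a b} ha hb h => by rw [map_mul, MulAut.mul_apply, ha, hb]
        inv_mem' := fun {a} ha h => by
          rw [← ha, ← MulAut.mul_apply, ← map_mul, mul_inv_cancel, map_one]; rfl }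
    exact fun i => S.zpow_mem (show τ ∈ S from hψτ) i
  have hmul : ∀ (h h' : H) (i j : ℤ), ((h : G) * τ ^ i) * (h' * τ ^ j) =
      (h * MulAut.conjNormal (τ ^ i) h' : H) * τ ^ (i + j) := by
    intro h h' i j
    rw [Subgroup.coe_mul, MulAut.conjNormal_apply, zpow_add]
    group
  let P : Subgroup (G × Multiplicative ℤ_[ℓ]) :=
    { carrier := {p | ∃ (h : H) (i : ℤ), p = ((h : G) * τ ^ i, ψ h * c ^ i)}
      one_mem' := ⟨1, 0, Prod.ext (by simp) (by simp)⟩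
      mul_mem' := by
        rintro _ _ ⟨h, i, rfl⟩ ⟨h', j, rfl⟩
        refine ⟨h * MulAut.conjNormal (τ ^ i) h', i + j, ?_⟩
        rw [Prod.mk_mul_mk, hmul, map_mul, hconj, zpow_add c, mul_mul_mul_comm]
      inv_mem' := by
        rintro _ ⟨h, i, rfl⟩
        refine ⟨MulAut.conjNormal (τ ^ (-i)) h⁻¹, -i, ?_⟩
        rw [Prod.inv_mk, hconj, map_inv ψ, mul_inv, zpow_neg c, MulAut.conjNormal_apply]
        congr 1
        push_cast
        group }
  have hmemP : ∀ (h : H) (i : ℤ), ((h : G) * τ ^ i, ψ h * c ^ i) ∈ P := fun h i => ⟨h, i, rfl⟩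
  obtain ⟨φ, hφ, hφP⟩ := exists_hom_of_dense_graph P
    (by
      refine hd.mono ?_
      rintro _ ⟨h, hh, i, rfl⟩
      exact ⟨_, hmemP ⟨h, hh⟩ i, rfl⟩)
    (by
      intro k
      obtain ⟨V, hV, hVk⟩ := hψ k
      have : Finite (G ⧸ V) := V.quotient_finite_of_isOpen hV
      have : V.FiniteIndex := Subgroup.finiteIndex_of_finite_quotient
      obtain ⟨e, he0, he⟩ : ∃ e : ℕ, e ≠ 0 ∧ τ ^ e ∈ V := by
        obtain ⟨e, he, -, h⟩ := Subgroup.exists_pow_mem_of_index_ne_zero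
          (Subgroup.FiniteIndex.index_ne_zero (H := V)) τ
        exact ⟨e, he.ne', h⟩
      obtain ⟨a, e', he', rfl⟩ := Nat.exists_eq_pow_mul_and_not_dvd he0 ℓ hp.ne_one
      refine ⟨V ⊓ U (max a k), hV.inter (hUo _), ?_⟩
      rintro g d ⟨h, i, hgd⟩ ⟨hgV, hgU⟩
      obtain ⟨rfl, rfl⟩ := Prod.mk.inj hgd
      have hi := hτ _ i ((Subgroup.mul_mem_cancel_left _ (hHU _ h.2)).1 hgU)
      have hpow : ∀ n : ℕ, ∃ h' : H, ((h : G) * τ ^ i) ^ n = h' * τ ^ (i * n) ∧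
          ψ h' = ψ h ^ n := by
        intro n
        induction n with
        | zero => exact ⟨1, by simp⟩
        | succ n ih =>
          obtain ⟨h', h1, h2⟩ := ih
          refine ⟨h' * MulAut.conjNormal (τ ^ (i * n)) h, ?_, ?_⟩
          · rw [pow_succ, h1, hmul]; congr 2; push_cast; ring
          · rw [map_mul, hconj, h2, pow_succ]
      obtain ⟨h', h1, h2⟩ := hpow e'
      have h3 : τ ^ (i * e') ∈ V := by
        obtain ⟨s, rfl⟩ := ((Int.natCast_dvd_natCast.2
          (Nat.pow_dvd_pow ℓ (le_max_left a k))).trans hi)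
        have : ((ℓ ^ a : ℕ) : ℤ) * s * e' = ((ℓ ^ a * e' : ℕ) : ℤ) * s := by push_cast; ring
        rw [this, zpow_mul, zpow_natCast]
        exact V.zpow_mem he s
      have h4 : (h' : G) ∈ V := by
        rw [← Subgroup.mul_mem_cancel_right V h3, ← h1]
        exact V.pow_mem hgV _
      have h5 := hVk h' h4
      rw [h2, toAdd_pow, nsmul_eq_mul, (isUnit_natCast_padic he').dvd_mul_left] at h5
      rw [toAdd_mul, toAdd_zpow, zsmul_eq_mul]
      refine dvd_add h5 (Dvd.dvd.mul_right ?_ _)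
      obtain ⟨s, hs⟩ := ((Int.natCast_dvd_natCast.2
          (Nat.pow_dvd_pow ℓ (le_max_right a k))).trans hi)
      exact ⟨s, by rw [hs]; push_cast; rfl⟩)
  refine ⟨φ, hφ, fun h => ?_, ?_⟩
  · have := hφP _ _ (hmemP h 0)
    simpa using this
  · have := hφP _ _ (hmemP 1 1)
    simpa using this

/-- Under the hypotheses of `exists_extension`, the subgroup `H` is the kernel of a continuous
homomorphism to `ℤ_ℓ`. -/
theorem exists_hom_ker_le (H : Subgroup G) [H.Normal] (U : ℕ → Subgroup G)
    (hUo : ∀ n, IsOpen (U n : Set G)) (hHU : ∀ n, H ≤ U n) (hUH : ∀ g, (∀ n, g ∈ U n) → g ∈ H)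
    (τ : G) (hd : Dense {g : G | ∃ h ∈ H, ∃ i : ℤ, g = h * τ ^ i})
    (hτ : ∀ (n : ℕ) (i : ℤ), τ ^ i ∈ U n ↔ ((ℓ ^ n : ℕ) : ℤ) ∣ i) :
    ∃ κ : G →* Multiplicative ℤ_[ℓ], Continuous κ ∧ ∀ g, κ g = 1 → g ∈ H := by
  obtain ⟨κ, hκ, hκH, hκτ⟩ := exists_extension H U hUo hHU τ hd (fun n i => (hτ n i).1) 1
    (fun _ => rfl) (fun k => ⟨⊤, isOpen_univ, fun _ _ => dvd_zero _⟩) (Multiplicative.ofAdd 1)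
  refine ⟨κ, hκ, fun g hg => hUH g fun n => ?_⟩
  have ho : IsOpen ((fun x => g⁻¹ * x) ⁻¹' (U n : Set G) ∩
      κ ⁻¹' {a | (ℓ : ℤ_[ℓ]) ^ n ∣ a.toAdd}) :=
    ((hUo n).preimage (continuous_const_mul _)).inter
      ((padic_isOpen_ideal n).preimage hκ)
  obtain ⟨x, ⟨hxU, hxκ⟩, h, hh, i, rfl⟩ := hd.inter_open_nonempty _ ho ⟨g, by
    refine ⟨?_, ?_⟩
    · change g⁻¹ * g ∈ U n
      rw [inv_mul_cancel]; exact one_mem _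
    · change (ℓ : ℤ_[ℓ]) ^ n ∣ (κ g).toAdd
      rw [hg]; exact dvd_zero _⟩
  have hκx : κ (h * τ ^ i) = Multiplicative.ofAdd (i : ℤ_[ℓ]) := by
    rw [map_mul, map_zpow, hκτ, show κ h = 1 from hκH ⟨h, hh⟩, one_mul, ← ofAdd_zsmul,
      zsmul_one]
  change (ℓ : ℤ_[ℓ]) ^ n ∣ (κ (h * τ ^ i)).toAdd at hxκ
  rw [hκx, toAdd_ofAdd, PadicInt.pow_p_dvd_int_iff] at hxκ
  have hx : h * τ ^ i ∈ U n := mul_mem (hHU n hh) ((hτ n i).2 (by exact_mod_cast hxκ))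
  have h1 : g⁻¹ * (h * τ ^ i) ∈ U n := hxU
  rwa [Subgroup.mul_mem_cancel_right _ hx, inv_mem_iff] at h1

/-- If `τ` generates the quotients `G / U n` and `H` is the intersection of the `U n`, then `H` and
`τ` generate a dense subgroup. -/
theorem dense_mul_zpowers (H : Subgroup G) (U : ℕ → Subgroup G)
    (hUo : ∀ n, IsOpen (U n : Set G)) (hU : ∀ n, U (n + 1) ≤ U n)
    (hUH : ∀ g, (∀ n, g ∈ U n) → g ∈ H) (τ : G)
    (hτ : ∀ (g : G) (n : ℕ), ∃ i : ℤ, τ ^ i * g⁻¹ ∈ U n) :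
    Dense {g : G | ∃ h ∈ H, ∃ i : ℤ, g = h * τ ^ i} := by
  intro g
  set D : Set G := {g : G | ∃ h ∈ H, ∃ i : ℤ, g = h * τ ^ i}
  let S : ℕ → Set G := fun n => closure D ∩ (fun x => x * g⁻¹) ⁻¹' (U n : Set G)
  have hS : ∀ n, IsClosed (S n) := fun n => isClosed_closure.inter
    (((U n).isClosed_of_isOpen (hUo n)).preimage (continuous_mul_const _))
  obtain ⟨x, hx⟩ := IsCompact.nonempty_iInter_of_sequence_nonempty_isCompact_isClosed S
    (fun n => Set.inter_subset_inter_right _ (Set.preimage_mono (hU n)))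
    (fun n => by
      obtain ⟨i, hi⟩ := hτ g n
      exact ⟨τ ^ i, subset_closure ⟨1, one_mem _, i, by rw [one_mul]⟩, hi⟩)
    (hS 0).isCompact hS
  rw [Set.mem_iInter] at hx
  have hxH : x * g⁻¹ ∈ H := hUH _ fun n => (hx n).2
  have h1 : (x * g⁻¹)⁻¹ * x ∈ closure D := by
    refine map_mem_closure (continuous_const_mul _) (hx 0).1 ?_
    rintro _ ⟨h, hh, i, rfl⟩
    exact ⟨_, mul_mem (inv_mem hxH) hh, i, by rw [mul_assoc]⟩
  simpa using h1

theorem pow_eq_pow_of_dvd_sub {M : Type*} [Monoid M] {z : M} {k : ℕ} (hz : z ^ ℓ ^ k = 1) {a b : ℕ}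
    (h : (ℓ : ℤ_[ℓ]) ^ k ∣ (a : ℤ_[ℓ]) - b) : z ^ a = z ^ b := by
  have h1 : (ℓ : ℤ_[ℓ]) ^ k ∣ ((a - b : ℤ) : ℤ_[ℓ]) := by push_cast; exact h
  rw [PadicInt.pow_p_dvd_int_iff] at h1
  refine pow_eq_pow_of_modEq ?_ hz
  refine (Nat.modEq_iff_dvd.2 ?_).symm
  exact_mod_cast h1

theorem exists_smul_eq_appr_nsmul_add {Y : Type*} [AddCommGroup Y] [Module ℤ_[ℓ] Y] (a : ℤ_[ℓ])
    (k : ℕ) (y : Y) : ∃ w : Y, a • y = a.appr k • y + (ℓ ^ k) • w := by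
  obtain ⟨c, hc⟩ := Ideal.mem_span_singleton.1 (PadicInt.appr_spec k a)
  refine ⟨c • y, ?_⟩
  rw [← Nat.cast_smul_eq_nsmul ℤ_[ℓ] (ℓ ^ k), ← Nat.cast_smul_eq_nsmul ℤ_[ℓ] (a.appr k),
    smul_smul, ← add_smul, Nat.cast_pow, ← hc, add_sub_cancel]

/-- A homomorphism from a free `ℤ_ℓ`-module to a cyclic group of order `ℓ ^ k` is the reduction of
the linear form with the same values on a basis. -/
theorem eq_nsmul_of_dvd_constr_sub {Y M ι : Type*} [AddCommGroup Y] [Module ℤ_[ℓ] Y]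
    [AddCommGroup M] [Fintype ι] (e : Module.Basis ι ℤ_[ℓ] Y) (χ : Y →+ M) {k : ℕ} {z : M}
    (hz : (ℓ ^ k) • z = 0) (hχz : ∀ y, ∃ n : ℕ, χ y = n • z) {n : ι → ℕ}
    (hn : ∀ j, χ (e j) = n j • z) {y : Y} {N : ℕ}
    (hN : (ℓ : ℤ_[ℓ]) ^ k ∣ (∑ j, e.repr y j * n j) - N) : χ y = N • z := by
  have hkill : ∀ y, (ℓ ^ k) • χ y = 0 := fun y => by
    obtain ⟨n, hn⟩ := hχz y
    rw [hn, smul_comm, hz, smul_zero]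
  have hterm : ∀ j, χ (e.repr y j • e j) = ((e.repr y j).appr k * n j) • z := by
    intro j
    obtain ⟨w, h2⟩ := exists_smul_eq_appr_nsmul_add (e.repr y j) k (e j)
    rw [h2, map_add, map_nsmul, map_nsmul, hkill, add_zero, hn, mul_smul]
  have hsum : χ y = (∑ j, (e.repr y j).appr k * n j) • z := by
    conv_lhs => rw [← e.sum_repr y]
    rw [map_sum, Finset.sum_smul]
    exact Finset.sum_congr rfl fun j _ => hterm j
  rw [hsum]
  have h3 : (ℓ : ℤ_[ℓ]) ^ k ∣ (∑ j, e.repr y j * n j) -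
      ((∑ j, (e.repr y j).appr k * n j : ℕ) : ℤ_[ℓ]) := by
    push_cast
    rw [← Finset.sum_sub_distrib]
    refine Finset.dvd_sum fun j _ => ?_
    rw [← sub_mul]
    exact Dvd.dvd.mul_right (Ideal.mem_span_singleton.1 (PadicInt.appr_spec k _)) _
  have h4 := dvd_sub hN h3
  rw [sub_sub_sub_cancel_left] at h4
  exact pow_eq_pow_of_dvd_sub (M := Multiplicative M) (z := Multiplicative.ofAdd z) hz h4

/-- A character of `G` with values in the cyclic group of order `ℓ ^ k` which is trivial on the
common kernel of all continuous homomorphisms `G → ℤ_ℓ` is the reduction of one such homomorphism.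
By compactness finitely many homomorphisms suffice; their joint image in `ℤ_ℓ ^ r` is a free
`ℤ_ℓ`-module, from which the character lifts. -/
theorem exists_hom_lift {M : Type*} [CommGroup M] (χ : G →* M) (hχ : IsOpen (χ.ker : Set G))
    (hker : ∀ g, (∀ φ : G →* Multiplicative ℤ_[ℓ], Continuous φ → φ g = 1) → χ g = 1)
    {k : ℕ} {z : M} (hz : z ^ ℓ ^ k = 1) (hχz : ∀ g, ∃ n : ℕ, χ g = z ^ n) :
    ∃ φ : G →* Multiplicative ℤ_[ℓ], Continuous φ ∧
      ∀ (g : G) (n : ℕ), (ℓ : ℤ_[ℓ]) ^ k ∣ (φ g).toAdd - n → χ g = z ^ n := by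
  classical
  have : T2Space (Multiplicative ℤ_[ℓ]) := inferInstanceAs (T2Space ℤ_[ℓ])
  obtain ⟨u, hu⟩ := hχ.isClosed_compl.isCompact.elim_finite_subfamily_closed
    (fun φ : {φ : G →* Multiplicative ℤ_[ℓ] // Continuous φ} => (φ.1.ker : Set G))
    (fun φ => isClosed_singleton.preimage φ.2) (by
      ext g
      simp only [Set.mem_inter_iff, Set.mem_compl_iff, Set.mem_iInter, Set.mem_empty_iff_false,
        iff_false, not_and, SetLike.mem_coe]
      exact fun h1 h2 => h1 (hker g fun φ hφ => h2 ⟨φ, hφ⟩))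
  let Φ : G → (u → ℤ_[ℓ]) := fun g φ => (φ.1.1 g).toAdd
  have hΦ : Continuous Φ := continuous_pi fun φ => φ.1.2
  have hΦm : ∀ g h, Φ (g * h) = Φ g + Φ h := fun g h => by
    ext φ; simp [Φ]
  have hΦ1 : Φ 1 = 0 := by ext φ; simp [Φ]
  have hΦp : ∀ g (n : ℕ), Φ (g ^ n) = n • Φ g := fun g n => by
    ext φ; simp [Φ]
  have hcl : IsClosed (Set.range Φ) := (isCompact_range hΦ).isClosed
  let Λ : Submodule ℤ_[ℓ] (u → ℤ_[ℓ]) :=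
    { carrier := Set.range Φ
      add_mem' := by rintro _ _ ⟨g, rfl⟩ ⟨h, rfl⟩; exact ⟨g * h, hΦm g h⟩
      zero_mem' := ⟨1, hΦ1⟩
      smul_mem' := by
        rintro a _ ⟨g, rfl⟩
        have hc : IsClosed {a : ℤ_[ℓ] | a • Φ g ∈ Set.range Φ} :=
          hcl.preimage (continuous_id.smul continuous_const)
        refine hc.closure_subset_iff.2 ?_ (PadicInt.denseRange_natCast a)
        rintro _ ⟨n, rfl⟩
        exact ⟨g ^ n, by rw [hΦp, Nat.cast_smul_eq_nsmul]⟩ }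
  let Ψ : G →* Multiplicative Λ :=
    MonoidHom.mk' (fun g => Multiplicative.ofAdd ⟨Φ g, g, rfl⟩) fun g h => by
      rw [← ofAdd_add]; congr 1; exact Subtype.ext (hΦm g h)
  have hΨ : Function.Surjective Ψ := fun y => by
    obtain ⟨g, hg⟩ := y.toAdd.2
    exact ⟨g, congrArg Multiplicative.ofAdd (Subtype.ext hg)⟩
  have hΨker : Ψ.ker ≤ χ.ker := by
    intro g hg
    by_contra hcon
    have h1 : Φ g = 0 := congrArg (fun y : Multiplicative Λ => (y.toAdd : u → ℤ_[ℓ])) hg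
    have h2 : g ∈ (χ.ker : Set G)ᶜ ∩ ⋂ φ ∈ u, (φ.1.ker : Set G) := by
      refine ⟨hcon, ?_⟩
      simp only [Set.mem_iInter]
      exact fun φ hφ => congrFun h1 ⟨φ, hφ⟩
    rw [hu] at h2
    exact h2
  let χ' : Λ →+ Additive M := MonoidHom.toAdditiveRight (Ψ.liftOfSurjective hΨ ⟨χ, hΨker⟩)
  have hχ' : ∀ g, χ' ⟨Φ g, g, rfl⟩ = Additive.ofMul (χ g) := fun g =>
    congrArg Additive.ofMul (Ψ.liftOfRightInverse_comp_apply _ _ ⟨χ, hΨker⟩ g)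
  have hχz' : ∀ y, ∃ n : ℕ, χ' y = n • Additive.ofMul z := by
    rintro ⟨_, g, rfl⟩
    obtain ⟨n, hn⟩ := hχz g
    exact ⟨n, by rw [hχ', hn, ofMul_pow]⟩
  have hz' : (ℓ ^ k) • Additive.ofMul z = 0 := by rw [← ofMul_pow, hz, ofMul_one]
  let e := Module.Free.chooseBasis ℤ_[ℓ] Λ
  choose n hn using fun j => hχz' (e j)
  let ψ : Λ →ₗ[ℤ_[ℓ]] ℤ_[ℓ] := e.constr ℤ_[ℓ] fun j => (n j : ℤ_[ℓ])
  have hψ : ∀ y, ψ y = ∑ j, e.repr y j * n j := fun y => by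
    rw [Module.Basis.constr_apply_fintype]
    rfl
  have hψc : Continuous ψ := by
    have h1 : Continuous e.equivFun.symm := by
      refine continuous_induced_rng.2 ?_
      have : (Subtype.val ∘ e.equivFun.symm : _ → u → ℤ_[ℓ]) =
          fun x => ∑ i, x i • (e i : u → ℤ_[ℓ]) := by
        ext x : 1
        simp [Module.Basis.equivFun_symm_apply]
      rw [this]
      exact continuous_finsetSum _ fun i _ => (continuous_apply i).smul continuous_const
    have h2 : Continuous e.equivFun :=
      (Continuous.homeoOfEquivCompactToT2 (f := e.equivFun.symm.toEquiv) h1).symm.continuous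
    have h3 : (ψ : Λ → ℤ_[ℓ]) = fun y => ∑ j, e.equivFun y j * n j := funext hψ
    rw [h3]
    exact continuous_finsetSum _ fun j _ =>
      ((continuous_apply j).comp h2).mul continuous_const
  refine ⟨MonoidHom.mk' (fun g => Multiplicative.ofAdd (ψ ⟨Φ g, g, rfl⟩)) fun g h => ?_,
    hψc.comp (hΦ.subtype_mk _), fun g N hN => ?_⟩
  · rw [← ofAdd_add, ← map_add]; congr 2; exact Subtype.ext (hΦm g h)
  · change _ ∣ ψ ⟨Φ g, g, rfl⟩ - (N : ℤ_[ℓ]) at hN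
    apply Additive.ofMul.injective
    rw [← hχ', ofMul_pow]
    rw [hψ] at hN
    exact eq_nsmul_of_dvd_constr_sub e χ' hz' hχz' hn hN

end CompactGroups

/-! ### The absolute Galois group and the cyclotomic tower -/

section CyclotomicTower

variable {ℓ} {K Ω : Type*} [Field K] [Field Ω] [Algebra K Ω]

/-- The standing hypotheses on the base field and on the generator `γ` of `Gal(K_∞ / K)`: the
`ℓ ^ m`-th roots of unity lie in `K`, and `γ` raises the roots of unity of `ℓ`-power order to the
power `1 + ℓ ^ m`. Given `m ≠ 0`, the inequality `m + 2 ≤ ℓ * m` excludes only the case `ℓ = 2`,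
`m = 1`, where the order of `1 + ℓ ^ m = 3` modulo `ℓ ^ (m + N)` is not `ℓ ^ N` for `N ≥ 2`. -/
structure IsCycGenerator (m : ℕ) (γ : Gal(cycTop ℓ K Ω/K)) : Prop where
  ne_zero : m ≠ 0
  add_two_le : m + 2 ≤ ℓ * m
  mem_range : ∀ ζ : Ω, ζ ^ ℓ ^ m = 1 → ζ ∈ Set.range (algebraMap K Ω)
  apply_root : ∀ (k : ℕ) (ζ : cycTop ℓ K Ω), ζ ^ ℓ ^ k = 1 → γ ζ = ζ ^ (1 + ℓ ^ m)

variable (ℓ K Ω) in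
/-- The subgroup of the absolute Galois group that fixes the `ℓ ^ k`-th roots of unity, for all
`k`. -/
def rootFixer : Subgroup Gal(Ω/K) where
  carrier := {g | ∀ (k : ℕ) (ζ : Ω), ζ ^ ℓ ^ k = 1 → g ζ = ζ}
  one_mem' _ _ _ := rfl
  mul_mem' ha hb k ζ h := by rw [AlgEquiv.mul_apply, hb k ζ h, ha k ζ h]
  inv_mem' {a} ha k ζ h := by
    rw [AlgEquiv.aut_inv, AlgEquiv.symm_apply_eq, ha k ζ h]

variable (ℓ K Ω) in
/-- The subgroup of the absolute Galois group that fixes the `ℓ ^ k`-th roots of unity. -/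
def levelFixer (k : ℕ) : Subgroup Gal(Ω/K) where
  carrier := {g | ∀ ζ : Ω, ζ ^ ℓ ^ k = 1 → g ζ = ζ}
  one_mem' _ _ := rfl
  mul_mem' ha hb ζ h := by rw [AlgEquiv.mul_apply, hb ζ h, ha ζ h]
  inv_mem' {a} ha ζ h := by
    rw [AlgEquiv.aut_inv, AlgEquiv.symm_apply_eq, ha ζ h]

theorem rootFixer_le_levelFixer (k : ℕ) : rootFixer ℓ K Ω ≤ levelFixer ℓ K Ω k :=
  fun _ hg ζ h => hg k ζ h

theorem levelFixer_succ_le (k : ℕ) : levelFixer ℓ K Ω (k + 1) ≤ levelFixer ℓ K Ω k :=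
  fun _ hg ζ h => hg ζ (by rw [pow_succ, pow_mul, h, one_pow])

instance levelFixer_normal (k : ℕ) : (levelFixer ℓ K Ω k).Normal where
  conj_mem n hn g ζ h := by
    rw [AlgEquiv.mul_apply, AlgEquiv.mul_apply, hn (g⁻¹ ζ) (by rw [← map_pow, h, map_one]),
      AlgEquiv.aut_inv, AlgEquiv.apply_symm_apply]

instance rootFixer_normal : (rootFixer ℓ K Ω).Normal where
  conj_mem n hn g k ζ h := by
    rw [AlgEquiv.mul_apply, AlgEquiv.mul_apply, hn k (g⁻¹ ζ) (by rw [← map_pow, h, map_one]),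
      AlgEquiv.aut_inv, AlgEquiv.apply_symm_apply]

theorem fixingSubgroup_adjoin_eq {S : Set Ω} {V : Subgroup Gal(Ω/K)}
    (h : ∀ g : Gal(Ω/K), g ∈ V ↔ ∀ x ∈ S, g x = x) :
    (IntermediateField.adjoin K S).fixingSubgroup = V := by
  ext g
  rw [IntermediateField.mem_fixingSubgroup_iff, h]
  exact IntermediateField.forall_mem_adjoin_smul_eq_self_iff K g

theorem fixingSubgroup_cycTop : (cycTop ℓ K Ω).fixingSubgroup = rootFixer ℓ K Ω :=
  fixingSubgroup_adjoin_eq fun g => by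
    constructor
    · rintro hg ζ ⟨k, hk⟩
      exact hg k ζ hk
    · exact fun hg k ζ hk => hg ζ ⟨k, hk⟩

theorem lift_layer (m n : ℕ) : IntermediateField.lift (layer ℓ K Ω m n) =
    IntermediateField.adjoin K {ζ : Ω | ζ ^ ℓ ^ (m + n) = 1} := by
  rw [layer, IntermediateField.lift_adjoin]
  congr 1
  ext ζ
  constructor
  · rintro ⟨ξ, hξ, rfl⟩
    change (ξ : Ω) ^ ℓ ^ (m + n) = 1
    have h1 : ξ ^ ℓ ^ (m + n) = 1 := hξ
    exact_mod_cast congrArg Subtype.val h1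
  · intro (hζ : ζ ^ ℓ ^ (m + n) = 1)
    exact ⟨⟨ζ, IntermediateField.subset_adjoin K _ ⟨_, hζ⟩⟩, Subtype.ext hζ, rfl⟩

theorem fixingSubgroup_lift_layer (m n : ℕ) :
    (IntermediateField.lift (layer ℓ K Ω m n)).fixingSubgroup = levelFixer ℓ K Ω (m + n) := by
  rw [lift_layer]
  exact fixingSubgroup_adjoin_eq fun g => Iff.rfl

theorem levelFixer_apply_layer {m n : ℕ} {g : Gal(Ω/K)} (hg : g ∈ levelFixer ℓ K Ω (m + n))
    (x : layer ℓ K Ω m n) : g ((x : cycTop ℓ K Ω) : Ω) = ((x : cycTop ℓ K Ω) : Ω) := by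
  rw [← fixingSubgroup_lift_layer, IntermediateField.mem_fixingSubgroup_iff] at hg
  exact hg _ ((IntermediateField.mem_lift _).2 x.2)

theorem rootFixer_apply_cycTop {g : Gal(Ω/K)} (hg : g ∈ rootFixer ℓ K Ω) (x : cycTop ℓ K Ω) :
    g (x : Ω) = x := by
  rw [← fixingSubgroup_cycTop, IntermediateField.mem_fixingSubgroup_iff] at hg
  exact hg _ x.2

variable [IsGalois K Ω]

theorem exists_layer_of_fixed {m n : ℕ} {y : Ω} (h : ∀ g ∈ levelFixer ℓ K Ω (m + n), g y = y) :
    ∃ x : layer ℓ K Ω m n, ((x : cycTop ℓ K Ω) : Ω) = y := by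
  have h1 : y ∈ IntermediateField.lift (layer ℓ K Ω m n) := by
    rw [← InfiniteGalois.fixedField_fixingSubgroup (IntermediateField.lift (layer ℓ K Ω m n)),
      fixingSubgroup_lift_layer, IntermediateField.mem_fixedField_iff]
    exact h
  have h2 : y ∈ cycTop ℓ K Ω := IntermediateField.lift_le _ h1
  exact ⟨⟨⟨y, h2⟩, (IntermediateField.mem_lift (⟨y, h2⟩ : cycTop ℓ K Ω)).1 h1⟩, rfl⟩

theorem exists_unit_layer_of_fixed {m n : ℕ} {y : Ω} (hy : y ≠ 0)
    (h : ∀ g ∈ levelFixer ℓ K Ω (m + n), g y = y) :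
    ∃ x : (layer ℓ K Ω m n)ˣ, (((x : layer ℓ K Ω m n) : cycTop ℓ K Ω) : Ω) = y := by
  obtain ⟨x, rfl⟩ := exists_layer_of_fixed h
  refine ⟨Units.mk0 x ?_, rfl⟩
  rintro rfl
  exact hy rfl

instance normal_cycTop : Normal K (cycTop ℓ K Ω) := by
  rw [IntermediateField.normal_iff_forall_map_le]
  intro σ
  rw [cycTop, IntermediateField.adjoin_map]
  refine IntermediateField.adjoin.mono _ _ _ ?_
  rintro _ ⟨ζ, ⟨k, hk⟩, rfl⟩
  exact ⟨k, by rw [← map_pow, hk, map_one]⟩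

theorem exists_lift_generator (γ : Gal(cycTop ℓ K Ω/K)) :
    ∃ τ : Gal(Ω/K), ∀ x : cycTop ℓ K Ω, τ (x : Ω) = (γ x : cycTop ℓ K Ω) := by
  obtain ⟨τ, rfl⟩ := AlgEquiv.restrictNormalHom_surjective (F := K) (K₁ := cycTop ℓ K Ω) Ω γ
  exact ⟨τ, fun x => (AlgEquiv.restrictNormal_commutes τ (cycTop ℓ K Ω) x).symm⟩

theorem mem_cycTop_of_pow {k : ℕ} {ζ : Ω} (h : ζ ^ ℓ ^ k = 1) : ζ ∈ cycTop ℓ K Ω :=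
  IntermediateField.subset_adjoin K _ ⟨k, h⟩

variable {m : ℕ} {γ : Gal(cycTop ℓ K Ω/K)} {τ : Gal(Ω/K)}

theorem apply_root_of_lift (hγ : IsCycGenerator m γ)
    (hτ : ∀ x : cycTop ℓ K Ω, τ (x : Ω) = (γ x : cycTop ℓ K Ω)) {k : ℕ} {ζ : Ω}
    (h : ζ ^ ℓ ^ k = 1) : τ ζ = ζ ^ (1 + ℓ ^ m) := by
  have h1 := hτ ⟨ζ, mem_cycTop_of_pow h⟩
  rw [hγ.apply_root k _ (Subtype.ext h)] at h1
  exact h1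

theorem pow_apply_root_of_lift (hγ : IsCycGenerator m γ)
    (hτ : ∀ x : cycTop ℓ K Ω, τ (x : Ω) = (γ x : cycTop ℓ K Ω)) {k : ℕ} {ζ : Ω}
    (h : ζ ^ ℓ ^ k = 1) (i : ℕ) : (τ ^ i) ζ = ζ ^ (1 + ℓ ^ m) ^ i := by
  induction i with
  | zero => simp
  | succ i ih =>
    rw [pow_succ', AlgEquiv.mul_apply, ih, map_pow, apply_root_of_lift hγ hτ h, ← pow_mul,
      ← pow_succ']

theorem primitive_pow_eq_iff {ξ : Ω} {k : ℕ} (hξ : IsPrimitiveRoot ξ (ℓ ^ k)) {a b : ℕ} :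
    ξ ^ a = ξ ^ b ↔ a ≡ b [MOD ℓ ^ k] := by
  have : NeZero (ℓ ^ k) := ⟨pow_ne_zero _ (Fact.out : ℓ.Prime).ne_zero⟩
  have hu := hξ.isUnit this.out
  obtain ⟨u, rfl⟩ := hu
  rw [← Units.val_pow_eq_pow_val, ← Units.val_pow_eq_pow_val, Units.val_inj,
    pow_eq_pow_iff_modEq, ← IsPrimitiveRoot.eq_orderOf (IsPrimitiveRoot.coe_units_iff.1 hξ)]

variable [IsAlgClosed Ω] [CharZero Ω]

theorem exists_primitive (k : ℕ) : ∃ ξ : Ω, IsPrimitiveRoot ξ (ℓ ^ k) := by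
  have : NeZero (ℓ ^ k) := ⟨pow_ne_zero _ (Fact.out : ℓ.Prime).ne_zero⟩
  exact HasEnoughRootsOfUnity.exists_primitiveRoot Ω (ℓ ^ k)

theorem mem_levelFixer_iff {k : ℕ} {ξ : Ω} (hξ : IsPrimitiveRoot ξ (ℓ ^ k)) {g : Gal(Ω/K)} :
    g ∈ levelFixer ℓ K Ω k ↔ g ξ = ξ := by
  have : NeZero (ℓ ^ k) := ⟨pow_ne_zero _ (Fact.out : ℓ.Prime).ne_zero⟩
  refine ⟨fun h => h _ hξ.pow_eq_one, fun h ζ hζ => ?_⟩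
  obtain ⟨i, -, rfl⟩ := hξ.eq_pow_of_pow_eq_one hζ
  rw [map_pow, h]

theorem isOpen_levelFixer (k : ℕ) : IsOpen (levelFixer ℓ K Ω k : Set Gal(Ω/K)) := by
  obtain ⟨ξ, hξ⟩ := exists_primitive (ℓ := ℓ) (Ω := Ω) k
  convert stabilizer_isOpen_of_isIntegral (K := K) ξ using 1
  ext g
  exact mem_levelFixer_iff hξ

theorem pow_mem_levelFixer_iff (hγ : IsCycGenerator m γ)
    (hτ : ∀ x : cycTop ℓ K Ω, τ (x : Ω) = (γ x : cycTop ℓ K Ω)) (n i : ℕ) :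
    τ ^ i ∈ levelFixer ℓ K Ω (m + n) ↔ ℓ ^ n ∣ i := by
  obtain ⟨ξ, hξ⟩ := exists_primitive (ℓ := ℓ) (Ω := Ω) (m + n)
  rw [mem_levelFixer_iff hξ, pow_apply_root_of_lift hγ hτ hξ.pow_eq_one,
    ← one_add_pow_modEq_one_iff hγ.ne_zero hγ.add_two_le, ← primitive_pow_eq_iff hξ, pow_one]

theorem zpow_mem_levelFixer_iff (hγ : IsCycGenerator m γ)
    (hτ : ∀ x : cycTop ℓ K Ω, τ (x : Ω) = (γ x : cycTop ℓ K Ω)) (n : ℕ) (i : ℤ) :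
    τ ^ i ∈ levelFixer ℓ K Ω (m + n) ↔ ((ℓ ^ n : ℕ) : ℤ) ∣ i := by
  obtain ⟨i, rfl | rfl⟩ := i.eq_nat_or_neg
  · rw [zpow_natCast, pow_mem_levelFixer_iff hγ hτ, Int.natCast_dvd_natCast]
  · rw [zpow_neg, zpow_natCast, inv_mem_iff, pow_mem_levelFixer_iff hγ hτ, Int.dvd_neg,
      Int.natCast_dvd_natCast]

theorem exists_pow_mul_inv_mem_levelFixer (hγ : IsCycGenerator m γ)
    (hτ : ∀ x : cycTop ℓ K Ω, τ (x : Ω) = (γ x : cycTop ℓ K Ω)) (g : Gal(Ω/K)) (n : ℕ) :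
    ∃ i : ℕ, τ ^ i * g⁻¹ ∈ levelFixer ℓ K Ω (m + n) := by
  obtain ⟨ξ, hξ⟩ := exists_primitive (ℓ := ℓ) (Ω := Ω) (m + n)
  have : NeZero (ℓ ^ (m + n)) := ⟨pow_ne_zero _ (Fact.out : ℓ.Prime).ne_zero⟩
  obtain ⟨c, -, hc⟩ := hξ.eq_pow_of_pow_eq_one (ξ := g ξ)
    (by rw [← map_pow, hξ.pow_eq_one, map_one])
  have hc1 : c ≡ 1 [MOD ℓ ^ m] := by
    have hξm : IsPrimitiveRoot (ξ ^ ℓ ^ n) (ℓ ^ m) :=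
      hξ.pow (pow_pos (Fact.out : ℓ.Prime).pos _) (by rw [← pow_add, add_comm])
    rw [← primitive_pow_eq_iff hξm, pow_one, ← pow_mul, mul_comm, pow_mul, hc, ← map_pow]
    obtain ⟨x, hx⟩ := hγ.mem_range _ hξm.pow_eq_one
    rw [← hx, AlgEquiv.commutes]
  obtain ⟨i, hi⟩ := exists_one_add_pow_modEq hγ.ne_zero hγ.add_two_le n c hc1
  refine ⟨i, ?_⟩
  have h1 : (τ ^ i) ξ = g ξ := by
    rw [pow_apply_root_of_lift hγ hτ hξ.pow_eq_one, ← hc, primitive_pow_eq_iff hξ]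
    exact hi
  have h2 : g⁻¹ * τ ^ i ∈ levelFixer ℓ K Ω (m + n) := by
    rw [mem_levelFixer_iff hξ, AlgEquiv.mul_apply, h1, AlgEquiv.aut_inv, AlgEquiv.symm_apply_apply]
  simpa [mul_assoc] using (levelFixer_normal (ℓ := ℓ) (K := K) (Ω := Ω) (m + n)).conj_mem _ h2 g

theorem mem_rootFixer_of_forall {g : Gal(Ω/K)} (m : ℕ)
    (h : ∀ n, g ∈ levelFixer ℓ K Ω (m + n)) : g ∈ rootFixer ℓ K Ω :=
  fun k ζ hζ => h k ζ (by rw [add_comm, pow_add, pow_mul, hζ, one_pow])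

/-- The automorphism `γ` generates `Gal(K_∞ / K)` topologically. -/
theorem dense_rootFixer_mul_zpowers (hγ : IsCycGenerator m γ)
    (hτ : ∀ x : cycTop ℓ K Ω, τ (x : Ω) = (γ x : cycTop ℓ K Ω)) :
    Dense {g : Gal(Ω/K) | ∃ h ∈ rootFixer ℓ K Ω, ∃ i : ℤ, g = h * τ ^ i} :=
  dense_mul_zpowers _ (fun n => levelFixer ℓ K Ω (m + n)) (fun n => isOpen_levelFixer _)
    (fun n => levelFixer_succ_le _) (fun _ h => mem_rootFixer_of_forall m h) τ fun g n => by
      obtain ⟨i, hi⟩ := exists_pow_mul_inv_mem_levelFixer hγ hτ g n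
      exact ⟨i, by rwa [zpow_natCast]⟩

/-- An element fixed by `Gal(Ω / K_∞)` and by the `ℓ ^ n`-th power of a lift of `γ` is fixed by the
whole of `Gal(Ω / K_n)`. -/
theorem fixed_levelFixer_of_fixed (hγ : IsCycGenerator m γ)
    (hτ : ∀ x : cycTop ℓ K Ω, τ (x : Ω) = (γ x : cycTop ℓ K Ω)) {n : ℕ} {y : Ω}
    (h1 : ∀ h ∈ rootFixer ℓ K Ω, h y = y) (h2 : (τ ^ ℓ ^ n) y = y) :
    ∀ g ∈ levelFixer ℓ K Ω (m + n), g y = y := by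
  intro g hg
  set S := MulAction.stabilizer Gal(Ω/K) y
  have hS : IsOpen (S : Set Gal(Ω/K)) := stabilizer_isOpen_of_isIntegral y
  have ho : IsOpen ((fun x => g⁻¹ * x) ⁻¹' ((S ⊓ levelFixer ℓ K Ω (m + n) : Subgroup _) :
      Set Gal(Ω/K))) := (hS.inter (isOpen_levelFixer _)).preimage (continuous_const_mul _)
  obtain ⟨x, hx, h, hh, i, rfl⟩ := (dense_rootFixer_mul_zpowers hγ hτ).inter_open_nonempty _ ho
    ⟨g, by
      change g⁻¹ * g ∈ S ⊓ levelFixer ℓ K Ω (m + n)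
      rw [inv_mul_cancel]; exact one_mem _⟩
  obtain ⟨hx1, hx2⟩ := hx
  have h3 : h * τ ^ i ∈ levelFixer ℓ K Ω (m + n) :=
    (Subgroup.mul_mem_cancel_left _ (inv_mem hg)).1 hx2
  rw [Subgroup.mul_mem_cancel_left _ (rootFixer_le_levelFixer _ hh),
    zpow_mem_levelFixer_iff hγ hτ] at h3
  obtain ⟨j, rfl⟩ := h3
  have h4 : h * τ ^ (((ℓ ^ n : ℕ) : ℤ) * j) ∈ S := by
    refine mul_mem (h1 h hh) ?_
    rw [zpow_mul, zpow_natCast]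
    exact zpow_mem (show τ ^ ℓ ^ n ∈ S from h2) j
  have h5 : g⁻¹ ∈ S := (Subgroup.mul_mem_cancel_right _ h4).1 hx1
  exact inv_mem_iff.1 h5

end CyclotomicTower

/-! ### `ℤ_ℓ`-extensions and homomorphisms to `ℤ_ℓ` -/

section ZlExtensions

variable {ℓ} {K Ω : Type*} [Field K] [Field Ω] [Algebra K Ω] [IsGalois K Ω]

/-- The compositum `Z` is fixed by the common kernel of the homomorphisms to `ℤ_ℓ`. -/
theorem apply_zlCompositum {g : Gal(Ω/K)}
    (hg : ∀ φ : Gal(Ω/K) →* Multiplicative ℤ_[ℓ], Continuous φ → φ g = 1) {y : Ω}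
    (hy : y ∈ zlCompositum ℓ K Ω) : g y = y := by
  suffices h : zlCompositum ℓ K Ω ≤ IntermediateField.fixedField (Subgroup.zpowers g) by
    exact (IntermediateField.mem_fixedField_iff _ _).1 (h hy) g (Subgroup.mem_zpowers g)
  refine sSup_le ?_
  rintro L ⟨hL, ⟨e⟩⟩
  have : g ∈ L.fixingSubgroup := by
    rw [← IntermediateField.restrictNormalHom_ker, MonoidHom.mem_ker]
    have := hg (e.toMulEquiv.toMonoidHom.comp (AlgEquiv.restrictNormalHom L))
      (e.continuous.comp (InfiniteGalois.restrictNormalHom_continuous L))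
    exact (map_eq_one_iff e e.injective).1 this
  rw [IntermediateField.le_iff_le]
  exact (Subgroup.zpowers_le).2 this

theorem isZlExtension_fixedField (φ : Gal(Ω/K) →* Multiplicative ℤ_[ℓ]) (hφ : Continuous φ)
    (hs : Function.Surjective φ) :
    IsZlExtension (ℓ := ℓ) (IntermediateField.fixedField φ.ker) := by
  have : T2Space (Multiplicative ℤ_[ℓ]) := inferInstanceAs (T2Space ℤ_[ℓ])
  have hcl : IsClosed (φ.ker : Set Gal(Ω/K)) := isClosed_singleton.preimage hφ
  set L := IntermediateField.fixedField φ.ker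
  have hfix : L.fixingSubgroup = φ.ker :=
    InfiniteGalois.fixingSubgroup_fixedField ⟨φ.ker, hcl⟩
  have hn : L.fixingSubgroup.Normal := by rw [hfix]; infer_instance
  have hL : IsGalois K L := (InfiniteGalois.normal_iff_isGalois L).1 hn
  refine ⟨hL, ?_⟩
  let ρ : Gal(Ω/K) →* Gal(L/K) := AlgEquiv.restrictNormalHom L
  have hρs : Function.Surjective ρ := AlgEquiv.restrictNormalHom_surjective Ω
  have hρc : Continuous ρ := InfiniteGalois.restrictNormalHom_continuous L
  have hker : ρ.ker = φ.ker := (IntermediateField.restrictNormalHom_ker L).trans hfix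
  let e : Gal(L/K) ≃* Multiplicative ℤ_[ℓ] :=
    ((QuotientGroup.quotientKerEquivOfSurjective ρ hρs).symm.trans
      (QuotientGroup.quotientMulEquivOfEq hker)).trans
      (QuotientGroup.quotientKerEquivOfSurjective φ hs)
  have he : ∀ g, e (ρ g) = φ g := by
    intro g
    have : (QuotientGroup.quotientKerEquivOfSurjective ρ hρs).symm (ρ g) = QuotientGroup.mk g := by
      rw [MulEquiv.symm_apply_eq]; rfl
    change (QuotientGroup.quotientKerEquivOfSurjective φ hs)
      (QuotientGroup.quotientMulEquivOfEq hker
        ((QuotientGroup.quotientKerEquivOfSurjective ρ hρs).symm (ρ g))) = φ g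
    rw [this]
    rfl
  have hec : Continuous e := by
    have hq : Topology.IsQuotientMap ρ := hρc.isClosedMap.isQuotientMap hρc hρs
    rw [hq.continuous_iff]
    convert hφ using 1
    exact funext he
  exact ⟨{ e with
    continuous_toFun := hec
    continuous_invFun :=
      (Continuous.homeoOfEquivCompactToT2 (f := e.toEquiv) hec).symm.continuous }⟩

/-- A nonzero homomorphism to `ℤ_ℓ` is a multiple of a surjective one. -/
theorem exists_surjective_ker_eq {G : Type*} [Group G] [TopologicalSpace G] [CompactSpace G]
    (φ : G →* Multiplicative ℤ_[ℓ]) (hφ : Continuous φ) (h1 : φ ≠ 1) :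
    ∃ φ' : G →* Multiplicative ℤ_[ℓ], Continuous φ' ∧ Function.Surjective φ' ∧
      φ'.ker = φ.ker := by
  have : T2Space (Multiplicative ℤ_[ℓ]) := inferInstanceAs (T2Space ℤ_[ℓ])
  have hcl : IsClosed (Set.range φ) := (isCompact_range hφ).isClosed
  let I : Ideal ℤ_[ℓ] :=
    { carrier := {a | ∃ g, φ g = Multiplicative.ofAdd a}
      add_mem' := by
        rintro a b ⟨g, hg⟩ ⟨h, hh⟩
        exact ⟨g * h, by rw [map_mul, hg, hh]; rfl⟩
      zero_mem' := ⟨1, map_one φ⟩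
      smul_mem' := by
        rintro c a ⟨g, hg⟩
        have hc : IsClosed {c : ℤ_[ℓ] | Multiplicative.ofAdd (c * a) ∈ Set.range φ} :=
          hcl.preimage (continuous_mul_const (M := ℤ_[ℓ]) a)
        refine hc.closure_subset_iff.2 ?_ (PadicInt.denseRange_natCast c)
        rintro _ ⟨n, rfl⟩
        exact ⟨g ^ n, by rw [map_pow, hg, ← ofAdd_nsmul, nsmul_eq_mul]⟩ }
  obtain ⟨d, hd⟩ := (inferInstance : I.IsPrincipal)
  have hmem : ∀ a, (∃ g, φ g = Multiplicative.ofAdd a) ↔ d ∣ a := fun a => by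
    change a ∈ I ↔ _
    rw [hd]; exact Ideal.mem_span_singleton
  have hd0 : d ≠ 0 := by
    rintro rfl
    refine h1 (MonoidHom.ext fun g => ?_)
    have := (hmem (φ g).toAdd).1 ⟨g, rfl⟩
    exact zero_dvd_iff.1 this
  choose f hf using fun g => (hmem (φ g).toAdd).1 ⟨g, rfl⟩
  have hinj : ∀ a b : ℤ_[ℓ], d * a = d * b → a = b := fun a b h => mul_left_cancel₀ hd0 h
  refine ⟨MonoidHom.mk' (fun g => Multiplicative.ofAdd (f g)) fun g h => ?_, ?_, ?_, ?_⟩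
  · rw [← ofAdd_add]
    congr 1
    exact hinj _ _ (by rw [← hf, map_mul, toAdd_mul, hf, hf h, mul_add])
  · have hemb : Topology.IsClosedEmbedding (fun a : ℤ_[ℓ] => d * a) :=
      (continuous_const.mul continuous_id).isClosedEmbedding fun a b h => hinj a b h
    have h2 : Continuous f := by
      rw [hemb.isInducing.continuous_iff]
      have h3 : (fun a => d * a) ∘ f = fun g => (φ g).toAdd := funext fun g => (hf g).symm
      rw [h3]
      exact hφ
    exact h2
  · intro a
    obtain ⟨g, hg⟩ := (hmem (d * a.toAdd)).2 (dvd_mul_right _ _)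
    refine ⟨g, ?_⟩
    have := hf g
    rw [hg] at this
    exact (hinj _ _ this).symm
  · ext g
    rw [MonoidHom.mem_ker, MonoidHom.mem_ker]
    have h3 := hf g
    constructor
    · intro h
      have h4 : f g = 0 := h
      rw [h4, mul_zero] at h3
      exact h3
    · intro h
      rw [h] at h3
      exact (mul_eq_zero.1 h3.symm).resolve_left hd0

theorem fixedField_ker_le_zlCompositum (φ : Gal(Ω/K) →* Multiplicative ℤ_[ℓ])
    (hφ : Continuous φ) : IntermediateField.fixedField φ.ker ≤ zlCompositum ℓ K Ω := by
  by_cases h1 : φ = 1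
  · intro y hy
    have h2 : y ∈ (⊥ : IntermediateField K Ω) := by
      rw [InfiniteGalois.mem_bot_iff_fixed]
      intro g
      exact (IntermediateField.mem_fixedField_iff _ _).1 hy g (by rw [h1]; rfl)
    exact bot_le (a := zlCompositum ℓ K Ω) h2
  · obtain ⟨φ', hc, hs, hk⟩ := exists_surjective_ker_eq φ hφ h1
    rw [← hk]
    exact le_sSup (isZlExtension_fixedField φ' hc hs)

/-- An element fixed by the common kernel of two homomorphisms to `ℤ_ℓ` lies in `Z`. -/
theorem mem_zlCompositum_of_fixed {φ κ : Gal(Ω/K) →* Multiplicative ℤ_[ℓ]} (hφ : Continuous φ)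
    (hκ : Continuous κ) {y : Ω} (hy : ∀ g, φ g = 1 → κ g = 1 → g y = y) :
    y ∈ zlCompositum ℓ K Ω := by
  have : T2Space (Multiplicative ℤ_[ℓ]) := inferInstanceAs (T2Space ℤ_[ℓ])
  have h1 : ∀ ψ : Gal(Ω/K) →* Multiplicative ℤ_[ℓ], Continuous ψ →
      (IntermediateField.fixedField ψ.ker).fixingSubgroup = ψ.ker := fun ψ hψ =>
    InfiniteGalois.fixingSubgroup_fixedField ⟨ψ.ker, isClosed_singleton.preimage hψ⟩
  have h2 : y ∈ IntermediateField.fixedField φ.ker ⊔ IntermediateField.fixedField κ.ker := by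
    rw [← InfiniteGalois.fixedField_fixingSubgroup
      (IntermediateField.fixedField φ.ker ⊔ IntermediateField.fixedField κ.ker),
      IntermediateField.fixingSubgroup_sup, h1 φ hφ, h1 κ hκ, IntermediateField.mem_fixedField_iff]
    exact fun g hg => hy g hg.1 hg.2
  exact sup_le (fixedField_ker_le_zlCompositum φ hφ) (fixedField_ker_le_zlCompositum κ hκ) h2

end ZlExtensions

section InitialRadical

variable {ℓ} {K Ω : Type*} [Field K] [Field Ω] [Algebra K Ω] [IsGalois K Ω] [IsAlgClosed Ω]
  [CharZero Ω] {m : ℕ} {γ : Gal(cycTop ℓ K Ω/K)} {τ : Gal(Ω/K)}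

/-- If `x ^ (1 / ℓ ^ m)` lies in the compositum `Z` of the `ℤ_ℓ`-extensions then its Kummer
character is the reduction modulo `ℓ ^ m` of a homomorphism to `ℤ_ℓ`. -/
theorem exists_hom_of_mem_zlCompositum (hγ : IsCycGenerator m γ) {ξ : Ω}
    (hξ : IsPrimitiveRoot ξ (ℓ ^ m)) {x : Kˣ} {b : Ω} (hb : b ^ ℓ ^ m = algebraMap K Ω x)
    (hbZ : b ∈ zlCompositum ℓ K Ω) :
    ∃ φ : Gal(Ω/K) →* Multiplicative ℤ_[ℓ], Continuous φ ∧
      ∀ (g : Gal(Ω/K)) (n : ℕ), (ℓ : ℤ_[ℓ]) ^ m ∣ (φ g).toAdd - n → g b = ξ ^ n * b := by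
  have hp : ℓ.Prime := Fact.out
  have : NeZero (ℓ ^ m) := ⟨pow_ne_zero _ hp.ne_zero⟩
  have hb0 : b ≠ 0 := by
    rintro rfl
    rw [zero_pow this.out] at hb
    exact (map_ne_zero (algebraMap K Ω)).2 x.ne_zero hb.symm
  have hroot : ∀ g : Gal(Ω/K), (g b / b) ^ ℓ ^ m = 1 := fun g => by
    rw [div_pow, ← map_pow, hb, AlgEquiv.commutes, div_self]
    exact (map_ne_zero (algebraMap K Ω)).2 x.ne_zero
  have hfix : ∀ g h : Gal(Ω/K), g (h b / b) = h b / b := fun g h => by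
    obtain ⟨y, hy⟩ := hγ.mem_range _ (hroot h)
    rw [← hy, AlgEquiv.commutes]
  let χ : Gal(Ω/K) →* Ωˣ := MonoidHom.mk'
    (fun g => Units.mk0 (g b / b) (div_ne_zero ((map_ne_zero g).2 hb0) hb0)) fun g h => by
      ext
      have := hfix g h
      rw [map_div₀] at this
      change (g * h) b / b = g b / b * (h b / b)
      rw [← this, AlgEquiv.mul_apply]
      field_simp [(map_ne_zero g).2 hb0]
  have hχ : ∀ g, ((χ g : Ωˣ) : Ω) = g b / b := fun g => rfl
  have hχ1 : ∀ g, χ g = 1 ↔ g b = b := fun g => by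
    rw [← Units.val_inj, hχ, Units.val_one, div_eq_one_iff_eq hb0]
  let z : Ωˣ := (hξ.isUnit this.out).unit
  have hz : (z : Ω) = ξ := rfl
  obtain ⟨φ, hφ, h⟩ := exists_hom_lift χ
    (by
      convert stabilizer_isOpen_of_isIntegral (K := K) b using 1
      ext g
      exact hχ1 g)
    (fun g hg => (hχ1 g).2 (apply_zlCompositum hg hbZ))
    (k := m) (z := z) (Units.ext hξ.pow_eq_one) (fun g => by
      obtain ⟨i, -, hi⟩ := hξ.eq_pow_of_pow_eq_one (hroot g)
      exact ⟨i, Units.ext hi.symm⟩)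
  refine ⟨φ, hφ, fun g n hn => ?_⟩
  have h1 := congrArg (fun u : Ωˣ => (u : Ω)) (h g n hn)
  simp only [hχ, Units.val_pow_eq_pow_val, hz] at h1
  rw [← h1, div_mul_cancel₀ _ hb0]

theorem exists_ker_le_rootFixer (hγ : IsCycGenerator m γ) :
    ∃ κ : Gal(Ω/K) →* Multiplicative ℤ_[ℓ], Continuous κ ∧ ∀ g, κ g = 1 → g ∈ rootFixer ℓ K Ω := by
  obtain ⟨τ, hτ⟩ := exists_lift_generator γ
  exact exists_hom_ker_le (rootFixer ℓ K Ω) (fun n => levelFixer ℓ K Ω (m + n))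
    (fun n => isOpen_levelFixer _) (fun n => rootFixer_le_levelFixer _)
    (fun _ h => mem_rootFixer_of_forall m h) τ (dense_rootFixer_mul_zpowers hγ hτ)
    (fun n i => zpow_mem_levelFixer_iff hγ hτ n i)

theorem cycTop_sup_adjoin_le_zlCompositum (hγ : IsCycGenerator m γ) {S : Set Ω}
    {φ : Gal(Ω/K) →* Multiplicative ℤ_[ℓ]} (hφ : Continuous φ)
    (h : ∀ g ∈ rootFixer ℓ K Ω, φ g = 1 → ∀ y ∈ S, g y = y) :
    cycTop ℓ K Ω ⊔ IntermediateField.adjoin K S ≤ zlCompositum ℓ K Ω := by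
  obtain ⟨κ, hκ, hκ1⟩ := exists_ker_le_rootFixer hγ
  refine sup_le (fun y hy => ?_) (IntermediateField.adjoin_le_iff.2 fun y hy => ?_)
  · exact mem_zlCompositum_of_fixed hφ hκ fun g _ hg => rootFixer_apply_cycTop (hκ1 g hg) ⟨y, hy⟩
  · exact mem_zlCompositum_of_fixed hφ hκ fun g hg hg' => h g (hκ1 g hg') hg y hy

end InitialRadical

/-! ### Norms and inclusions in the tower -/

section Layers

variable {ℓ} {K Ω : Type*} [Field K] [Field Ω] [Algebra K Ω]

/-- If `s` generates the Galois group of `B / A`, the norm from `B` to `A` is the product over the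
powers of `s`. -/
theorem inclusion_norm_eq_prod {C : Type*} [Field C] [Algebra K C] {A B : IntermediateField K C}
    (h : A ≤ B) [FiniteDimensional K B] [IsGalois K B] (s : B ≃ₐ[K] B)
    (hs : ∀ b : B, s b = b ↔ (b : C) ∈ A) (x : B) :
    letI : Algebra A B := (IntermediateField.inclusion h).toRingHom.toAlgebra
    ((Algebra.norm A x : A) : C) = ((∏ j ∈ Finset.range (orderOf s), (s ^ j) x : B) : C) := by
  let _ : Algebra A B := (IntermediateField.inclusion h).toRingHom.toAlgebra
  have hst : IsScalarTower K A B := IsScalarTower.of_algebraMap_eq fun _ => rfl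
  have hfd : FiniteDimensional A B := FiniteDimensional.right K _ _
  have hgal : IsGalois A B := IsGalois.tower_top_of_isGalois K _ _
  have hmap : ∀ y : A, ((algebraMap A B y : B) : C) = y := fun _ => rfl
  let t : B ≃ₐ[A] B := AlgEquiv.ofRingEquiv (f := s.toRingEquiv) fun y => (hs _).2 y.2
  have ht : ∀ (j : ℕ) (y : B), (t ^ j) y = (s ^ j) y := by
    intro j
    induction j with
    | zero => exact fun y => rfl
    | succ j ih => intro y; rw [pow_succ, pow_succ, AlgEquiv.mul_apply, AlgEquiv.mul_apply, ih]; rfl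
  have hord : orderOf t = orderOf s := orderOf_eq_orderOf_iff.2 fun n => by
    constructor
    · intro h1
      ext y
      rw [← ht, h1]; rfl
    · intro h1
      refine AlgEquiv.ext fun y => ?_
      rw [ht, h1]; rfl
  have hgen : ∀ σ, σ ∈ Subgroup.zpowers t := by
    have h1 : IntermediateField.fixedField (Subgroup.zpowers t) = ⊥ := by
      refine eq_bot_iff.2 fun b hb => ?_
      have h2 : t b = b := (IntermediateField.mem_fixedField_iff _ _).1 hb t
        (Subgroup.mem_zpowers t)
      exact IntermediateField.mem_bot.2 ⟨⟨b, (hs b).1 h2⟩, Subtype.ext rfl⟩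
    have h2 := IntermediateField.fixingSubgroup_fixedField (Subgroup.zpowers t)
    rw [h1, IntermediateField.fixingSubgroup_bot] at h2
    intro σ
    rw [← h2]
    exact Subgroup.mem_top σ
  rw [← hmap, Algebra.norm_eq_prod_automorphisms]
  classical
  congr 1
  rw [← IsCyclic.image_range_orderOf hgen, hord, Finset.prod_image]
  · exact Finset.prod_congr rfl fun j _ => ht j x
  · intro i hi j hj hij
    rw [Finset.mem_coe, Finset.mem_range, ← hord] at hi hj
    exact pow_injOn_Iio_orderOf hi hj hij

/-- The inclusion `A → B` of intermediate fields as a multiplicative map. -/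
def inclusionHom {C : Type*} [Field C] [Algebra K C] {A B : IntermediateField K C} (h : A ≤ B) :
    A →* B :=
  (IntermediateField.inclusion h : A →* B)

theorem coe_inclusionHom {C : Type*} [Field C] [Algebra K C] {A B : IntermediateField K C}
    (h : A ≤ B) (x : A) : (inclusionHom h x : C) = x := rfl

variable (ℓ K Ω) in
/-- The inclusion `K_n → K_{n+1}`. -/
def layerInclusion (m n : ℕ) : layer ℓ K Ω m n →* layer ℓ K Ω m (n + 1) :=
  inclusionHom (layer_le_succ ℓ K Ω m n)

theorem coe_layerInclusion (m n : ℕ) (x : layer ℓ K Ω m n) :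
    (layerInclusion ℓ K Ω m n x : cycTop ℓ K Ω) = x :=
  coe_inclusionHom (layer_le_succ ℓ K Ω m n) x

theorem layer_ext {m n : ℕ} {x y : layer ℓ K Ω m n}
    (h : ((x : cycTop ℓ K Ω) : Ω) = ((y : cycTop ℓ K Ω) : Ω)) : x = y :=
  Subtype.ext (Subtype.ext h)

section LayerVal

variable {E : IntermediateField K Ω} {A B : IntermediateField K E}

/-- The embedding in `Ω` of the multiplicative group of a subfield of a subfield of `Ω`, such as
`K_n ⊆ K_∞ ⊆ Ω`. -/
def layerVal : Aˣ →* Ω :=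
  ((algebraMap E Ω : E →* Ω).comp (algebraMap A E : A →* E)).comp (Units.coeHom A)

theorem layerVal_injective : Function.Injective (layerVal : Aˣ →* Ω) := fun _ _ h =>
  Units.ext (Subtype.ext (Subtype.ext h))

theorem layerVal_ne_zero (x : Aˣ) : layerVal x ≠ 0 :=
  ((Group.isUnit x).map layerVal).ne_zero

theorem layerVal_inclusionHom (h : A ≤ B) (x : Aˣ) :
    layerVal (Units.map (inclusionHom h) x) = layerVal x := rfl

end LayerVal

theorem layerVal_layerInclusion {m n : ℕ} (x : (layer ℓ K Ω m n)ˣ) :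
    layerVal (Units.map (layerInclusion ℓ K Ω m n) x) = layerVal x :=
  layerVal_inclusionHom (layer_le_succ ℓ K Ω m n) x

theorem finite_roots (R : Type*) [CommRing R] [IsDomain R] {N : ℕ} (hN : 0 < N) :
    {ζ : R | ζ ^ N = 1}.Finite :=
  (Polynomial.nthRootsFinset N (1 : R)).finite_toSet.subset fun _ hζ =>
    (Polynomial.mem_nthRootsFinset hN 1).2 hζ

variable [IsGalois K Ω]

instance finiteDimensional_layer (m n : ℕ) : FiniteDimensional K (layer ℓ K Ω m n) := by
  have hN : 0 < ℓ ^ (m + n) := pow_pos (Fact.out : ℓ.Prime).pos _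
  have : Finite {ζ : cycTop ℓ K Ω | ζ ^ ℓ ^ (m + n) = 1} := finite_roots _ hN
  exact IntermediateField.finiteDimensional_adjoin fun x hx =>
    IsIntegral.of_pow hN (by rw [show x ^ ℓ ^ (m + n) = 1 from hx]; exact isIntegral_one)

instance isGalois_layer (m n : ℕ) : IsGalois K (layer ℓ K Ω m n) := by
  have h1 : Normal K (layer ℓ K Ω m n) := by
    rw [IntermediateField.normal_iff_forall_map_le]
    intro σ
    rw [layer, IntermediateField.adjoin_map]
    refine IntermediateField.adjoin.mono _ _ _ ?_
    rintro _ ⟨ζ, hζ, rfl⟩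
    change (σ ζ) ^ ℓ ^ (m + n) = 1
    rw [← map_pow, show ζ ^ ℓ ^ (m + n) = 1 from hζ, map_one]
  exact ⟨⟩

variable [IsAlgClosed Ω] [CharZero Ω] {m : ℕ} {γ : Gal(cycTop ℓ K Ω/K)} {τ : Gal(Ω/K)}

theorem coe_actLayer_iterate (hτ : ∀ x : cycTop ℓ K Ω, τ (x : Ω) = (γ x : cycTop ℓ K Ω))
    (n i : ℕ) (x : layer ℓ K Ω m n) :
    (((actLayer m n γ)^[i] x : cycTop ℓ K Ω) : Ω) = (τ ^ i) ((x : cycTop ℓ K Ω) : Ω) := by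
  induction i with
  | zero => rfl
  | succ i ih =>
    rw [Function.iterate_succ_apply', pow_succ', AlgEquiv.mul_apply, ← ih, hτ]
    rfl

theorem actLayer_iterate_pow (hγ : IsCycGenerator m γ) (n : ℕ) (x : layer ℓ K Ω m n) :
    (actLayer m n γ)^[ℓ ^ n] x = x := by
  obtain ⟨τ, hτ⟩ := exists_lift_generator γ
  apply layer_ext
  rw [coe_actLayer_iterate hτ]
  exact levelFixer_apply_layer ((pow_mem_levelFixer_iff hγ hτ n _).2 dvd_rfl) x

theorem coe_restrictLayer_pow (γ : Gal(cycTop ℓ K Ω/K)) (n i j : ℕ) (x : layer ℓ K Ω m n) :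
    (restrictLayer m n (γ ^ i) ^ j) x = (actLayer m n γ)^[i * j] x := by
  have h1 : ∀ x : layer ℓ K Ω m n, restrictLayer m n (γ ^ i) x = (actLayer m n γ)^[i] x := by
    intro x
    apply Subtype.ext
    rw [coe_restrictLayer]
    induction i with
    | zero => rfl
    | succ i ih => rw [pow_succ', AlgEquiv.mul_apply, ih, Function.iterate_succ_apply']; rfl
  rw [Function.iterate_mul]
  induction j with
  | zero => rfl
  | succ j ih => rw [pow_succ', AlgEquiv.mul_apply, ih, Function.iterate_succ_apply', h1]

/-- The norm from `K_{n+1}` to `K_n` is the product over the powers of `γ ^ ℓ ^ n`, which generates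
the Galois group. -/
theorem layerInclusion_layerNorm (hγ : IsCycGenerator m γ) (n : ℕ) (x : layer ℓ K Ω m (n + 1)) :
    layerInclusion ℓ K Ω m n (layerNorm ℓ K Ω m n x) =
      ∏ j ∈ Finset.range ℓ, (actLayer m (n + 1) γ)^[ℓ ^ n * j] x := by
  have hp : ℓ.Prime := Fact.out
  obtain ⟨τ, hτ⟩ := exists_lift_generator γ
  have hs1 : ∀ y : layer ℓ K Ω m (n + 1), (((restrictLayer m (n + 1) (γ ^ ℓ ^ n) y :
      layer ℓ K Ω m (n + 1)) : cycTop ℓ K Ω) : Ω) = (τ ^ ℓ ^ n) ((y : cycTop ℓ K Ω) : Ω) := by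
    intro y
    have := coe_restrictLayer_pow γ (n + 1) (ℓ ^ n) 1 y
    rw [pow_one, mul_one] at this
    rw [this, coe_actLayer_iterate hτ]
  have hord : orderOf (restrictLayer m (n + 1) (γ ^ ℓ ^ n)) = ℓ := by
    refine orderOf_eq_prime (p := ℓ) ?_ ?_
    · refine AlgEquiv.ext fun y => ?_
      rw [coe_restrictLayer_pow, ← pow_succ]
      exact actLayer_iterate_pow hγ (n + 1) y
    · intro h
      obtain ⟨ξ, hξ⟩ := exists_primitive (ℓ := ℓ) (Ω := Ω) (m + (n + 1))
      obtain ⟨x, rfl⟩ := exists_layer_of_fixed (K := K) (n := n + 1) (y := ξ)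
        (fun g hg => hg _ hξ.pow_eq_one)
      have h1 := hs1 x
      rw [h] at h1
      have h2 := (mem_levelFixer_iff hξ).2 h1.symm
      rw [pow_mem_levelFixer_iff hγ hτ] at h2
      exact absurd ((Nat.pow_dvd_pow_iff_le_right hp.one_lt).1 h2) (by omega)
  apply Subtype.ext
  have h := inclusion_norm_eq_prod (layer_le_succ ℓ K Ω m n)
    (restrictLayer m (n + 1) (γ ^ ℓ ^ n)) (fun b => by
      constructor
      · intro hb
        have h1 := hs1 b
        rw [hb] at h1
        obtain ⟨y, hy⟩ := exists_layer_of_fixed (fixed_levelFixer_of_fixed hγ hτ (n := n)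
          (fun g hg => rootFixer_apply_cycTop hg (b : cycTop ℓ K Ω)) h1.symm)
        have h2 : (y : cycTop ℓ K Ω) = b := Subtype.ext hy
        rw [← h2]
        exact y.2
      · intro hb
        apply layer_ext
        rw [hs1]
        exact levelFixer_apply_layer ((pow_mem_levelFixer_iff hγ hτ n _).2 dvd_rfl) ⟨b, hb⟩) x
  rw [coe_layerInclusion]
  refine h.trans ?_
  rw [hord]
  congr 1
  exact Finset.prod_congr rfl fun j _ => coe_restrictLayer_pow γ (n + 1) (ℓ ^ n) j x

theorem starSubOne_layer_bijective (hγ : IsCycGenerator m γ) (n : ℕ) :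
    Function.Bijective (starSubOne ℓ ℚ_[ℓ] m (actLayer m n γ)) :=
  starSubOne_bijective ℓ hγ.ne_zero _ (pow_ne_zero n (Fact.out : ℓ.Prime).ne_zero)
    (actLayer_iterate_pow hγ n)

theorem mem_radicalInvariants_iff (hγ : IsCycGenerator m γ) {n : ℕ}
    {y : UniversalRadical ℓ (layer ℓ K Ω m n)} : y ∈ radicalInvariants m γ n ↔
      mapUnits ℓ (QlModZl ℓ) (actLayer m n γ) y = (1 + (ℓ : ℤ_[ℓ]) ^ m) • y :=
  starSubOne_eq_zero_iff ℓ hγ.ne_zero _ y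

theorem radicalOf_iterate (hγ : IsCycGenerator m γ) {n k : ℕ} {x : (layer ℓ K Ω m n)ˣ}
    (h : radicalOf ℓ k x ∈ radicalInvariants m γ n) (i : ℕ) :
    radicalOf ℓ k ((Units.map (actLayer m n γ))^[i] x) =
      (1 + (ℓ : ℤ_[ℓ]) ^ m) ^ i • radicalOf ℓ k x := by
  rw [mem_radicalInvariants_iff hγ, mapUnits_radicalOf] at h
  induction i with
  | zero => rw [pow_zero, one_smul]; rfl
  | succ i ih =>
    rw [Function.iterate_succ_apply', ← mapUnits_radicalOf, ih, map_smul, mapUnits_radicalOf, h,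
      smul_smul, pow_succ]

/-- The elements of `𝔕_{K_n}` fixed by `γ*` are killed by `ℓ ^ (m + n)`, so that they are
of the form `ℓ ^ (-(m + n)) ⊗ x`. -/
theorem exists_radicalOf_of_mem_radicalInvariants (hγ : IsCycGenerator m γ) {n : ℕ}
    {y : UniversalRadical ℓ (layer ℓ K Ω m n)} (h : y ∈ radicalInvariants m γ n) :
    ∃ x, y = radicalOf ℓ (m + n) x := by
  apply exists_radicalOf_of_pow_smul_eq_zero
  obtain ⟨k, x, rfl⟩ := exists_radicalOf_eq ℓ y
  have h1 := radicalOf_iterate hγ h (ℓ ^ n)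
  have h2 : (Units.map (actLayer m n γ))^[ℓ ^ n] x = x := Units.ext (by
    rw [coe_units_map_iterate, actLayer_iterate_pow hγ])
  obtain ⟨v, hv, hvn⟩ := exists_one_add_pow_eq (ℓ := ℓ) hγ.ne_zero hγ.add_two_le n
  have h3 : (1 + (ℓ : ℤ_[ℓ]) ^ m) ^ ℓ ^ n = 1 + ℓ ^ (m + n) * v := by exact_mod_cast hvn
  rw [h2, h3, add_smul, one_smul, left_eq_add, mul_comm, mul_smul] at h1
  exact (isUnit_natCast_padic hv).smul_eq_zero.1 h1

/-- On the elements fixed by `γ*` the norm from `K_{n+1}` to `K_n` is the multiplication by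
`∑ (1 + ℓ ^ m) ^ (ℓ ^ n j)`. -/
theorem mapUnits_layerInclusion_layerNorm (hγ : IsCycGenerator m γ) {n : ℕ}
    {y : UniversalRadical ℓ (layer ℓ K Ω m (n + 1))} (h : y ∈ radicalInvariants m γ (n + 1)) :
    mapUnits ℓ (QlModZl ℓ) (layerInclusion ℓ K Ω m n)
      (mapUnits ℓ (QlModZl ℓ) (layerNorm ℓ K Ω m n) y) =
      ((∑ j ∈ Finset.range ℓ, (1 + ℓ ^ m) ^ (ℓ ^ n * j) : ℕ) : ℤ_[ℓ]) • y := by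
  obtain ⟨k, x, rfl⟩ := exists_radicalOf_eq ℓ y
  have h1 : Units.map (layerInclusion ℓ K Ω m n) (Units.map (layerNorm ℓ K Ω m n) x) =
      ∏ j ∈ Finset.range ℓ, (Units.map (actLayer m (n + 1) γ))^[ℓ ^ n * j] x := by
    apply Units.ext
    rw [Units.coe_prod]
    simp_rw [coe_units_map_iterate]
    exact layerInclusion_layerNorm hγ n x
  have h2 : ∀ (s : Finset ℕ) (f : ℕ → (layer ℓ K Ω m (n + 1))ˣ),
      radicalOf ℓ k (∏ j ∈ s, f j) = ∑ j ∈ s, radicalOf ℓ k (f j) := by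
    intro s f
    induction s using Finset.cons_induction with
    | empty => rw [Finset.prod_empty, Finset.sum_empty, radicalOf, ofMul_one,
        TensorProduct.tmul_zero]
    | cons a s ha ih => rw [Finset.prod_cons, Finset.sum_cons, radicalOf_mul, ih]
  rw [mapUnits_radicalOf, mapUnits_radicalOf, h1, h2]
  push_cast
  rw [Finset.sum_smul]
  exact Finset.sum_congr rfl fun j _ => radicalOf_iterate hγ h _

/-- The map `𝔕_{K_n} → 𝔕_{K_{n+1}}` is injective: if `x = b ^ ℓ ^ k` with `b ∈ K_∞`, then
`γ ^ ℓ ^ n` multiplies `b` by a root of unity, which is also the factor by which it multiplies some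
root of unity `η`, as `γ ^ ℓ ^ n - 1` is surjective on the roots of unity of `ℓ`-power order. So
`b / η ∈ K_n`. -/
theorem mapUnits_layerInclusion_injective (hγ : IsCycGenerator m γ) (n : ℕ) :
    Function.Injective (mapUnits ℓ (QlModZl ℓ) (layerInclusion ℓ K Ω m n)) := by
  have hp : ℓ.Prime := Fact.out
  rw [injective_iff_map_eq_zero]
  intro y hy
  obtain ⟨τ, hτ⟩ := exists_lift_generator γ
  obtain ⟨k, x, rfl⟩ := exists_radicalOf_eq ℓ y
  rw [mapUnits_radicalOf] at hy
  obtain ⟨j, ζ, c, hζ, hc⟩ := exists_of_radicalOf_eq_zero ℓ hy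
  have hx0 : layerVal x ≠ 0 := layerVal_ne_zero x
  have hx : layerVal x = layerVal ζ * layerVal c ^ ℓ ^ k := by
    rw [← map_pow, ← map_mul, ← hc]
    exact (layerVal_layerInclusion x).symm
  have hζΩ : layerVal ζ ^ ℓ ^ j = 1 := by rw [← map_pow, hζ, map_one]
  obtain ⟨ξ, hξ⟩ := IsAlgClosed.exists_pow_nat_eq (layerVal ζ) (pow_pos hp.pos k)
  set b : Ω := ξ * layerVal c with hb
  have hbx : b ^ ℓ ^ k = layerVal x := by rw [hb, mul_pow, hξ, hx]
  have hξ1 : ξ ^ ℓ ^ (k + j) = 1 := by rw [pow_add, pow_mul, hξ, hζΩ]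
  have hb0 : b ≠ 0 := by
    intro h0
    rw [h0, zero_pow (pow_ne_zero _ hp.ne_zero)] at hbx
    exact hx0 hbx.symm
  have hbfix : ∀ g ∈ rootFixer ℓ K Ω, g b = b := fun g hg => by
    rw [hb, map_mul, hg _ _ hξ1]
    exact congrArg (ξ * ·) (rootFixer_apply_cycTop hg _)
  obtain ⟨v, hv, hvn⟩ := exists_one_add_pow_eq (ℓ := ℓ) hγ.ne_zero hγ.add_two_le n
  set ε : Ω := (τ ^ ℓ ^ n) b / b with hε
  have hτx : (τ ^ ℓ ^ n) (layerVal x) = layerVal x :=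
    levelFixer_apply_layer ((pow_mem_levelFixer_iff hγ hτ n _).2 dvd_rfl) _
  have hε1 : ε ^ ℓ ^ k = 1 := by
    rw [hε, div_pow, ← map_pow, hbx, hτx, div_self hx0]
  obtain ⟨v', hv'⟩ : ∃ v' : ℕ, v * v' ≡ 1 [MOD ℓ ^ k] := by
    have hcop : Nat.Coprime v (ℓ ^ k) := ((hp.coprime_iff_not_dvd.2 hv).symm.pow_right k)
    rcases k.eq_zero_or_pos with rfl | hk
    · exact ⟨0, by simp [Nat.modEq_one]⟩
    · obtain ⟨v', -, h⟩ := Nat.exists_mul_mod_eq_one_of_coprime hcop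
        (Nat.one_lt_pow hk.ne' hp.one_lt)
      exact ⟨v', h.trans (Nat.mod_eq_of_lt (Nat.one_lt_pow hk.ne' hp.one_lt)).symm⟩
  obtain ⟨η, hη⟩ := IsAlgClosed.exists_pow_nat_eq (ε ^ v') (pow_pos hp.pos (m + n))
  have hη1 : η ^ ℓ ^ (m + n + k) = 1 := by
    rw [pow_add, pow_mul, hη, ← pow_mul, mul_comm, pow_mul, hε1, one_pow]
  have hη0 : η ≠ 0 := by
    rintro rfl
    rw [zero_pow (pow_ne_zero _ hp.ne_zero)] at hη1
    exact zero_ne_one hη1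
  have hτη : (τ ^ ℓ ^ n) η = η * ε := by
    rw [pow_apply_root_of_lift hγ hτ hη1, hvn, pow_add, pow_one, pow_mul, hη, ← pow_mul,
      mul_comm v',
      pow_eq_pow_of_modEq hv' hε1, pow_one]
  have hfix : ∀ g ∈ levelFixer ℓ K Ω (m + n), g (b / η) = b / η := by
    refine fixed_levelFixer_of_fixed hγ hτ (fun g hg => ?_) ?_
    · rw [map_div₀, hbfix g hg, hg _ _ hη1]
    · rw [map_div₀, hτη, hε]
      field_simp
      exact div_self ((map_ne_zero _).2 hb0)
  obtain ⟨c', hc'⟩ := exists_unit_layer_of_fixed (div_ne_zero hb0 hη0) hfix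
  replace hc' : layerVal c' = b / η := hc'
  have hroot : (x / c' ^ ℓ ^ k) ^ ℓ ^ (m + n) = 1 := by
    apply layerVal_injective
    have h1 : layerVal (x / c' ^ ℓ ^ k) = η ^ ℓ ^ k := by
      have h2 : layerVal (x / c' ^ ℓ ^ k) * layerVal c' ^ ℓ ^ k = layerVal x := by
        rw [← map_pow, ← map_mul, div_mul_cancel]
      rw [hc', ← hbx, div_pow] at h2
      field_simp at h2
      exact h2
    rw [map_pow, h1, map_one, ← pow_mul, ← pow_add, add_comm, hη1]
  rw [← div_mul_cancel x (c' ^ ℓ ^ k), radicalOf_mul, radicalOf_torsion ℓ _ _ hroot,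
    radicalOf_pow_self, add_zero]

end Layers

/-! ### Powers of roots of unity with exponents in `ℤ_ℓ` -/

section PadicPow

variable {ℓ}

/-- The power `z ^ a` with an exponent `a ∈ ℤ_ℓ`, for an element `z` such that `z ^ ℓ ^ k = 1`.
The exponent is replaced by its representative `a.appr k` modulo `ℓ ^ k`. -/
noncomputable def padicPow {M : Type*} [Monoid M] (k : ℕ) (z : M) (a : ℤ_[ℓ]) : M := z ^ a.appr k

theorem pow_dvd_sub_appr (k : ℕ) (a : ℤ_[ℓ]) : (ℓ : ℤ_[ℓ]) ^ k ∣ a - a.appr k :=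
  Ideal.mem_span_singleton.1 (PadicInt.appr_spec k a)

section Monoid

variable {M : Type*} [Monoid M] {k : ℕ} {z : M}

theorem padicPow_eq_pow (hz : z ^ ℓ ^ k = 1) {a : ℤ_[ℓ]} {n : ℕ}
    (h : (ℓ : ℤ_[ℓ]) ^ k ∣ a - n) : padicPow k z a = z ^ n := by
  refine pow_eq_pow_of_dvd_sub hz ?_
  have := dvd_sub h (pow_dvd_sub_appr k a)
  rwa [sub_sub_sub_cancel_left] at this

theorem padicPow_zero (hz : z ^ ℓ ^ k = 1) : padicPow k z (0 : ℤ_[ℓ]) = 1 := by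
  rw [padicPow_eq_pow hz (n := 0) (by simp), pow_zero]

theorem padicPow_add (hz : z ^ ℓ ^ k = 1) (a b : ℤ_[ℓ]) :
    padicPow k z (a + b) = padicPow k z a * padicPow k z b := by
  rw [padicPow_eq_pow hz (n := a.appr k + b.appr k), pow_add]
  · rfl
  · have := dvd_add (pow_dvd_sub_appr k a) (pow_dvd_sub_appr k b)
    push_cast
    rwa [add_sub_add_comm]

theorem padicPow_natCast_mul (hz : z ^ ℓ ^ k = 1) (n : ℕ) (a : ℤ_[ℓ]) :
    padicPow k z ((n : ℤ_[ℓ]) * a) = padicPow k z a ^ n := by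
  rw [padicPow_eq_pow hz (n := a.appr k * n), pow_mul]
  · rfl
  · have := (pow_dvd_sub_appr k a).mul_left n
    push_cast
    rwa [mul_sub, mul_comm (n : ℤ_[ℓ]) (a.appr k : ℤ_[ℓ])] at this

theorem padicPow_succ {z' : M} (hz' : z' ^ ℓ ^ (k + 1) = 1) (h : z' ^ ℓ = z) (a : ℤ_[ℓ]) :
    padicPow (k + 1) z' a ^ ℓ = padicPow k z a := by
  have hz : z ^ ℓ ^ k = 1 := by rw [← h, ← pow_mul, ← pow_succ', hz']
  rw [padicPow_eq_pow hz ((pow_dvd_pow _ k.le_succ).trans (pow_dvd_sub_appr (k + 1) a)), padicPow,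
    ← pow_mul, mul_comm, pow_mul, h]

theorem map_padicPow {N F : Type*} [Monoid N] [FunLike F M N] [MonoidHomClass F M N] (f : F)
    (a : ℤ_[ℓ]) : f (padicPow k z a) = padicPow k (f z) a :=
  map_pow f z _

theorem padicPow_pow_eq_one (hz : z ^ ℓ ^ k = 1) (a : ℤ_[ℓ]) : padicPow k z a ^ ℓ ^ k = 1 := by
  rw [padicPow, ← pow_mul, mul_comm, pow_mul, hz, one_pow]

end Monoid

theorem dvd_sub_of_padicPow_eq {F : Type*} [Field F] {k : ℕ} {z : F}
    (hz : IsPrimitiveRoot z (ℓ ^ k)) {a b : ℤ_[ℓ]} (h : padicPow k z a = padicPow k z b) :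
    (ℓ : ℤ_[ℓ]) ^ k ∣ a - b := by
  have h1 := (primitive_pow_eq_iff hz).1 h
  have h2 : (ℓ : ℤ_[ℓ]) ^ k ∣ (a.appr k : ℤ_[ℓ]) - b.appr k := by
    have h3 := (PadicInt.pow_p_dvd_int_iff (p := ℓ) k ((a.appr k : ℤ) - b.appr k)).2
      (by exact_mod_cast (Nat.modEq_iff_dvd.1 h1.symm))
    exact_mod_cast h3
  have h3 := dvd_add (dvd_sub (pow_dvd_sub_appr k a) (pow_dvd_sub_appr k b)) h2
  convert h3 using 1
  ring

theorem eq_of_padicPow_eq {F : Type*} [Field F] {z : ℕ → F} (m : ℕ)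
    (hz : ∀ k, IsPrimitiveRoot (z k) (ℓ ^ k)) {a b : ℤ_[ℓ]}
    (h : ∀ n, padicPow (m + n) (z (m + n)) a = padicPow (m + n) (z (m + n)) b) : a = b :=
  sub_eq_zero.1 (padic_eq_zero fun k =>
    (pow_dvd_pow _ (Nat.le_add_left k m)).trans (dvd_sub_of_padicPow_eq (hz _) (h k)))

/-- By compactness of `ℤ_ℓ`, a compatible sequence of residues defines an `ℓ`-adic integer. -/
theorem exists_padic_limit (m : ℕ) (e : ℕ → ℕ)
    (h : ∀ n, (ℓ : ℤ_[ℓ]) ^ (m + n) ∣ (e (n + 1) : ℤ_[ℓ]) - e n) :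
    ∃ a : ℤ_[ℓ], ∀ n, (ℓ : ℤ_[ℓ]) ^ (m + n) ∣ a - e n := by
  have hcl : ∀ n, IsClosed {a : ℤ_[ℓ] | (ℓ : ℤ_[ℓ]) ^ (m + n) ∣ a - e n} := fun n =>
    (padic_isClosed_ideal (m + n)).preimage (continuous_sub_right (e n : ℤ_[ℓ]))
  have hanti : ∀ n, {a : ℤ_[ℓ] | (ℓ : ℤ_[ℓ]) ^ (m + (n + 1)) ∣ a - e (n + 1)} ⊆
      {a : ℤ_[ℓ] | (ℓ : ℤ_[ℓ]) ^ (m + n) ∣ a - e n} := fun n a ha => by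
    have h1 := dvd_add ((pow_dvd_pow (ℓ : ℤ_[ℓ]) (m + n).le_succ).trans ha) (h n)
    rwa [sub_add_sub_cancel] at h1
  obtain ⟨a, ha⟩ := IsCompact.nonempty_iInter_of_sequence_nonempty_isCompact_isClosed
    (fun n => {a : ℤ_[ℓ] | (ℓ : ℤ_[ℓ]) ^ (m + n) ∣ a - e n}) hanti
    (fun n => ⟨e n, by simp⟩) (hcl 0).isCompact hcl
  exact ⟨a, fun n => Set.mem_iInter.1 ha n⟩

/-- A compatible system of primitive roots of unity of `ℓ`-power order. -/
theorem exists_compatible_roots (Ω : Type*) [Field Ω] [IsAlgClosed Ω] [CharZero Ω] :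
    ∃ ζ : ℕ → Ω, (∀ k, IsPrimitiveRoot (ζ k) (ℓ ^ k)) ∧ ∀ k, ζ (k + 1) ^ ℓ = ζ k := by
  have hp : ℓ.Prime := Fact.out
  have hstep : ∀ (k : ℕ) (z : {z : Ω // IsPrimitiveRoot z (ℓ ^ k)}),
      ∃ w : {z : Ω // IsPrimitiveRoot z (ℓ ^ (k + 1))}, (w : Ω) ^ ℓ = z := by
    rintro k ⟨z, hz⟩
    rcases k with _ | k
    · obtain ⟨w, hw⟩ := exists_primitive (ℓ := ℓ) (Ω := Ω) 1
      refine ⟨⟨w, hw⟩, ?_⟩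
      rw [pow_zero, IsPrimitiveRoot.one_right_iff] at hz
      have := hw.pow_eq_one
      rw [pow_one] at this
      exact this.trans hz.symm
    · obtain ⟨w, hw⟩ := IsAlgClosed.exists_pow_nat_eq z hp.pos
      refine ⟨⟨w, IsPrimitiveRoot.iff_orderOf.2 (orderOf_eq_prime_pow ?_ ?_)⟩, hw⟩
      · rw [pow_succ', pow_mul, hw]
        exact hz.pow_ne_one_of_pos_of_lt (pow_ne_zero _ hp.ne_zero)
          (Nat.pow_lt_pow_right hp.one_lt k.lt_succ_self)
      · rw [pow_succ', pow_mul, hw, hz.pow_eq_one]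
  choose f hf using hstep
  let ζ : ∀ k, {z : Ω // IsPrimitiveRoot z (ℓ ^ k)} := fun k =>
    Nat.rec ⟨1, by rw [pow_zero]; exact IsPrimitiveRoot.one⟩ f k
  exact ⟨fun k => (ζ k).1, fun k => (ζ k).2, fun k => hf k (ζ k)⟩

end PadicPow

/-! ### Kummer theory over the cyclotomic tower -/

section Eigenvectors

/-- A case of Hilbert's theorem 90, proved with a Lagrange resolvent `∑ χ(q)⁻¹ q y` over
`q ∈ U / V`: a character of a group of automorphisms whose values are fixed by the group is the
character of an eigenvector, if it is trivial on an open subgroup. -/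
theorem exists_eigenvector {K Ω : Type*} [Field K] [Field Ω] [Algebra K Ω] [IsGalois K Ω]
    (U : Subgroup Gal(Ω/K)) (χ : U →* Ωˣ) (hfix : ∀ u v : U, (u : Gal(Ω/K)) (χ v : Ω) = χ v)
    (V : Subgroup Gal(Ω/K)) (hV : IsOpen (V : Set Gal(Ω/K)))
    (hχ : ∀ v : U, (v : Gal(Ω/K)) ∈ V → χ v = 1) :
    ∃ b : Ω, b ≠ 0 ∧ ∀ u : U, (u : Gal(Ω/K)) b = χ u * b := by
  let W : Subgroup U := V.subgroupOf U
  have hV' : Finite (Gal(Ω/K) ⧸ V) := Subgroup.quotient_finite_of_isOpen V hV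
  have hV'' : V.FiniteIndex := Subgroup.finiteIndex_of_finite_quotient
  have hfin : Finite (U ⧸ W) := inferInstance
  have := Fintype.ofFinite (U ⧸ W)
  let L := IntermediateField.fixedField V
  have hL : L.fixingSubgroup = V :=
    InfiniteGalois.fixingSubgroup_fixedField ⟨V, Subgroup.isClosed_of_isOpen V hV⟩
  let act : U ⧸ W → L →* Ω := fun q =>
    ((q.out : Gal(Ω/K)) : Ω →* Ω).comp (algebraMap L Ω : L →* Ω)
  have hact : ∀ q (y : L), act q y = (q.out : Gal(Ω/K)) (y : Ω) := fun q y => rfl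
  have hV1 : ∀ v ∈ V, ∀ y : L, v (y : Ω) = y := fun v hv y =>
    (IntermediateField.mem_fixedField_iff _ _).1 y.2 v hv
  have hinj : Function.Injective act := fun q q' h => by
    rw [← q.out_eq', ← q'.out_eq']
    refine QuotientGroup.eq.2 ?_
    rw [Subgroup.mem_subgroupOf, ← hL, IntermediateField.mem_fixingSubgroup_iff]
    intro y hy
    have h1 := DFunLike.congr_fun h ⟨y, hy⟩
    rw [hact, hact] at h1
    rw [Subgroup.coe_mul, Subgroup.coe_inv, AlgEquiv.mul_apply, ← h1, AlgEquiv.aut_inv,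
      AlgEquiv.symm_apply_apply]
  have hli := (linearIndependent_monoidHom L Ω).comp act hinj
  obtain ⟨y, hy⟩ : ∃ y : L, ∑ q, ((χ q.out)⁻¹ : Ωˣ) * act q y ≠ 0 := by
    by_contra! h
    have h1 := Fintype.linearIndependent_iff.1 hli (fun q => (((χ q.out)⁻¹ : Ωˣ) : Ω)) (by
      ext y
      simpa using h y) ((1 : U) : U ⧸ W)
    exact Units.ne_zero _ h1
  refine ⟨_, hy, fun u => ?_⟩
  have hχo : ∀ q : U ⧸ W, χ (u • q).out = χ u * χ q.out ∧
      act (u • q) y = (u : Gal(Ω/K)) (act q y) := by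
    intro q
    have h1 : (u * q.out)⁻¹ * (u • q).out ∈ W := by
      refine QuotientGroup.eq.1 ?_
      rw [QuotientGroup.out_eq']
      exact congrArg (fun p : U ⧸ W => u • p) q.out_eq'
    obtain ⟨w, hw⟩ : ∃ w : U, w = (u * q.out)⁻¹ * (u • q).out := ⟨_, rfl⟩
    rw [← hw] at h1
    have h2 : (u • q).out = u * q.out * w := by rw [hw, mul_inv_cancel_left]
    constructor
    · rw [h2, map_mul, hχ w h1, mul_one, map_mul]
    · rw [hact, hact, h2, Subgroup.coe_mul, Subgroup.coe_mul, AlgEquiv.mul_apply,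
        AlgEquiv.mul_apply, hV1 (w : Gal(Ω/K)) h1]
  rw [map_sum, Finset.mul_sum]
  refine Eq.trans ?_ (Equiv.sum_comp (MulAction.toPerm u) _)
  refine Finset.sum_congr rfl fun q _ => ?_
  rw [MulAction.toPerm_apply, (hχo q).1, (hχo q).2, map_mul]
  have h3 : (u : Gal(Ω/K)) (((χ q.out)⁻¹ : Ωˣ) : Ω) = ((χ q.out)⁻¹ : Ωˣ) := by
    rw [← map_inv]; exact hfix _ _
  rw [h3, mul_inv, Units.val_mul, mul_assoc, Units.mul_inv_cancel_left]

end Eigenvectors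

section KummerSequences

variable {ℓ} {K Ω : Type*} [Field K] [Field Ω] [Algebra K Ω] [IsGalois K Ω]

/-- The reduction modulo `ℓ ^ k` of a homomorphism to `ℤ_ℓ` is the Kummer character of an element,
over the field generated by the `ℓ ^ k`-th roots of unity. -/
theorem exists_kummer_element {k : ℕ} {z : Ω} (hz : IsPrimitiveRoot z (ℓ ^ k))
    {φ : Gal(Ω/K) →* Multiplicative ℤ_[ℓ]} (hφ : Continuous φ) :
    ∃ b : Ω, b ≠ 0 ∧ ∀ g ∈ levelFixer ℓ K Ω k, g b = padicPow k z (φ g).toAdd * b := by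
  have hN : ℓ ^ k ≠ 0 := pow_ne_zero _ (Fact.out : ℓ.Prime).ne_zero
  let w : Ωˣ := (hz.isUnit hN).unit
  have hw : w ^ ℓ ^ k = 1 := Units.ext hz.pow_eq_one
  have hwz : ∀ a : ℤ_[ℓ], ((padicPow k w a : Ωˣ) : Ω) = padicPow k z a := fun a =>
    map_padicPow (Units.coeHom Ω) a
  let χ : levelFixer ℓ K Ω k →* Ωˣ := MonoidHom.mk' (fun g => padicPow k w (φ g).toAdd)
    fun g h => by
      rw [← padicPow_add hw, ← toAdd_mul, ← map_mul]; rfl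
  let V : Subgroup Gal(Ω/K) :=
    (AddSubgroup.toSubgroup (Ideal.span {(ℓ : ℤ_[ℓ]) ^ k}).toAddSubgroup).comap φ
  have hmem : ∀ g, g ∈ V ↔ (ℓ : ℤ_[ℓ]) ^ k ∣ (φ g).toAdd := fun g =>
    Ideal.mem_span_singleton
  have hV : IsOpen (V : Set Gal(Ω/K)) := by
    have : (V : Set Gal(Ω/K)) = φ ⁻¹' {a : ℤ_[ℓ] | (ℓ : ℤ_[ℓ]) ^ k ∣ a} := Set.ext hmem
    rw [this]
    exact (padic_isOpen_ideal k).preimage hφ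
  obtain ⟨b, hb0, hb⟩ := exists_eigenvector _ χ (fun u v => by
    change (u : Gal(Ω/K)) ((padicPow k w (φ v).toAdd : Ωˣ) : Ω) = (padicPow k w (φ v).toAdd : Ωˣ)
    rw [hwz]
    exact u.2 _ (padicPow_pow_eq_one hz.pow_eq_one _)) V hV (fun v hv => by
      have : padicPow k w (φ v).toAdd = 1 := by
        rw [padicPow_eq_pow hw (n := 0), pow_zero]
        simpa using (hmem v).1 hv
      exact this)
  refine ⟨b, hb0, fun g hg => ?_⟩
  rw [hb ⟨g, hg⟩]
  exact congrArg (· * b) (hwz _)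

variable [IsAlgClosed Ω] [CharZero Ω] {m : ℕ} {γ : Gal(cycTop ℓ K Ω/K)} {τ : Gal(Ω/K)}

theorem apply_padicPow {k : ℕ} {z : Ω} (hz : z ^ ℓ ^ k = 1) {g : Gal(Ω/K)}
    (hg : g ∈ rootFixer ℓ K Ω) (a : ℤ_[ℓ]) : g (padicPow k z a) = padicPow k z a :=
  hg k _ (padicPow_pow_eq_one hz a)

/-- A sequence of elements `b n` that, up to factors in `K_∞`, are `ℓ ^ (m + n)`-th roots of
elements of `K_∞`, satisfy `b (n + 1) ^ ℓ = b n`, and are eigenvectors for the lift `τ` of `γ` with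
eigenvalue `1 + ℓ ^ m`, has a Kummer character that extends to a homomorphism from the absolute
Galois group of `K` to `ℤ_ℓ`. -/
theorem exists_hom_of_kummer_sequence (hγ : IsCycGenerator m γ)
    (hτ : ∀ x : cycTop ℓ K Ω, τ (x : Ω) = (γ x : cycTop ℓ K Ω))
    {ζ : ℕ → Ω} (hζ : ∀ k, IsPrimitiveRoot (ζ k) (ℓ ^ k)) (hζs : ∀ k, ζ (k + 1) ^ ℓ = ζ k)
    {b : ℕ → Ω} (hb0 : ∀ n, b n ≠ 0)
    (hpow : ∀ n, ∀ g ∈ rootFixer ℓ K Ω, g (b n ^ ℓ ^ (m + n)) = b n ^ ℓ ^ (m + n))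
    (hsucc : ∀ n, ∀ g ∈ rootFixer ℓ K Ω, g (b (n + 1) ^ ℓ / b n) = b (n + 1) ^ ℓ / b n)
    (hbτ : ∀ n, ∀ g ∈ rootFixer ℓ K Ω,
      g (τ (b n) / b n ^ (1 + ℓ ^ m)) = τ (b n) / b n ^ (1 + ℓ ^ m)) :
    ∃ φ : Gal(Ω/K) →* Multiplicative ℤ_[ℓ], Continuous φ ∧
      ∀ g ∈ rootFixer ℓ K Ω, ∀ n, g (b n) = padicPow (m + n) (ζ (m + n)) (φ g).toAdd * b n := by
  have hp : ℓ.Prime := Fact.out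
  have hζ1 : ∀ k, ζ k ^ ℓ ^ k = 1 := fun k => (hζ k).pow_eq_one
  have hex : ∀ g : rootFixer ℓ K Ω, ∃ a : ℤ_[ℓ], ∀ n,
      (g : Gal(Ω/K)) (b n) = padicPow (m + n) (ζ (m + n)) a * b n := by
    rintro ⟨g, hg⟩
    have h1 : ∀ n, ∃ e : ℕ, g (b n) = ζ (m + n) ^ e * b n := fun n => by
      have : NeZero (ℓ ^ (m + n)) := ⟨pow_ne_zero _ hp.ne_zero⟩
      obtain ⟨e, -, he⟩ := (hζ (m + n)).eq_pow_of_pow_eq_one (ξ := g (b n) / b n) (by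
        rw [div_pow, ← map_pow, hpow n g hg, div_self (pow_ne_zero _ (hb0 n))])
      exact ⟨e, by rw [he, div_mul_cancel₀ _ (hb0 n)]⟩
    choose e he using h1
    obtain ⟨a, ha⟩ := exists_padic_limit (ℓ := ℓ) m e (fun n => by
      have h2 := hsucc n g hg
      rw [map_div₀, map_pow, he, he, mul_pow, ← pow_mul, mul_comm (e (n + 1)), pow_mul,
        ← add_assoc, hζs, mul_div_mul_comm, mul_eq_right₀ (div_ne_zero
          (pow_ne_zero _ (hb0 _)) (hb0 n)), div_eq_one_iff_eq (pow_ne_zero _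
          ((hζ _).ne_zero (pow_ne_zero _ hp.ne_zero))), primitive_pow_eq_iff (hζ _)] at h2
      have h3 := (PadicInt.pow_p_dvd_int_iff (p := ℓ) (m + n) ((e (n + 1) : ℤ) - e n)).2
        (by exact_mod_cast (Nat.modEq_iff_dvd.1 h2.symm))
      exact_mod_cast h3)
    exact ⟨a, fun n => by rw [padicPow_eq_pow (hζ1 _) (ha n)]; exact he n⟩
  choose f hf using hex
  have huniq : ∀ (g : rootFixer ℓ K Ω) (a : ℤ_[ℓ]),
      (∀ n, (g : Gal(Ω/K)) (b n) = padicPow (m + n) (ζ (m + n)) a * b n) → f g = a :=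
    fun g a ha => eq_of_padicPow_eq m hζ fun n =>
      mul_right_cancel₀ (hb0 n) ((hf g n).symm.trans (ha n))
  let ψ : rootFixer ℓ K Ω →* Multiplicative ℤ_[ℓ] :=
    MonoidHom.mk' (fun g => Multiplicative.ofAdd (f g)) fun g h => by
      rw [← ofAdd_add]
      refine congrArg Multiplicative.ofAdd (huniq _ _ fun n => ?_)
      rw [Subgroup.coe_mul, AlgEquiv.mul_apply, hf h, map_mul, apply_padicPow (hζ1 _) g.2, hf g,
        padicPow_add (hζ1 _)]
      ring
  have hψ : ∀ g, (ψ g).toAdd = f g := fun g => rfl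
  have hconj : ∀ h, ψ (MulAut.conjNormal τ h) = ψ h := by
    -- compare two expressions for the image of `τ (b n)` under the conjugate of `h`
    intro h
    set g : rootFixer ℓ K Ω := MulAut.conjNormal τ h with hg
    have hgτ : ∀ y, (g : Gal(Ω/K)) (τ y) = τ ((h : Gal(Ω/K)) y) := fun y => by
      rw [hg, MulAut.conjNormal_apply, AlgEquiv.mul_apply, AlgEquiv.mul_apply, AlgEquiv.aut_inv,
        AlgEquiv.symm_apply_apply]
    have h0 : ((1 + ℓ ^ m : ℕ) : ℤ_[ℓ]) ≠ 0 := by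
      rw [Nat.cast_ne_zero]; omega
    refine congrArg Multiplicative.ofAdd (mul_left_cancel₀ h0 (eq_of_padicPow_eq m hζ fun n => ?_))
    have h1 := hbτ n _ g.2
    rw [map_div₀, hgτ, hf h, map_mul, map_pow, hf g, map_padicPow, apply_root_of_lift hγ hτ (hζ1 _),
      mul_pow, mul_div_mul_comm, mul_eq_right₀ (div_ne_zero ((map_ne_zero _).2 (hb0 n))
        (pow_ne_zero _ (hb0 _))), div_eq_one_iff_eq, padicPow, ← pow_mul,
        mul_comm (1 + ℓ ^ m), pow_mul] at h1
    · rw [padicPow_natCast_mul (hζ1 _), padicPow_natCast_mul (hζ1 _), ← h1]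
      rfl
    · exact pow_ne_zero _ (pow_ne_zero _ ((hζ _).ne_zero (pow_ne_zero _ hp.ne_zero)))
  have hcont : ∀ k : ℕ, ∃ V : Subgroup Gal(Ω/K), IsOpen (V : Set Gal(Ω/K)) ∧
      ∀ h : rootFixer ℓ K Ω, (h : Gal(Ω/K)) ∈ V → (ℓ : ℤ_[ℓ]) ^ k ∣ (ψ h).toAdd := by
    intro k
    refine ⟨MulAction.stabilizer Gal(Ω/K) (b k), stabilizer_isOpen_of_isIntegral (b k),
      fun h hh => ?_⟩
    have h1 : (h : Gal(Ω/K)) (b k) = b k := hh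
    rw [hf h, mul_eq_right₀ (hb0 k), ← padicPow_zero (hζ1 (m + k))] at h1
    have h2 := dvd_sub_of_padicPow_eq (hζ _) h1
    rw [sub_zero] at h2
    exact (pow_dvd_pow _ (Nat.le_add_left k m)).trans h2
  obtain ⟨φ, hφ, hφψ, -⟩ := exists_extension (rootFixer ℓ K Ω)
    (fun n => levelFixer ℓ K Ω (m + n)) (fun n => isOpen_levelFixer _)
    (fun n => rootFixer_le_levelFixer _) τ (dense_rootFixer_mul_zpowers hγ hτ)
    (fun n i => (zpow_mem_levelFixer_iff hγ hτ n i).1) ψ hconj hcont 1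
  exact ⟨φ, hφ, fun g hg n => by rw [hφψ ⟨g, hg⟩]; exact hf ⟨g, hg⟩ n⟩

end KummerSequences

/-! ### The initial radical and sequences of Kummer radicals -/

section InitialRadicalSequences

variable {ℓ} {K Ω : Type*} [Field K] [Field Ω] [Algebra K Ω] [IsGalois K Ω]
  [IsAlgClosed Ω] [CharZero Ω] {m n : ℕ} {γ : Gal(cycTop ℓ K Ω/K)} {τ : Gal(Ω/K)}

theorem levelFixer_apply_layerVal {g : Gal(Ω/K)} (hg : g ∈ levelFixer ℓ K Ω (m + n))
    (x : (layer ℓ K Ω m n)ˣ) : g (layerVal x) = layerVal x :=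
  levelFixer_apply_layer hg _

theorem rootFixer_apply_layerVal {g : Gal(Ω/K)} (hg : g ∈ rootFixer ℓ K Ω)
    (x : (layer ℓ K Ω m n)ˣ) : g (layerVal x) = layerVal x :=
  rootFixer_apply_cycTop hg _

theorem exists_layerVal_eq {y : Ω} (hy : y ≠ 0) (h : ∀ g ∈ levelFixer ℓ K Ω (m + n), g y = y) :
    ∃ x : (layer ℓ K Ω m n)ˣ, layerVal x = y :=
  exists_unit_layer_of_fixed hy h

theorem layerVal_actLayer (hτ : ∀ x : cycTop ℓ K Ω, τ (x : Ω) = (γ x : cycTop ℓ K Ω))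
    (x : (layer ℓ K Ω m n)ˣ) : layerVal (Units.map (actLayer m n γ) x) = τ (layerVal x) :=
  (hτ _).symm

/-- If `ℓ ^ (-k) ⊗ x` vanishes, the `ℓ ^ k`-th roots of `x` lie in `K_∞`. -/
theorem apply_eq_of_radicalOf_eq_zero {k : ℕ} {x : (layer ℓ K Ω m n)ˣ} (h : radicalOf ℓ k x = 0)
    {b : Ω} (hb : b ^ ℓ ^ k = layerVal x) {g : Gal(Ω/K)} (hg : g ∈ rootFixer ℓ K Ω) : g b = b := by
  obtain ⟨j, ξ, c, hξ, rfl⟩ := exists_of_radicalOf_eq_zero ℓ h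
  have hc := layerVal_ne_zero c
  have h1 : (b / layerVal c) ^ ℓ ^ (k + j) = 1 := by
    rw [pow_add, pow_mul, div_pow, hb, map_mul, map_pow,
      mul_div_cancel_right₀ _ (pow_ne_zero _ hc), ← map_pow, hξ, map_one]
  have h2 := hg _ _ h1
  rwa [map_div₀, rootFixer_apply_layerVal hg, div_left_inj' hc] at h2

theorem radicalOf_eq_zero_of_apply_eq {k : ℕ} {x : (layer ℓ K Ω m n)ˣ} {b : Ω}
    (hb : b ^ ℓ ^ k = layerVal x) (h : ∀ g ∈ levelFixer ℓ K Ω (m + n), g b = b) :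
    radicalOf ℓ k x = 0 := by
  have hb0 : b ≠ 0 := by
    rintro rfl
    rw [zero_pow (pow_ne_zero _ (Fact.out : ℓ.Prime).ne_zero)] at hb
    exact layerVal_ne_zero x hb.symm
  obtain ⟨c, hc⟩ := exists_layerVal_eq hb0 h
  have : x = c ^ ℓ ^ k := layerVal_injective (by rw [map_pow, hc, hb])
  rw [this, radicalOf_pow_self]

theorem radicalOf_div {F : Type*} [Field F] (k : ℕ) (x y : Fˣ) :
    radicalOf ℓ k (x / y) = radicalOf ℓ k x - radicalOf ℓ k y := by
  rw [eq_sub_iff_add_eq, ← radicalOf_mul, div_mul_cancel]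

theorem radicalOf_mem_radicalInvariants_iff (hγ : IsCycGenerator m γ) {k : ℕ}
    {x : (layer ℓ K Ω m n)ˣ} : radicalOf ℓ k x ∈ radicalInvariants m γ n ↔
      radicalOf ℓ k (Units.map (actLayer m n γ) x / x ^ (1 + ℓ ^ m)) = 0 := by
  rw [mem_radicalInvariants_iff hγ, mapUnits_radicalOf, radicalOf_div, radicalOf_pow, sub_eq_zero]
  push_cast
  rfl

theorem mapUnits_layerInclusion_radicalOf_eq_iff {k : ℕ} {x : (layer ℓ K Ω m n)ˣ}
    {x' : (layer ℓ K Ω m (n + 1))ˣ} :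
    mapUnits ℓ (QlModZl ℓ) (layerInclusion ℓ K Ω m n) (radicalOf ℓ k x) =
      (ℓ : ℤ_[ℓ]) • radicalOf ℓ (k + 1) x' ↔
    radicalOf ℓ k (x' / Units.map (layerInclusion ℓ K Ω m n) x) = 0 := by
  have h := pow_smul_radicalOf ℓ k 1 x'
  rw [pow_one] at h
  rw [h, mapUnits_radicalOf, radicalOf_div, sub_eq_zero, eq_comm]

theorem mem_levelFixer_base (hγ : IsCycGenerator m γ) (g : Gal(Ω/K)) :
    g ∈ levelFixer ℓ K Ω (m + 0) := fun ξ hξ => by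
  obtain ⟨y, rfl⟩ := hγ.mem_range ξ hξ
  exact g.commutes y

/-- The element `ℓ ^ (-m) ⊗ x` of the initial radical is the initial term of a sequence of
elements `y n ∈ 𝔕_{K_n}` fixed by `γ*` such that `y n = ℓ • y (n + 1)`: the Kummer character of `x`
lifts to a homomorphism `φ` to `ℤ_ℓ`, and `y n` is the element whose Kummer character is the
reduction of `φ` modulo `ℓ ^ (m + n)`. -/
theorem exists_sequence_of_mem_initialRadical (hγ : IsCycGenerator m γ) {z : UniversalRadical ℓ K}
    (hz : z ∈ initialRadical ℓ K Ω m) :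
    ∃ y : ∀ n, UniversalRadical ℓ (layer ℓ K Ω m n), y 0 = toLayerZero ℓ K Ω m z ∧
      (∀ n, y n ∈ radicalInvariants m γ n) ∧
      ∀ n, mapUnits ℓ (QlModZl ℓ) (layerInclusion ℓ K Ω m n) (y n) = (ℓ : ℤ_[ℓ]) • y (n + 1) := by
  have hp : ℓ.Prime := Fact.out
  obtain ⟨x, hxZ, rfl⟩ := hz
  obtain ⟨τ, hτ⟩ := exists_lift_generator γ
  obtain ⟨ζ, hζ, hζs⟩ := exists_compatible_roots (ℓ := ℓ) Ω
  have hζ1 : ∀ k, ζ k ^ ℓ ^ k = 1 := fun k => (hζ k).pow_eq_one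
  obtain ⟨β, hβ⟩ := IsAlgClosed.exists_pow_nat_eq (algebraMap K Ω x) (pow_pos hp.pos m)
  have hβ0 : β ≠ 0 := by
    rintro rfl
    rw [zero_pow (pow_ne_zero _ hp.ne_zero)] at hβ
    exact (map_ne_zero (algebraMap K Ω)).2 x.ne_zero hβ.symm
  obtain ⟨φ, hφ, hφβ⟩ := exists_hom_of_mem_zlCompositum hγ (hζ m) hβ
    (hxZ ((le_sup_right : IntermediateField.adjoin K _ ≤ _)
      (IntermediateField.subset_adjoin K _ hβ)))
  replace hφβ : ∀ g, g β = padicPow m (ζ m) (φ g).toAdd * β := fun g =>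
    hφβ g _ (pow_dvd_sub_appr m _)
  choose b hb0 hb using fun n => exists_kummer_element (hζ (m + n)) hφ
  have hbpow : ∀ n, ∀ g ∈ levelFixer ℓ K Ω (m + n), g (b n ^ ℓ ^ (m + n)) = b n ^ ℓ ^ (m + n) := by
    intro n g hg
    rw [map_pow, hb n g hg, mul_pow, padicPow_pow_eq_one (hζ1 _), one_mul]
  choose x' hx' using fun n => exists_layerVal_eq (pow_ne_zero (ℓ ^ (m + n)) (hb0 n)) (hbpow n)
  refine ⟨fun n => radicalOf ℓ (m + n) (x' n), ?_, fun n => ?_, fun n => ?_⟩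
  · let ι : K →* layer ℓ K Ω m 0 := (algebraMap K (layer ℓ K Ω m 0) : K →* layer ℓ K Ω m 0)
    change radicalOf ℓ m (x' 0) = radicalOf ℓ m (Units.map ι x)
    rw [← sub_eq_zero, ← radicalOf_div]
    have hιx : layerVal (Units.map ι x) = algebraMap K Ω x := rfl
    refine radicalOf_eq_zero_of_apply_eq (b := b 0 / β) ?_ fun g hg => ?_
    · rw [map_div, div_pow, hβ, hιx, hx' 0, add_zero]
    · rw [map_div₀, hb 0 g hg, hφβ]
      exact mul_div_mul_left _ _ fun h0 => one_ne_zero <| by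
        rw [← padicPow_pow_eq_one (hζ1 m) (φ g).toAdd,
          show padicPow m (ζ m) (φ g).toAdd = 0 from h0, zero_pow (pow_ne_zero _ hp.ne_zero)]
  · rw [radicalOf_mem_radicalInvariants_iff hγ]
    refine radicalOf_eq_zero_of_apply_eq (b := τ (b n) / b n ^ (1 + ℓ ^ m)) ?_ fun g hg => ?_
    · rw [map_div, layerVal_actLayer hτ, map_pow, hx', div_pow, map_pow, ← pow_mul, ← pow_mul,
        mul_comm (1 + _)]
    · have hconj : τ⁻¹ * g * τ ∈ levelFixer ℓ K Ω (m + n) := by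
        simpa using (levelFixer_normal (m + n)).conj_mem g hg τ⁻¹
      have h1 : g (τ (b n)) = τ ((τ⁻¹ * g * τ) (b n)) := by
        rw [AlgEquiv.mul_apply, AlgEquiv.mul_apply, AlgEquiv.aut_inv, AlgEquiv.apply_symm_apply]
      have h2 : φ (τ⁻¹ * g * τ) = φ g := by
        rw [map_mul, map_mul, mul_right_comm, ← map_mul, inv_mul_cancel, map_one, one_mul]
      rw [map_div₀, h1, hb n _ hconj, h2, map_mul, map_padicPow, apply_root_of_lift hγ hτ (hζ1 _),
        map_pow, hb n g hg, mul_pow, padicPow, ← pow_mul, mul_comm (1 + _), pow_mul]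
      exact mul_div_mul_left _ _ (pow_ne_zero _ (pow_ne_zero _
        ((hζ _).ne_zero (pow_ne_zero _ hp.ne_zero))))
  · refine mapUnits_layerInclusion_radicalOf_eq_iff.2
      (radicalOf_eq_zero_of_apply_eq (b := b (n + 1) ^ ℓ / b n) ?_ fun g hg => ?_)
    · rw [map_div, layerVal_layerInclusion, hx', hx', div_pow, ← pow_mul, ← pow_succ', add_assoc]
    · rw [map_div₀, map_pow, hb _ g hg, hb n g (levelFixer_succ_le _ hg), mul_pow]
      have h3 := padicPow_succ (hζ1 (m + n + 1)) (hζs (m + n)) (φ g).toAdd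
      rw [show m + (n + 1) = m + n + 1 from rfl, h3]
      exact mul_div_mul_left _ _ (pow_ne_zero _ ((hζ _).ne_zero (pow_ne_zero _ hp.ne_zero)))

/-- Conversely, the Kummer characters of such a sequence define a homomorphism to `ℤ_ℓ` that
lifts the Kummer character of the initial term. -/
theorem mem_initialRadical_of_sequence (hγ : IsCycGenerator m γ)
    {y : ∀ n, UniversalRadical ℓ (layer ℓ K Ω m n)}
    (hy : ∀ n, y n ∈ radicalInvariants m γ n)
    (hyι : ∀ n, mapUnits ℓ (QlModZl ℓ) (layerInclusion ℓ K Ω m n) (y n) =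
      (ℓ : ℤ_[ℓ]) • y (n + 1)) :
    y 0 ∈ toLayerZero ℓ K Ω m '' initialRadical ℓ K Ω m := by
  have hp : ℓ.Prime := Fact.out
  obtain ⟨τ, hτ⟩ := exists_lift_generator γ
  obtain ⟨ζ, hζ, hζs⟩ := exists_compatible_roots (ℓ := ℓ) Ω
  choose x hx using fun n => exists_radicalOf_of_mem_radicalInvariants hγ (hy n)
  choose b hb using fun n => IsAlgClosed.exists_pow_nat_eq (layerVal (x n))
    (pow_pos hp.pos (m + n))
  have hb0 : ∀ n, b n ≠ 0 := fun n h0 => layerVal_ne_zero (x n) (by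
    rw [← hb, h0, zero_pow (pow_ne_zero _ hp.ne_zero)])
  obtain ⟨φ, hφ, hφb⟩ := exists_hom_of_kummer_sequence hγ hτ hζ hζs hb0
    (fun n g hg => by rw [hb, rootFixer_apply_layerVal hg])
    (fun n g hg => by
      have h1 := hyι n
      rw [hx, hx] at h1
      refine apply_eq_of_radicalOf_eq_zero (mapUnits_layerInclusion_radicalOf_eq_iff.1 h1) ?_ hg
      rw [map_div, layerVal_layerInclusion, ← hb, ← hb, div_pow, ← pow_mul, ← pow_succ', add_assoc])
    (fun n g hg => by
      have h1 := hy n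
      rw [hx, radicalOf_mem_radicalInvariants_iff hγ] at h1
      refine apply_eq_of_radicalOf_eq_zero h1 ?_ hg
      rw [map_div, layerVal_actLayer hτ, map_pow, ← hb, div_pow, map_pow, ← pow_mul, ← pow_mul,
        mul_comm (1 + _)])
  obtain ⟨x₀, hx₀⟩ : ∃ x₀ : K, algebraMap K Ω x₀ = layerVal (x 0) :=
    (InfiniteGalois.mem_range_algebraMap_iff_fixed _).2 fun g =>
      levelFixer_apply_layerVal (mem_levelFixer_base hγ g) _
  have hx₀0 : x₀ ≠ 0 := by
    rintro rfl
    exact layerVal_ne_zero (x 0) (by rw [← hx₀, map_zero])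
  refine ⟨_, ⟨Units.mk0 x₀ hx₀0, ?_, rfl⟩, ?_⟩
  · refine cycTop_sup_adjoin_le_zlCompositum hγ hφ fun g hg hg1 w hw => ?_
    have hw' : w ^ ℓ ^ m = b 0 ^ ℓ ^ m := by
      rw [show w ^ ℓ ^ m = algebraMap K Ω x₀ from hw, hx₀, ← hb, add_zero]
    have h1 : (w / b 0) ^ ℓ ^ m = 1 := by
      rw [div_pow, hw', div_self (pow_ne_zero _ (hb0 0))]
    have h2 := hg _ _ h1
    have h3 := hφb g hg 0
    rw [hg1, toAdd_one, padicPow_zero (hζ _).pow_eq_one, one_mul] at h3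
    rwa [map_div₀, h3, div_left_inj' (hb0 0)] at h2
  · rw [hx 0]
    let ι : K →* layer ℓ K Ω m 0 := (algebraMap K (layer ℓ K Ω m 0) : K →* layer ℓ K Ω m 0)
    change radicalOf ℓ m (Units.map ι (Units.mk0 x₀ hx₀0)) = radicalOf ℓ m (x 0)
    congr 1
    exact layerVal_injective hx₀

end InitialRadicalSequences

/-! ### Norm-compatible sequences -/

section NormCompatible

variable {ℓ} {K Ω : Type*} [Field K] [Field Ω] [Algebra K Ω] {m : ℕ} {γ : Gal(cycTop ℓ K Ω/K)}

theorem mapUnits_layerNorm_mem {n : ℕ} {y : UniversalRadical ℓ (layer ℓ K Ω m (n + 1))}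
    (hy : y ∈ radicalInvariants m γ (n + 1)) :
    mapUnits ℓ (QlModZl ℓ) (layerNorm ℓ K Ω m n) y ∈ radicalInvariants m γ n := by
  have h : starSubOne ℓ (QlModZl ℓ) m (actLayer m (n + 1) γ) y = 0 := hy
  have h1 := mapUnits_starSubOne ℓ (QlModZl ℓ) m _ _ _ (actLayer_comp_layerNorm m n γ) y
  rw [h, map_zero] at h1
  exact h1.symm

variable [IsGalois K Ω] [IsAlgClosed Ω] [CharZero Ω]

/-- The units of `ℤ_ℓ` that appear in the formula for the norm on the elements fixed by `γ*`. -/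
theorem exists_units_norm (hγ : IsCycGenerator m γ) :
    ∃ u : ℕ → ℤ_[ℓ]ˣ, ∀ (n : ℕ) (y : UniversalRadical ℓ (layer ℓ K Ω m (n + 1))),
      y ∈ radicalInvariants m γ (n + 1) →
      mapUnits ℓ (QlModZl ℓ) (layerInclusion ℓ K Ω m n)
        (mapUnits ℓ (QlModZl ℓ) (layerNorm ℓ K Ω m n) y) = (ℓ : ℤ_[ℓ]) • (u n : ℤ_[ℓ]) • y := by
  choose u hu hsum using exists_sum_pow_eq (ℓ := ℓ) hγ.ne_zero hγ.add_two_le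
  refine ⟨fun n => (isUnit_natCast_padic (hu n)).unit, fun n y hy => ?_⟩
  rw [mapUnits_layerInclusion_layerNorm hγ hy, hsum, Nat.cast_mul, mul_smul]
  rfl

/-- Up to units of `ℤ_ℓ`, the sequences of elements `y n ∈ 𝔕_{K_n}` fixed by `γ*` such that
`y n = ℓ • y (n + 1)` are the norm-compatible sequences, because the norm of an element fixed by
`γ*` is the product of the element by `ℓ` and a unit. So the initial radical consists of the initial
terms of the norm-compatible sequences. -/
theorem mem_image_initialRadical_iff (hγ : IsCycGenerator m γ)
    (z : UniversalRadical ℓ (layer ℓ K Ω m 0)) :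
    z ∈ toLayerZero ℓ K Ω m '' initialRadical ℓ K Ω m ↔
      ∃ y : ∀ n, UniversalRadical ℓ (layer ℓ K Ω m n), y 0 = z ∧
        (∀ n, y n ∈ radicalInvariants m γ n) ∧
        ∀ n, mapUnits ℓ (QlModZl ℓ) (layerNorm ℓ K Ω m n) (y (n + 1)) = y n := by
  obtain ⟨u, hu⟩ := exists_units_norm hγ
  let w : ℕ → ℤ_[ℓ]ˣ := fun n => Nat.rec (1 : ℤ_[ℓ]ˣ) (fun n w => w * (u n)⁻¹) n
  have hw : ∀ n, (w (n + 1) : ℤ_[ℓ]) * (u n : ℤ_[ℓ]) = (w n).val := fun n => by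
    rw [← Units.val_mul]
    exact congrArg Units.val (inv_mul_cancel_right (w n) (u n))
  have hw' : ∀ n, (((w n)⁻¹ : ℤ_[ℓ]ˣ) : ℤ_[ℓ]) * u n = ((w (n + 1))⁻¹ : ℤ_[ℓ]ˣ) := fun n => by
    rw [← Units.val_mul]
    refine congrArg Units.val ?_
    change (w n)⁻¹ * u n = (w n * (u n)⁻¹)⁻¹
    rw [mul_inv, inv_inv]
  constructor
  · rintro ⟨z, hz, rfl⟩
    obtain ⟨y, hy0, hy, hyι⟩ := exists_sequence_of_mem_initialRadical hγ hz
    refine ⟨fun n => (w n).val • y n, ?_, fun n => Submodule.smul_mem _ _ (hy n), fun n => ?_⟩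
    · change (1 : ℤ_[ℓ]) • y 0 = _
      rw [one_smul, hy0]
    · apply mapUnits_layerInclusion_injective hγ n
      rw [hu n _ (Submodule.smul_mem _ _ (hy (n + 1))), map_smul, hyι, ← hw n, smul_smul, smul_smul,
        smul_smul]
      ring_nf
  · rintro ⟨y, rfl, hy, hyN⟩
    have := mem_initialRadical_of_sequence hγ (y := fun n => (w n)⁻¹.val • y n)
      (fun n => Submodule.smul_mem _ _ (hy n)) (fun n => by
        rw [← hyN n, map_smul, hu n _ (hy (n + 1)), ← hw' n, smul_smul, smul_smul, smul_smul]
        ring_nf)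
    change (((1 : ℤ_[ℓ]ˣ)⁻¹ : ℤ_[ℓ]ˣ) : ℤ_[ℓ]) • y 0 ∈ _ at this
    rwa [inv_one, Units.val_one, one_smul] at this

theorem exists_connecting_layer (hγ : IsCycGenerator m γ) (n : ℕ) :
    ∃ δ : radicalInvariants m γ n ≃ₗ[ℤ_[ℓ]] LayerQuotient m γ n,
      ∀ (y : radicalInvariants m γ n) (v : RationalIdeles ℓ (layer ℓ K Ω m n))
        (r : PrincipalIdeles ℓ (layer ℓ K Ω m n)), toRadical ℓ _ v = y →
        starSubOne ℓ ℚ_[ℓ] m (actLayer m n γ) v = toRational ℓ _ r →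
        δ y = Submodule.Quotient.mk r :=
  exists_connecting ℓ m (actLayer m n γ) (starSubOne_layer_bijective hγ n)

/-- The snake lemma for `γ* - 1` at every layer, and its compatibility with the norms. -/
theorem exists_connecting_layers (hγ : IsCycGenerator m γ) :
    ∃ δ : ∀ n : ℕ, radicalInvariants m γ n ≃ₗ[ℤ_[ℓ]] LayerQuotient m γ n,
      (∀ (n : ℕ) (y : radicalInvariants m γ n) (v : RationalIdeles ℓ (layer ℓ K Ω m n))
        (r : PrincipalIdeles ℓ (layer ℓ K Ω m n)), toRadical ℓ _ v = y →
        starSubOne ℓ ℚ_[ℓ] m (actLayer m n γ) v = toRational ℓ _ r →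
        δ n y = Submodule.Quotient.mk r) ∧
      ∀ (n : ℕ) (y : radicalInvariants m γ (n + 1)),
        δ n ⟨_, mapUnits_layerNorm_mem y.2⟩ = quotientNorm m γ n (δ (n + 1) y) := by
  choose δ hδ using fun n => exists_connecting_layer hγ n
  refine ⟨δ, hδ, fun n y => ?_⟩
  obtain ⟨v, hv⟩ := toRadical_surjective ℓ (y : UniversalRadical ℓ (layer ℓ K Ω m (n + 1)))
  obtain ⟨r, hr⟩ := (toRadical_eq_zero_iff ℓ
    (starSubOne ℓ ℚ_[ℓ] m (actLayer m (n + 1) γ) v)).1 (by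
      rw [toRadical_starSubOne, hv]
      exact y.2)
  rw [hδ (n + 1) y v r hv hr.symm]
  refine hδ n _ (mapUnits ℓ ℚ_[ℓ] (layerNorm ℓ K Ω m n) v)
    (mapUnits ℓ ℤ_[ℓ] (layerNorm ℓ K Ω m n) r) ?_ ?_
  · rw [toRadical_mapUnits, hv]
  · rw [← mapUnits_starSubOne ℓ ℚ_[ℓ] m _ _ _ (actLayer_comp_layerNorm m n γ),
      toRational_mapUnits, hr]

theorem image_initialRadical_eq (hγ : IsCycGenerator m γ)
    (δ : ∀ n : ℕ, radicalInvariants m γ n ≃ₗ[ℤ_[ℓ]] LayerQuotient m γ n)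
    (hδ : ∀ (n : ℕ) (y : radicalInvariants m γ (n + 1)),
      δ n ⟨_, mapUnits_layerNorm_mem y.2⟩ = quotientNorm m γ n (δ (n + 1) y)) :
    toLayerZero ℓ K Ω m '' initialRadical ℓ K Ω m =
      (fun c => ((δ 0).symm c : UniversalRadical ℓ (layer ℓ K Ω m 0))) ''
        (initialTerms m γ : Set (LayerQuotient m γ 0)) := by
  refine Set.ext fun z => ?_
  rw [mem_image_initialRadical_iff hγ]
  constructor
  · rintro ⟨y, rfl, hy, hyN⟩
    refine ⟨δ 0 ⟨y 0, hy 0⟩, ⟨fun n => δ n ⟨y n, hy n⟩, fun n => ?_, rfl⟩, ?_⟩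
    · rw [← hδ]
      exact congrArg (δ n) (Subtype.ext (hyN n))
    · exact congrArg Subtype.val ((δ 0).symm_apply_apply _)
  · rintro ⟨_, ⟨c, hc, rfl⟩, rfl⟩
    refine ⟨fun n => (δ n).symm (c n), rfl, fun n => Subtype.prop _, fun n => ?_⟩
    have h1 := hδ n ((δ (n + 1)).symm (c (n + 1)))
    rw [LinearEquiv.apply_symm_apply, show quotientNorm m γ n (c (n + 1)) = c n from
      hc n, ← LinearEquiv.eq_symm_apply] at h1
    exact congrArg Subtype.val h1

end NormCompatible

/-! ### Fields that contain the `2ℓ`-th roots of unity -/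

section BaseField

variable {ℓ}

/-- The group of roots of unity of `ℓ`-power order of `K` is cyclic, so it contains an element of
order `ℓ ^ m`; the `2ℓ`-th roots of unity give `m ≥ 1`, and `m ≥ 2` if `ℓ = 2`. -/
theorem isCycGenerator_of_isPrimitiveRoot {K Ω : Type*} [Field K] [Field Ω] [Algebra K Ω]
    [CharZero K] (hK : ∃ ζ : K, IsPrimitiveRoot ζ (2 * ℓ)) {m : ℕ}
    (hm : Nat.card (CommGroup.primaryComponent Kˣ ℓ) = ℓ ^ m) {γ : Gal(cycTop ℓ K Ω/K)}
    (hγ : ∀ (k : ℕ) (ζ : cycTop ℓ K Ω), ζ ^ ℓ ^ k = 1 → γ ζ = ζ ^ (1 + ℓ ^ m)) :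
    IsCycGenerator m γ := by
  have hp : ℓ.Prime := Fact.out
  have hN : 0 < ℓ ^ m := pow_pos hp.pos m
  set T := CommGroup.primaryComponent Kˣ ℓ
  have hfin : Finite T := Nat.finite_of_card_ne_zero (by rw [hm]; exact hN.ne')
  have hcyc : IsCyclic T := isCyclic_of_injective_ringHom
    ((Units.coeHom K).comp T.subtype) fun a b h => Subtype.ext (Units.ext h)
  have hdvd : ∀ (k : ℕ) (ζ : K), IsPrimitiveRoot ζ (ℓ ^ k) → k ≤ m := by
    intro k ζ hζ
    obtain ⟨u, rfl⟩ := hζ.isUnit (pow_ne_zero _ hp.ne_zero)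
    rw [IsPrimitiveRoot.coe_units_iff] at hζ
    have h1 : u ∈ T := ⟨k, hζ.pow_eq_one⟩
    have h2 : orderOf (⟨u, h1⟩ : T) ∣ ℓ ^ m := hm ▸ orderOf_dvd_natCard _
    rw [Subgroup.orderOf_mk, ← hζ.eq_orderOf] at h2
    exact (Nat.pow_dvd_pow_iff_le_right hp.one_lt).1 h2
  obtain ⟨ζ, hζ⟩ := hK
  refine ⟨?_, ?_, ?_, hγ⟩
  · have := hdvd 1 (ζ ^ 2) (by
      rw [pow_one]
      exact hζ.pow (by have := hp.pos; omega) rfl)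
    omega
  · rcases hp.eq_two_or_odd' with rfl | hodd
    · have := hdvd 2 ζ hζ
      omega
    · have h1 := hdvd 1 (ζ ^ 2) (by
        rw [pow_one]
        exact hζ.pow (by have := hp.pos; omega) rfl)
      have h3 : 3 ≤ ℓ := by
        have := hp.two_le
        rcases hodd with ⟨k, hk⟩
        omega
      nlinarith
  · obtain ⟨t, ht⟩ := hcyc.exists_generator
    have hord : orderOf ((t : Kˣ) : K) = ℓ ^ m := by
      rw [orderOf_units, Subgroup.orderOf_coe, orderOf_eq_card_of_forall_mem_zpowers ht, hm]
    have hprim : IsPrimitiveRoot (algebraMap K Ω (t : Kˣ)) (ℓ ^ m) :=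
      (IsPrimitiveRoot.iff_orderOf.2 hord).map_of_injective (algebraMap K Ω).injective
    intro ξ hξ
    have : NeZero (ℓ ^ m) := ⟨hN.ne'⟩
    obtain ⟨i, -, rfl⟩ := hprim.eq_pow_of_pow_eq_one hξ
    exact ⟨_, map_pow _ _ _⟩

end BaseField

end CycloKummer

theorem mainTheorem2 (ℓ : ℕ) [Fact ℓ.Prime] (K Ω : Type*) [Field K] [NumberField K]
    [Field Ω] [Algebra K Ω] [IsAlgClosure K Ω]
    (hK : ∃ ζ : K, IsPrimitiveRoot ζ (2 * ℓ))
    (m : ℕ) (hm : Nat.card (CommGroup.primaryComponent Kˣ ℓ) = ℓ ^ m)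
    (γ : Gal(CycloKummer.cycTop ℓ K Ω/K))
    (hγ : ∀ (k : ℕ) (ζ : CycloKummer.cycTop ℓ K Ω), ζ ^ ℓ ^ k = 1 → γ ζ = ζ ^ (1 + ℓ ^ m)) :
    (∀ n : ℕ, Function.Bijective
      (CycloKummer.starSubOne ℓ ℚ_[ℓ] m (CycloKummer.actLayer m n γ))) ∧
    ∃ δ : ∀ n : ℕ, CycloKummer.radicalInvariants m γ n ≃ₗ[ℤ_[ℓ]]
        CycloKummer.LayerQuotient m γ n,
      -- `δ n` is the connecting map of the snake lemma
      (∀ (n : ℕ) (y : CycloKummer.radicalInvariants m γ n)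
        (v : CycloKummer.RationalIdeles ℓ (CycloKummer.layer ℓ K Ω m n))
        (r : CycloKummer.PrincipalIdeles ℓ (CycloKummer.layer ℓ K Ω m n)),
        CycloKummer.toRadical ℓ _ v = y →
        CycloKummer.starSubOne ℓ ℚ_[ℓ] m (CycloKummer.actLayer m n γ) v =
          CycloKummer.toRational ℓ _ r →
        δ n y = Submodule.Quotient.mk r) ∧
      -- the maps `δ n` are compatible with the norms
      (∀ (n : ℕ) (y : CycloKummer.radicalInvariants m γ (n + 1)),
        ∃ h : CycloKummer.mapUnits ℓ (CycloKummer.QlModZl ℓ)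
            (CycloKummer.layerNorm ℓ K Ω m n) y ∈ CycloKummer.radicalInvariants m γ n,
          δ n ⟨_, h⟩ = CycloKummer.quotientNorm m γ n (δ (n + 1) y)) ∧
      -- `δ 0` identifies the initial radical with the initial terms of the projective limit
      CycloKummer.toLayerZero ℓ K Ω m '' CycloKummer.initialRadical ℓ K Ω m =
        (fun c => ((δ 0).symm c : CycloKummer.UniversalRadical ℓ (CycloKummer.layer ℓ K Ω m 0))) ''
          (CycloKummer.initialTerms m γ : Set (CycloKummer.LayerQuotient m γ 0)) := by
  have hΩc : IsAlgClosed Ω := IsAlgClosure.isAlgClosed K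
  have hΩa : Algebra.IsAlgebraic K Ω := IsAlgClosure.isAlgebraic
  have hΩ0 : CharZero Ω := charZero_of_injective_algebraMap (algebraMap K Ω).injective
  have hΩn : Normal K Ω := IsAlgClosure.normal K Ω
  have hΩs : Algebra.IsSeparable K Ω := Algebra.IsAlgebraic.isSeparable_of_perfectField
  have hΩg : IsGalois K Ω := ⟨⟩
  have hgen := CycloKummer.isCycGenerator_of_isPrimitiveRoot hK hm hγ
  obtain ⟨δ, hδ, hN⟩ := CycloKummer.exists_connecting_layers hgen
  exact ⟨CycloKummer.starSubOne_layer_bijective hgen, δ, hδ,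
    fun n y => ⟨CycloKummer.mapUnits_layerNorm_mem y.2, hN n y⟩,
    CycloKummer.image_initialRadical_eq hgen δ hN⟩
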